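/- Let $\phi,\psi:\mathbb R\to\mathbb R$ be square integrable and integrable, let $M\ge1$ and $T\ge1$ be integers and $\alpha>1$, and put $\hat g(\xi)=\int_{\mathbb R} g(t)e^{-i\xi t}\,dt$. Assume: * $\phi$ and $\psi$ are supported in $(-T,0)$ and $(0,T)$ respectively, $\int\phi=1$ and $\int\psi^2=1$; * $\sup_{\xi}|\hat\psi(\xi)|(1+|\xi|)^{\alpha}<\infty$; * $\int t^m\psi(t)\,dt=0$ for $m=0,\dots,M-1$; * for $m=0,\dots,M-1$, the function $t\mapsto\sum_{k\in\mathbb Z}k^m\phi(t-k)$ is (almost everywhere equal to) a polynomial of degree $m$. For $0<\beta\le2$ and $L>0$, let $\mathcal H(\beta,L)$ be the set of even non-negative functions $g$ on $[-\pi,\pi]$ with $|g(\lambda)-g(0)|\le L\,g(0)|\lambda|^\beta$ for all $\lambda\in[-\pi,\pi]$. Let $f^*\in\mathcal H(\beta,L)$ and $d\in((1+\beta)/2-\alpha,\,M]$. Let $X=\{X_k\}_{k\in\mathbb Z}$ be a real Gaussian process with memory parameter $d$ and generalized spectral density $|1-e^{-i\lambda}|^{-2d}f^*(\lambda)$. That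 is, $f^*$ is non-negative, symmetric and bounded on $(-\pi,\pi)$ and bounded away from $0$ near the origin, and for every integer $K\ge0$ with $K>d-1/2$ the $K$-th order difference $\Delta^KX$, where $(\Delta X)_k=X_k-X_{k-1}$, is weakly stationary with spectral density $g_K(\lambda)=|1-e^{-i\lambda}|^{2(K-d)}f^*(\lambda)$, in the sense that $\mathrm{Cov}((\Delta^KX)_k,(\Delta^KX)_l)=\int_{-\pi}^{\pi}e^{i\lambda(k-l)}g_K(\lambda)\,d\lambda$. Assume moreover that $\Delta^MX$ has mean zero. For $j\ge0$ and $k\in\mathbb Z$ let $$W_{j,k}=\int_{\mathbb R}\Big(\sum_{l\in\mathbb Z}X_l\,\phi(t-l)\Big)\,2^{-j/2}\psi(2^{-j}t-k)\,dt .$$ For a sample size $n$ let $n_j$ be the integer part of $2^{-j}(n-T+1)-T+1$ (and $n_j=0$ if this number is negative), and let $\hat v_j=n_j^{-1}\sum_{k=0}^{n_j-1}W_{j,k}^2$. Let $\ell\ge1$ and let $\mathbf w=(w_0,\dots,w_\ell)^T\in\mathbb R^{\ell+1}$ satisfy $\sum_{i=0}^{\ell} w_i=0$ and $2\log(2)\sum_{i=0}^{\ell}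 i\,w_i=1$. Let $J_0(n)\ge0$ be a sequence of integers such that the number $m=m(n)=\sum_{j=J_0(n)}^{J_0(n)+\ell}n_j$ of wavelet coefficients used satisfies $m\to\infty$ and $m/n\to0$ as $n\to\infty$, and put $$\hat d_n(\mathbf w)=\sum_{i=0}^{\ell}w_i\log\hat v_{J_0(n)+i}.$$ Then $\hat d_n(\mathbf w)$ is square integrable for all large $n$, and $$\lim_{n\to\infty}m\,\mathrm{Var}\big[\hat d_n(\mathbf w)\big]=(2-2^{-\ell})\,\mathbf w^T\mathbf V(d)\,\mathbf w ,$$ where $\mathbf V(d)$ is the $(1+\ell)\times(1+\ell)$ matrix with entries $$\mathbf V_{i,j}(d)=\frac{4\pi\,2^{2d|i-j|}\,2^{i\wedge j}}{\mathrm K(d)^2}\int_{-\pi}^{\pi}\big|\mathbf D_{\infty,|i-j|}(\lambda;d)\big|^2\,d\lambda,\qquad 0\le i,j\le\ell,$$ $|\cdot|$ is the Euclidean norm on $\mathbb C^{2^u}$, $\mathrm K(d)=\int_{\mathbb R}|\xi|^{-2d}|\hat\psi(\xi)|^2\,d\xi$ and, for $u\ge0$, $$\mathbf D_{\infty,u}(\lambda;d)=\sum_{l\in\mathbb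 Z}|\lambda+2l\pi|^{-2d}\,\mathbf e_u(\lambda+2l\pi)\,\overline{\hat\psi(\lambda+2l\pi)}\,\hat\psi\big(2^{-u}(\lambda+2l\pi)\big),$$ $$\mathbf e_u(\xi)=2^{-u/2}\big(e^{-iv2^{-u}\xi}\big)_{v=0,\dots,2^u-1}\in\mathbb C^{2^u}.$$ -/

import Mathlib

open MeasureTheory ProbabilityTheory Filter Topology

namespace WaveletRegression

noncomputable section

/-- Fourier transform with the convention `∫ g(t) exp(-i ξ t) dt`. -/
def fourierT (g : ℝ → ℝ) (ξ : ℝ) : ℂ :=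
  ∫ t : ℝ, (g t : ℂ) * Complex.exp (-(Complex.I * ξ * t))

/-- The assumptions on the scaling function `φ` and the wavelet `ψ` (with `M` vanishing moments,
Fourier decay exponent `α`), the supports being normalized to lie in `(-T, 0)` and `(0, T)`. -/
structure WaveletAssumptions (φ ψ : ℝ → ℝ) (M : ℕ) (α : ℝ) (T : ℕ) : Prop where
  memLp_phi : MemLp φ 2 volume
  memLp_psi : MemLp ψ 2 volume
  integrable_phi : Integrable φ volume
  integrable_psi : Integrable ψ volume
  support_phi : Function.support φ ⊆ Set.Ioo (-(T : ℝ)) 0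
  support_psi : Function.support ψ ⊆ Set.Ioo 0 (T : ℝ)
  integral_phi : ∫ t, φ t = 1
  integral_psi_sq : ∫ t, ψ t ^ 2 = 1
  decay_psi : ∃ C : ℝ, ∀ ξ : ℝ, ‖fourierT ψ ξ‖ * (1 + |ξ|) ^ α ≤ C
  vanishing_moments : ∀ m < M, ∫ t, t ^ m * ψ t = 0
  polynomial_phi : ∀ m < M, ∃ p : Polynomial ℝ, p.degree = m ∧
    ∀ᵐ t : ℝ, ∑' k : ℤ, (k : ℝ) ^ m * φ (t - k) = p.eval t

/-- The class `H(β, L)` of functions on `[-π, π]` (values outside `[-π, π]` are irrelevant). -/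
def classH (β L : ℝ) : Set (ℝ → ℝ) :=
  {g | ∀ x ∈ Set.Icc (-Real.pi) Real.pi,
    0 ≤ g x ∧ g (-x) = g x ∧ |g x - g 0| ≤ L * g 0 * |x| ^ β}

section Processes

variable {Ω : Type*} [MeasurableSpace Ω]

/-- First order difference `(Δ X)_k = X_k - X_{k-1}`. -/
def diff (X : ℤ → Ω → ℝ) : ℤ → Ω → ℝ := fun k ω => X k ω - X (k - 1) ω

/-- `K`-th order difference. -/
def diffIter (K : ℕ) (X : ℤ → Ω → ℝ) : ℤ → Ω → ℝ := diff^[K] X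

/-- `Y` is weakly stationary with spectral density `g`:
`Cov(Y_k, Y_l) = ∫_{-π}^{π} exp(i x (k - l)) g(x) dx`. -/
structure HasSpectralDensity (Y : ℤ → Ω → ℝ) (P : Measure Ω) (g : ℝ → ℝ) : Prop where
  memLp : ∀ k, MemLp (Y k) 2 P
  mean_const : ∀ k l, ∫ ω, Y k ω ∂P = ∫ ω, Y l ω ∂P
  integrableOn : IntegrableOn g (Set.Ioo (-Real.pi) Real.pi) volume
  cov_eq : ∀ k l : ℤ, ((covariance (Y k) (Y l) P : ℝ) : ℂ) =
    ∫ x in (-Real.pi)..Real.pi, Complex.exp (Complex.I * x * ((k : ℂ) - (l : ℂ))) * (g x : ℂ)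

/-- `X` has memory parameter `d`, with short-memory part `fstar` of its generalized spectral
density `|1 - exp(-i x)|^(-2d) fstar(x)`. -/
structure HasMemoryParameter (X : ℤ → Ω → ℝ) (P : Measure Ω) (d : ℝ) (fstar : ℝ → ℝ) : Prop where
  nonneg : ∀ x ∈ Set.Ioo (-Real.pi) Real.pi, 0 ≤ fstar x
  even : ∀ x ∈ Set.Ioo (-Real.pi) Real.pi, fstar (-x) = fstar x
  bounded : ∃ B : ℝ, ∀ x ∈ Set.Ioo (-Real.pi) Real.pi, fstar x ≤ B
  bounded_below : ∃ c > 0, ∃ ε > 0, ∀ x : ℝ, |x| < ε → c ≤ fstar x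
  spectral : ∀ K : ℕ, d - 1 / 2 < (K : ℝ) →
    HasSpectralDensity (diffIter K X) P
      (fun x => ‖1 - Complex.exp (-(Complex.I * x))‖ ^ (2 * ((K : ℝ) - d)) * fstar x)

end Processes

/-- `ψ_{j,k}(t) = 2^(-j/2) ψ(2^(-j) t - k)`. -/
def psiJK (ψ : ℝ → ℝ) (j : ℕ) (k : ℤ) (t : ℝ) : ℝ :=
  (2 : ℝ) ^ (-(j : ℝ) / 2) * ψ ((2 : ℝ) ^ (-(j : ℝ)) * t - k)

/-- Wavelet coefficient at scale `j` and location `k` of the sequence `x`. -/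
def waveletCoeff (φ ψ : ℝ → ℝ) (x : ℤ → ℝ) (j : ℕ) (k : ℤ) : ℝ :=
  ∫ t : ℝ, (∑' l : ℤ, x l * φ (t - l)) * psiJK ψ j k t

/-- Number `n_j` of available wavelet coefficients at scale `j` from `n` observations
(`0` if there is none). -/
def numCoeff (T n j : ℕ) : ℕ :=
  ⌊(2 : ℝ) ^ (-(j : ℝ)) * ((n : ℝ) - T + 1) - T + 1⌋₊

/-- Total number `m` of wavelet coefficients at the scales `J, …, J + ℓ`. -/
def totalCoeff (T ℓ n J : ℕ) : ℕ := ∑ j ∈ Finset.Icc J (J + ℓ), numCoeff T n j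

/-- Empirical variance of the available wavelet coefficients at scale `j`. -/
def empVar (φ ψ : ℝ → ℝ) (T : ℕ) (x : ℤ → ℝ) (n j : ℕ) : ℝ :=
  (numCoeff T n j : ℝ)⁻¹ * ∑ k ∈ Finset.range (numCoeff T n j), waveletCoeff φ ψ x j (k : ℤ) ^ 2

/-- The log-scale regression estimator of the memory parameter, with lower scale `J`. -/
def dHat (φ ψ : ℝ → ℝ) (T : ℕ) {ℓ : ℕ} (w : Fin (ℓ + 1) → ℝ) (x : ℤ → ℝ) (n J : ℕ) : ℝ :=
  ∑ i : Fin (ℓ + 1), w i * Real.log (empVar φ ψ T x n (J + i))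

/-- `K(d) = ∫ |ξ|^(-2d) |ψ̂(ξ)|² dξ`. -/
def Kpsi (ψ : ℝ → ℝ) (d : ℝ) : ℝ :=
  ∫ ξ : ℝ, |ξ| ^ (-2 * d) * ‖fourierT ψ ξ‖ ^ 2

/-- The unit vector `e_u(ξ)` with entries `2^(-u/2) exp(-i v 2^(-u) ξ)`, `0 ≤ v < 2^u`. -/
def eVec (u : ℕ) (ξ : ℝ) : EuclideanSpace ℂ (Fin (2 ^ u)) :=
  WithLp.toLp 2 fun v =>
    (((2 : ℝ) ^ (-(u : ℝ) / 2) : ℝ) : ℂ) *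
      Complex.exp (-(Complex.I * ((v : ℕ) : ℂ) * (((2 : ℝ) ^ (-(u : ℝ)) * ξ : ℝ) : ℂ)))

/-- The summand of `D_{∞,u}` at frequency `ξ`. -/
def dInftyTerm (ψ : ℝ → ℝ) (u : ℕ) (d ξ : ℝ) : EuclideanSpace ℂ (Fin (2 ^ u)) :=
  (((|ξ| ^ (-2 * d) : ℝ) : ℂ) * starRingEnd ℂ (fourierT ψ ξ) *
    fourierT ψ ((2 : ℝ) ^ (-(u : ℝ)) * ξ)) • eVec u ξ

/-- The limiting (cross) spectral density `D_{∞,u}(x; d)`. -/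
def dInfty (ψ : ℝ → ℝ) (u : ℕ) (x d : ℝ) : EuclideanSpace ℂ (Fin (2 ^ u)) :=
  ∑' l : ℤ, dInftyTerm ψ u d (x + 2 * l * Real.pi)

/-- The matrix `V(d)`. -/
def asympVar (ψ : ℝ → ℝ) (ℓ : ℕ) (d : ℝ) : Matrix (Fin (ℓ + 1)) (Fin (ℓ + 1)) ℝ :=
  Matrix.of fun i j =>
    4 * Real.pi * (2 : ℝ) ^ (2 * d * (Nat.dist i j : ℝ)) * 2 ^ (min (i : ℕ) (j : ℕ)) /
        Kpsi ψ d ^ 2 *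
      ∫ x in (-Real.pi)..Real.pi, ‖dInfty ψ (Nat.dist i j) x d‖ ^ 2

end

end WaveletRegression

/-! The proof is a delta method for Gaussian arrays combined with a spectral computation. Let s_i be
the common variance of the wavelet coefficients at scale J₀ + i and write the empirical variance as
s_i q_i. Up to a constant, the estimator is the linear part Σ w_i (q_i - 1) plus the remainder Σ w_i
(log q_i - (q_i - 1)).

The remainder is negligible: m E(log q - (q - 1))² → 0. Away from q = 0 this is Taylor's formula,
with E(q - 1)⁴ ≤ C (E(q - 1)²)² for Gaussian quadratic forms (`integral_quadraticForm_pow_four_le`).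
Near q = 0, where log is unbounded, Jensen's inequality bounds |log q| by an average of logarithms
of squared Gaussians, which has a universal sixth moment (`log_quadraticForm`).
`tendsto_variance_sum_log` concludes that only the variance of the linear part matters, and by the
Gaussian identity Cov(U², V²) = 2 Cov(U, V)² this is a double sum of squared covariances of wavelet
coefficients.

For the covariances, wavelet coefficients are finite filters of X divisible by the M-th order
difference, hence have a spectral representation (`covariance_waveletCoeff`). For locations 2^u q +
v at scale j and l at scale j + u, the covariance is 2^(2d(j+u)) times the Fourier coefficient of
index q - l of an explicit kernel on ℝ (`integral_waveletCoeff_mul`). By Poisson summation the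
kernel converges pointwise to f*(0) times the conjugate of coordinate v of the summand of D_{∞,u}.
It is dominated by C (1 + |η|)^(-(2α + 2d)), and 2α + 2d > 1 by the lower bound on d. Parseval's
identity for the periodized kernel then gives the limit of the sum over all r = q - l of the squared
coefficients (`tendsto_spectralCoeff`, `sum_tsum_eq_integral_dInfty`).

It remains to count. Since m is of order 2^(-J₀) n, the condition m/n → 0 forces J₀ → ∞, so the
limit in j applies. A Cesàro argument (`tendsto_avg_sum_sub`) replaces the double sum by the sum
over r, and m / n_{J₀+i} → 2^i (2 - 2^(-ℓ)) supplies the remaining constants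
(`tendsto_covariance_sum`). -/

namespace WaveletRegression

/-! ### Moments of Gaussian variables and of independent sums. -/

section Moments

open scoped ENNReal NNReal

variable {Ω : Type*} [MeasurableSpace Ω] {P : Measure Ω}

/-- Random variables with finite moments of all orders. -/
def AllMoments (U : Ω → ℝ) (P : Measure Ω) : Prop := ∀ p : ℝ≥0∞, p ≠ ∞ → MemLp U p P

lemma AllMoments.memLp_two {U : Ω → ℝ} (h : AllMoments U P) : MemLp U 2 P := h 2 (by simp)

lemma AllMoments.integrable {U : Ω → ℝ} (h : AllMoments U P) : Integrable U P :=
  memLp_one_iff_integrable.1 (h 1 (by simp))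

lemma AllMoments.add {U V : Ω → ℝ} (hU : AllMoments U P) (hV : AllMoments V P) :
    AllMoments (fun ω => U ω + V ω) P := fun p hp => (hU p hp).add (hV p hp)

lemma AllMoments.sub {U V : Ω → ℝ} (hU : AllMoments U P) (hV : AllMoments V P) :
    AllMoments (fun ω => U ω - V ω) P := fun p hp => (hU p hp).sub (hV p hp)

lemma AllMoments.const [IsFiniteMeasure P] (c : ℝ) : AllMoments (fun _ : Ω => c) P :=
  fun _ _ => memLp_const c

lemma AllMoments.mul {U V : Ω → ℝ} (hU : AllMoments U P) (hV : AllMoments V P) :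
    AllMoments (fun ω => U ω * V ω) P := fun p hp => by
  have : ENNReal.HolderTriple (2 * p) (2 * p) p := ⟨by
    rw [ENNReal.mul_inv (by simp) (by simp), ← add_mul, ENNReal.inv_two_add_inv_two, one_mul]⟩
  exact (hV (2 * p) (ENNReal.mul_ne_top (by simp) hp)).mul
    (hU (2 * p) (ENNReal.mul_ne_top (by simp) hp))

lemma AllMoments.const_mul {U : Ω → ℝ} (hU : AllMoments U P) (c : ℝ) :
    AllMoments (fun ω => c * U ω) P := fun p hp => (hU p hp).const_mul c

lemma AllMoments.pow [IsFiniteMeasure P] {U : Ω → ℝ} (hU : AllMoments U P) (n : ℕ) :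
    AllMoments (fun ω => U ω ^ n) P := by
  induction n with
  | zero => simpa using AllMoments.const 1
  | succ n ih => simpa [pow_succ] using ih.mul hU

lemma AllMoments.sum {ι : Type*} {s : Finset ι} {U : ι → Ω → ℝ}
    (hU : ∀ i ∈ s, AllMoments (U i) P) : AllMoments (fun ω => ∑ i ∈ s, U i ω) P :=
  fun p hp => memLp_finsetSum _ fun i hi => hU i hi p hp

lemma AllMoments.of_hasGaussianLaw {U : Ω → ℝ} (h : HasGaussianLaw U P) : AllMoments U P :=
  fun _ hp => h.memLp hp

/-- Integrability of products with independent factors and the factorisation of the mean. -/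
lemma integral_pow_mul_pow_of_indepFun [IsFiniteMeasure P] {U V : Ω → ℝ}
    (hU : AllMoments U P) (hV : AllMoments V P) (h : IndepFun U V P) (a b : ℕ) :
    ∫ ω, U ω ^ a * V ω ^ b ∂P = (∫ ω, U ω ^ a ∂P) * ∫ ω, V ω ^ b ∂P := by
  have := (h.comp (φ := fun x : ℝ => x ^ a) (ψ := fun x : ℝ => x ^ b) (by fun_prop)
    (by fun_prop)).integral_mul_eq_mul_integral (hU.pow a).integrable.aestronglyMeasurable
    (hV.pow b).integrable.aestronglyMeasurable
  simpa using this

/-- Fourth moments of sums of independent centred variables. -/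
lemma integral_sum_pow_four_le [IsProbabilityMeasure P] {ι : Type*}
    {U : ι → Ω → ℝ} {C : ℝ} (hC : 3 ≤ C) (hU : ∀ i, AllMoments (U i) P) (hind : iIndepFun U P)
    (hmean : ∀ i, ∫ ω, U i ω ∂P = 0)
    (h4 : ∀ i, ∫ ω, U i ω ^ 4 ∂P ≤ C * (∫ ω, U i ω ^ 2 ∂P) ^ 2) (s : Finset ι) :
    ∫ ω, (∑ i ∈ s, U i ω) ^ 4 ∂P ≤ C * (∫ ω, (∑ i ∈ s, U i ω) ^ 2 ∂P) ^ 2 := by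
  classical
  induction s using Finset.induction with
  | empty => simp
  | insert i s his ih =>
    set S : Ω → ℝ := fun ω => ∑ i ∈ s, U i ω with hS
    have hSm : AllMoments S P := AllMoments.sum fun i _ => hU i
    have hSU : IndepFun S (U i) P := by
      have h1 := hind.indepFun_finsetSum_of_notMem₀
        (fun i => (hU i).integrable.aestronglyMeasurable.aemeasurable) his
      have h2 : (∑ j ∈ s, U j) = S := by ext ω; simp [hS]
      rwa [h2] at h1
    have hS0 : ∫ ω, S ω ∂P = 0 := by
      rw [hS, integral_finsetSum _ fun i _ => (hU i).integrable]
      simp [hmean]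
    have e1 := integral_pow_mul_pow_of_indepFun hSm (hU i) hSU 3 1
    have e2 := integral_pow_mul_pow_of_indepFun hSm (hU i) hSU 2 2
    have e3 := integral_pow_mul_pow_of_indepFun hSm (hU i) hSU 1 3
    have e4 := integral_pow_mul_pow_of_indepFun hSm (hU i) hSU 1 1
    simp only [pow_one, hS0, hmean i, mul_zero, zero_mul] at e1 e3 e4
    have I : ∀ a b, Integrable (fun ω => S ω ^ a * U i ω ^ b) P := fun a b =>
      ((hSm.pow a).mul ((hU i).pow b)).integrable
    have I31 := I 3 1
    have I13 := I 1 3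
    have I11 := I 1 1
    simp only [pow_one] at I31 I13 I11
    have E4 : ∫ ω, (∑ j ∈ insert i s, U j ω) ^ 4 ∂P = ∫ ω, S ω ^ 4 ∂P +
        6 * ((∫ ω, S ω ^ 2 ∂P) * ∫ ω, U i ω ^ 2 ∂P) + ∫ ω, U i ω ^ 4 ∂P := by
      have : ∀ ω, (∑ j ∈ insert i s, U j ω) ^ 4 = S ω ^ 4 + (4 * (S ω ^ 3 * U i ω)
          + (6 * (S ω ^ 2 * U i ω ^ 2) + (4 * (S ω * U i ω ^ 3) + U i ω ^ 4))) := fun ω => by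
        rw [Finset.sum_insert his]; ring
      simp_rw [this]
      rw [integral_add (hSm.pow 4).integrable, integral_add (I31.const_mul 4),
        integral_add ((I 2 2).const_mul 6), integral_add (I13.const_mul 4) ((hU i).pow 4).integrable,
        integral_const_mul, integral_const_mul, integral_const_mul, e1, e2, e3]
      · ring
      · exact (I13.const_mul 4).add ((hU i).pow 4).integrable
      · exact ((I 2 2).const_mul 6).add ((I13.const_mul 4).add ((hU i).pow 4).integrable)
      · exact (I31.const_mul 4).add (((I 2 2).const_mul 6).add
          ((I13.const_mul 4).add ((hU i).pow 4).integrable))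
    have E2 : ∫ ω, (∑ j ∈ insert i s, U j ω) ^ 2 ∂P = ∫ ω, S ω ^ 2 ∂P + ∫ ω, U i ω ^ 2 ∂P := by
      have : ∀ ω, (∑ j ∈ insert i s, U j ω) ^ 2 = S ω ^ 2 + (2 * (S ω * U i ω) + U i ω ^ 2) :=
        fun ω => by rw [Finset.sum_insert his]; ring
      simp_rw [this]
      rw [integral_add (hSm.pow 2).integrable, integral_add (I11.const_mul 2)
        ((hU i).pow 2).integrable, integral_const_mul, e4]
      · ring
      · exact (I11.const_mul 2).add ((hU i).pow 2).integrable
    rw [E4, E2]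
    have p1 : 0 ≤ ∫ ω, S ω ^ 2 ∂P := integral_nonneg fun _ => sq_nonneg _
    have p2 : 0 ≤ ∫ ω, U i ω ^ 2 ∂P := integral_nonneg fun _ => sq_nonneg _
    -- With a, b the two second moments, the cross term 6ab is absorbed by 2Cab in C(a + b)²; this
    -- is where 3 ≤ C enters.
    nlinarith [h4 i, mul_nonneg p1 p2, mul_nonneg (sub_nonneg.2 hC) (mul_nonneg p1 p2)]

/-- Fourth derivative at 0 of the moment generating function exp(t²/2). Differentiating p(t)
exp(t²/2) replaces p by p' + t p, which `d0` iterates. -/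
lemma integral_pow_four_gaussianReal : ∫ x, x ^ 4 ∂(gaussianReal 0 1) = 3 := by
  have h := iteratedDeriv_mgf_zero (X := id) (μ := gaussianReal 0 1)
    (by rw [integrableExpSet_id_gaussianReal]; simp) 4
  have e : mgf id (gaussianReal 0 1) = fun t => Real.exp (t ^ 2 / 2) := by
    rw [mgf_id_gaussianReal]; ext t; simp
  rw [e] at h
  have d0 : ∀ (p q : ℝ → ℝ) (_ : ∀ t, HasDerivAt p (q t) t),
      deriv (fun t => p t * Real.exp (t ^ 2 / 2)) =
        fun t => (q t + t * p t) * Real.exp (t ^ 2 / 2) := fun p q hpq => by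
    ext t
    have h1 : HasDerivAt (fun t : ℝ => t ^ 2 / 2) t t := by
      simpa using (hasDerivAt_pow 2 t).div_const 2
    exact (((hpq t).mul h1.exp).congr_deriv (by ring)).deriv
  have d1 := d0 (fun _ => 1) (fun _ => 0) fun t => hasDerivAt_const t 1
  have d2 := d0 (fun t => t) (fun _ => 1) fun t => hasDerivAt_id t
  have d3 := d0 (fun t => 1 + t ^ 2) (fun t => 2 * t) fun t => by
    simpa using (hasDerivAt_pow 2 t).const_add 1
  have d4 := d0 (fun t => 3 * t + t ^ 3) (fun t => 3 + 3 * t ^ 2) fun t => by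
    exact (((hasDerivAt_id t).const_mul 3).add (hasDerivAt_pow 3 t)).congr_deriv (by simp)
  simp only [iteratedDeriv_succ, iteratedDeriv_zero] at h
  simp only [one_mul, zero_add, mul_one] at d1
  rw [d1, d2] at h
  have r3 : (fun t : ℝ => (1 + t * t) * Real.exp (t ^ 2 / 2)) =
    fun t => (1 + t ^ 2) * Real.exp (t ^ 2 / 2) := by ext t; ring
  rw [r3, d3] at h
  have r4 : (fun t : ℝ => (2 * t + t * (1 + t ^ 2)) * Real.exp (t ^ 2 / 2)) =
    fun t => (3 * t + t ^ 3) * Real.exp (t ^ 2 / 2) := by ext t; ring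
  rw [r4, d4] at h
  simpa using h.symm

/-- Integrals of functions of a centred Gaussian variable. -/
lemma integral_comp_of_hasGaussianLaw {U : Ω → ℝ} (hU : HasGaussianLaw U P)
    (h0 : ∫ ω, U ω ∂P = 0) {f : ℝ → ℝ} (hf : Measurable f) :
    ∫ ω, f (U ω) ∂P = ∫ x, f (√(∫ ω, U ω ^ 2 ∂P) * x) ∂(gaussianReal 0 1) := by
  have := hU.isProbabilityMeasure
  have e := hU.map_eq_gaussianReal
  have v : Var[U; P] = ∫ ω, U ω ^ 2 ∂P := variance_of_integral_eq_zero hU.aemeasurable h0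
  have v0 : 0 ≤ ∫ ω, U ω ^ 2 ∂P := integral_nonneg fun _ => sq_nonneg _
  have m : P.map U = (gaussianReal 0 1).map (√(∫ ω, U ω ^ 2 ∂P) * ·) := by
    rw [gaussianReal_map_const_mul, e, v, h0]
    congr 1
    · simp
    · ext; simp [v0]
  rw [← integral_map hU.aemeasurable hf.aestronglyMeasurable, m, integral_map (by fun_prop)
    hf.aestronglyMeasurable]

lemma integral_pow_four_of_hasGaussianLaw {U : Ω → ℝ} (hU : HasGaussianLaw U P)
    (h0 : ∫ ω, U ω ∂P = 0) : ∫ ω, U ω ^ 4 ∂P = 3 * (∫ ω, U ω ^ 2 ∂P) ^ 2 := by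
  have v0 : 0 ≤ ∫ ω, U ω ^ 2 ∂P := integral_nonneg fun _ => sq_nonneg _
  rw [integral_comp_of_hasGaussianLaw hU h0 (f := fun x => x ^ 4) (by fun_prop)]
  simp_rw [mul_pow]
  rw [integral_const_mul, integral_pow_four_gaussianReal,
    show √(∫ ω, U ω ^ 2 ∂P) ^ 4 = (√(∫ ω, U ω ^ 2 ∂P) ^ 2) ^ 2 by ring, Real.sq_sqrt v0]
  ring

/-- Polarization: (U + V)⁴ + (U - V)⁴ = 2U⁴ + 12U²V² + 2V⁴. Since U ± V are Gaussian, the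
one-dimensional fourth moment suffices. -/
lemma integral_sq_mul_sq_of_hasGaussianLaw {U V : Ω → ℝ}
    (h : HasGaussianLaw (fun ω => (U ω, V ω)) P)
    (hU0 : ∫ ω, U ω ∂P = 0) (hV0 : ∫ ω, V ω ∂P = 0) :
    ∫ ω, U ω ^ 2 * V ω ^ 2 ∂P =
      (∫ ω, U ω ^ 2 ∂P) * (∫ ω, V ω ^ 2 ∂P) + 2 * (∫ ω, U ω * V ω ∂P) ^ 2 := by
  have := h.isProbabilityMeasure
  have hU := h.fst
  have hV := h.snd
  have mU := AllMoments.of_hasGaussianLaw hU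
  have mV := AllMoments.of_hasGaussianLaw hV
  have hA := h.fun_add
  have hB := h.fun_sub
  have a0 : ∫ ω, U ω + V ω ∂P = 0 := by
    rw [integral_add mU.integrable mV.integrable, hU0, hV0, add_zero]
  have b0 : ∫ ω, U ω - V ω ∂P = 0 := by
    rw [integral_sub mU.integrable mV.integrable, hU0, hV0, sub_zero]
  have fU := integral_pow_four_of_hasGaussianLaw hU hU0
  have fV := integral_pow_four_of_hasGaussianLaw hV hV0
  have fA := integral_pow_four_of_hasGaussianLaw hA a0
  have fB := integral_pow_four_of_hasGaussianLaw hB b0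
  have iUU := (mU.pow 2).integrable
  have iVV := (mV.pow 2).integrable
  have iUV := (mU.mul mV).integrable
  have sA : ∫ ω, (U ω + V ω) ^ 2 ∂P = ∫ ω, U ω ^ 2 ∂P + (2 * (∫ ω, U ω * V ω ∂P)
      + ∫ ω, V ω ^ 2 ∂P) := by
    rw [← integral_const_mul, ← integral_add (iUV.const_mul 2) iVV, ← integral_add iUU
      (((mU.mul mV).const_mul 2).add (mV.pow 2)).integrable]
    congr 1; ext ω; ring
  have sB : ∫ ω, (U ω - V ω) ^ 2 ∂P = ∫ ω, U ω ^ 2 ∂P + ((-2) * (∫ ω, U ω * V ω ∂P)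
      + ∫ ω, V ω ^ 2 ∂P) := by
    rw [← integral_const_mul, ← integral_add (iUV.const_mul (-2)) iVV, ← integral_add iUU
      (((mU.mul mV).const_mul (-2)).add (mV.pow 2)).integrable]
    congr 1; ext ω; ring
  have i22 := ((mU.pow 2).mul (mV.pow 2)).integrable
  have q : ∫ ω, (U ω + V ω) ^ 4 ∂P + ∫ ω, (U ω - V ω) ^ 4 ∂P =
      2 * (∫ ω, U ω ^ 4 ∂P) + (12 * (∫ ω, U ω ^ 2 * V ω ^ 2 ∂P) + 2 * ∫ ω, V ω ^ 4 ∂P) := by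
    have i4 := (mU.pow 4).integrable.const_mul 2
    have j4 := (mV.pow 4).integrable.const_mul 2
    rw [← integral_add ((mU.add mV).pow 4).integrable ((mU.sub mV).pow 4).integrable,
      ← integral_const_mul, ← integral_const_mul, ← integral_const_mul,
      ← integral_add (i22.const_mul 12) j4, ← integral_add i4
        ((((mU.pow 2).mul (mV.pow 2)).const_mul 12).add ((mV.pow 4).const_mul 2)).integrable]
    congr 1; ext ω; ring
  rw [fA, fB, fU, fV, sA, sB] at q
  linarith [q]

end Moments

/-! ### Fourth moments of Gaussian quadratic forms. -/

section QuadraticForms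

open scoped ENNReal NNReal Matrix

variable {Ω : Type*} [MeasurableSpace Ω] {P : Measure Ω}

/-- A centred Gaussian vector can be rotated into independent coordinates. -/
lemma exists_rotation_iIndepFun {ι : Type*} [Fintype ι] {W : ι → Ω → ℝ}
    (hW : HasGaussianLaw (fun ω i => W i ω) P) (h0 : ∀ i, ∫ ω, W i ω ∂P = 0) :
    ∃ Y : ι → Ω → ℝ, (∀ i, HasGaussianLaw (Y i) P) ∧ (∀ i, ∫ ω, Y i ω ∂P = 0) ∧
      iIndepFun Y P ∧ ∀ ω, ∑ i, Y i ω ^ 2 = ∑ i, W i ω ^ 2 := by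
  classical
  have := hW.isProbabilityMeasure
  have hWi : ∀ i, HasGaussianLaw (W i) P := fun i => hW.eval i
  let Γ : Matrix ι ι ℝ := Matrix.of fun i j => cov[W i, W j; P]
  have hΓ : Γ.IsHermitian := by
    ext i j; simp [Γ, covariance_comm]
  let U : Matrix ι ι ℝ := hΓ.eigenvectorUnitary
  have hU1 : U * Uᵀ = 1 := by
    have := Unitary.coe_mul_star_self hΓ.eigenvectorUnitary
    simpa [U, Matrix.star_eq_conjTranspose, Matrix.conjTranspose_eq_transpose_of_trivial] using this
  have hdiag : Uᵀ * Γ * U = Matrix.diagonal hΓ.eigenvalues := by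
    have := hΓ.conjStarAlgAut_star_eigenvectorUnitary
    rw [Unitary.conjStarAlgAut_star_apply] at this
    simpa [U, Matrix.star_eq_conjTranspose, Matrix.conjTranspose_eq_transpose_of_trivial,
      Function.comp_def] using this
  have hY : HasGaussianLaw (fun ω i => ∑ j, U j i * W j ω) P := by
    have := hW.map_fun (LinearMap.toContinuousLinearMap (Matrix.mulVecLin Uᵀ))
    have e : (fun ω i => ∑ j, U j i * W j ω) = fun ω =>
        LinearMap.toContinuousLinearMap (Matrix.mulVecLin Uᵀ) (fun i => W i ω) := by
      ext ω i; simp [Matrix.vecMul, dotProduct, mul_comm]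
    rwa [e]
  refine ⟨fun i ω => ∑ j, U j i * W j ω, fun i => hY.eval i, fun i => ?_, ?_, fun ω => ?_⟩
  · rw [integral_finsetSum _ fun j _ => (hWi j).integrable.const_mul _]
    simp [integral_const_mul, h0]
  -- Jointly Gaussian and uncorrelated implies independent; the new covariance matrix is UᵀΓU, which
  -- is diagonal.
  · refine hY.iIndepFun_of_covariance_eq_zero fun a b hab => ?_
    rw [covariance_fun_sum_fun_sum (fun i => (hWi i).memLp_two.const_mul _)
      (fun i => (hWi i).memLp_two.const_mul _)]
    have := congrFun (congrFun hdiag a) b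
    rw [Matrix.diagonal_apply_ne _ hab] at this
    rw [← this]
    simp only [covariance_const_mul_left, covariance_const_mul_right, Matrix.mul_apply,
      Matrix.transpose_apply, Finset.sum_mul, Γ, Matrix.of_apply]
    rw [Finset.sum_comm]
    refine Finset.sum_congr rfl fun i _ => Finset.sum_congr rfl fun j _ => by ring
  · have e : ∀ v : ι → ℝ, ∑ i, v i ^ 2 = v ⬝ᵥ v := fun v => by simp [dotProduct, sq]
    have : (fun i => ∑ j, U j i * W j ω) = Uᵀ *ᵥ (fun i => W i ω) := by
      ext i; simp [Matrix.mulVec, dotProduct]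
    rw [e (fun i => ∑ j, U j i * W j ω), e, this, Matrix.dotProduct_mulVec, Matrix.vecMul_mulVec,
      Matrix.transpose_transpose, ← Matrix.dotProduct_mulVec]
    rw [hU1]; simp

/-- A constant comparing fourth and second moments of centred Gaussian quadratic forms. -/
noncomputable def chaosConst : ℝ := max 3 (∫ x, (x ^ 2 - 1) ^ 4 ∂(gaussianReal 0 1))

/-- A hypercontractive estimate in the second Wiener chaos, with a constant independent of the
dimension and the covariance. After rotation the form is a sum of independent centred terms Y² - v,
each with fourth moment v⁴ E(N² - 1)⁴, N standard Gaussian, and second moment 2v²; v = 0 is allowed.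
-/
lemma integral_quadraticForm_pow_four_le {ι : Type*} [Fintype ι] {W : ι → Ω → ℝ}
    (hW : HasGaussianLaw (fun ω i => W i ω) P) (h0 : ∀ i, ∫ ω, W i ω ∂P = 0) :
    ∫ ω, (∑ i, (W i ω ^ 2 - ∫ ω', W i ω' ^ 2 ∂P)) ^ 4 ∂P ≤
      chaosConst * (∫ ω, (∑ i, (W i ω ^ 2 - ∫ ω', W i ω' ^ 2 ∂P)) ^ 2 ∂P) ^ 2 := by
  have := hW.isProbabilityMeasure
  obtain ⟨Y, hY, hY0, hYi, hYs⟩ := exists_rotation_iIndepFun hW h0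
  have mY := fun i => AllMoments.of_hasGaussianLaw (hY i)
  have mW := fun i => AllMoments.of_hasGaussianLaw (hW.eval i)
  have hS : ∀ ω, ∑ i, (W i ω ^ 2 - ∫ ω', W i ω' ^ 2 ∂P) =
      ∑ i, (Y i ω ^ 2 - ∫ ω', Y i ω' ^ 2 ∂P) := fun ω => by
    rw [Finset.sum_sub_distrib, Finset.sum_sub_distrib, hYs,
      ← integral_finsetSum _ fun i _ => ((mW i).pow 2).integrable,
      ← integral_finsetSum _ fun i _ => ((mY i).pow 2).integrable]
    simp_rw [hYs]
  simp_rw [hS]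
  have mU : ∀ i, AllMoments (fun ω => Y i ω ^ 2 - ∫ ω', Y i ω' ^ 2 ∂P) P := fun i =>
    ((mY i).pow 2).sub (AllMoments.const _)
  refine integral_sum_pow_four_le (le_max_left _ _) mU ?_ ?_ ?_ _
  · exact hYi.comp (fun i x => x ^ 2 - ∫ ω', Y i ω' ^ 2 ∂P) fun i => by fun_prop
  · intro i
    rw [integral_sub ((mY i).pow 2).integrable (integrable_const _)]
    simp
  · intro i
    set v := ∫ ω', Y i ω' ^ 2 ∂P with hv
    have v0 : 0 ≤ v := integral_nonneg fun _ => sq_nonneg _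
    have e4 : ∫ ω, (Y i ω ^ 2 - v) ^ 4 ∂P = v ^ 4 * ∫ x, (x ^ 2 - 1) ^ 4 ∂(gaussianReal 0 1) := by
      rw [integral_comp_of_hasGaussianLaw (hY i) (hY0 i) (f := fun x => (x ^ 2 - v) ^ 4)
        (by fun_prop), ← hv, ← integral_const_mul]
      congr 1; ext x
      rw [mul_pow, Real.sq_sqrt v0]; ring
    have e2 : ∫ ω, (Y i ω ^ 2 - v) ^ 2 ∂P = 2 * v ^ 2 := by
      have h4 := integral_pow_four_of_hasGaussianLaw (hY i) (hY0 i)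
      have : ∀ ω, (Y i ω ^ 2 - v) ^ 2 = (Y i ω ^ 4 - 2 * v * Y i ω ^ 2) + v ^ 2 := fun ω => by ring
      simp_rw [this]
      rw [integral_add _ (integrable_const _), integral_sub ((mY i).pow 4).integrable
        (((mY i).pow 2).integrable.const_mul _), h4, integral_const_mul, ← hv]
      · simp; ring
      · exact (((mY i).pow 4).sub (((mY i).pow 2).const_mul _)).integrable
    rw [e4, e2]
    have k0 : 0 ≤ ∫ x, (x ^ 2 - 1) ^ 4 ∂(gaussianReal 0 1) :=
      integral_nonneg fun _ => by positivity
    have : v ^ 4 * ∫ x, (x ^ 2 - 1) ^ 4 ∂(gaussianReal 0 1) ≤ v ^ 4 * chaosConst :=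
      mul_le_mul_of_nonneg_left (le_max_right _ _) (by positivity)
    have c0 : 0 ≤ chaosConst := le_trans (by norm_num) (le_max_left _ _)
    change _ ≤ chaosConst * _
    nlinarith [mul_nonneg c0 (pow_nonneg v0 4)]

end QuadraticForms

/-! ### Logarithms of averages of squared Gaussian variables. -/

section LogQuadraticForms

open scoped ENNReal NNReal Matrix

variable {Ω : Type*} [MeasurableSpace Ω] {P : Measure Ω}

/-- The majorant is integrable for the Gaussian law: the singularity at 0 is weakened to |x|^(-1/2),
by bounding |log|x|| by 12 |x|^(-1/12) and taking sixth powers. -/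
lemma log_sq_pow_six_le (x : ℝ) :
    Real.log (x ^ 2) ^ 6 ≤ 64 * (12 ^ 6 * |x| ^ (-(1 / 2) : ℝ) + x ^ 6) := by
  rw [Real.log_pow, ← Real.log_abs]
  rcases eq_or_ne x 0 with rfl | hx
  · rw [abs_zero, Real.log_zero, mul_zero, zero_pow (by norm_num)]
    positivity
  have hp : 0 < |x| := abs_pos.2 hx
  rw [show x ^ 6 = |x| ^ 6 by rw [show (6 : ℕ) = 2 * 3 by norm_num, pow_mul, pow_mul, sq_abs]]
  push_cast
  rw [mul_pow, show (2 : ℝ) ^ 6 = 64 by norm_num]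
  refine mul_le_mul_of_nonneg_left ?_ (by norm_num)
  rcases le_total |x| 1 with h1 | h1
  · have h := (Real.abs_log_mul_self_rpow_lt |x| (1 / 12) hp h1 (by norm_num)).le
    have e : Real.log |x| ^ 6 = |Real.log |x| * |x| ^ (1 / 12 : ℝ)| ^ 6 * |x| ^ (-(1 / 2) : ℝ) := by
      rw [Even.pow_abs ⟨3, rfl⟩, mul_pow, ← Real.rpow_natCast (|x| ^ (1 / 12 : ℝ)),
        ← Real.rpow_mul hp.le, mul_assoc, ← Real.rpow_add hp]
      norm_num
    rw [e]
    have : |Real.log |x| * |x| ^ (1 / 12 : ℝ)| ^ 6 ≤ 12 ^ 6 :=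
      pow_le_pow_left₀ (abs_nonneg _) (by linarith) 6
    have h2 : 0 ≤ |x| ^ (-(1 / 2) : ℝ) := by positivity
    nlinarith [mul_le_mul_of_nonneg_right this h2, pow_pos hp 6]
  · have h0 := Real.log_nonneg h1
    have : Real.log |x| ≤ |x| := (Real.log_le_sub_one_of_pos hp).trans (by linarith)
    have := pow_le_pow_left₀ h0 this 6
    have h2 : 0 ≤ |x| ^ (-(1 / 2) : ℝ) := by positivity
    linarith

lemma integrable_abs_rpow_gaussianReal :
    Integrable (fun x : ℝ => |x| ^ (-(1 / 2) : ℝ)) (gaussianReal 0 1) := by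
  rw [gaussianReal_of_var_ne_zero _ one_ne_zero, integrable_withDensity_iff_integrable_smul'
    (measurable_gaussianPDF 0 1) (ae_of_all _ fun x => gaussianPDF_lt_top)]
  have h1 : IntegrableOn (fun x : ℝ => (gaussianPDF 0 1 x).toReal • |x| ^ (-(1 / 2) : ℝ))
      (Set.Ioi 0) := by
    refine IntegrableOn.congr_fun ((integrableOn_rpow_mul_exp_neg_mul_sq
      (b := 1 / 2) (by norm_num) (s := -(1 / 2)) (by norm_num)).const_mul (√(2 * Real.pi * 1))⁻¹)
      (fun x hx => ?_) measurableSet_Ioi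
    simp only [toReal_gaussianPDF, gaussianPDFReal, smul_eq_mul, sub_zero, NNReal.coe_one, mul_one,
      abs_of_pos (Set.mem_Ioi.1 hx)]
    rw [show -(1 / 2) * x ^ 2 = -x ^ 2 / 2 by ring]; ring
  have h2 : IntegrableOn (fun x : ℝ => (gaussianPDF 0 1 x).toReal • |x| ^ (-(1 / 2) : ℝ))
      (Set.Iio 0) := by
    have h1' := h1
    rw [← neg_zero] at h1'
    convert h1'.comp_neg_Iio using 2
    simp [gaussianPDFReal]
  rw [← integrableOn_univ, ← Set.Iic_union_Ioi (a := (0 : ℝ))]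
  exact ((integrableOn_Iic_iff_integrableOn_Iio (by simp)).2 h2).union h1

lemma integrable_log_sq_pow_six_gaussianReal :
    Integrable (fun x : ℝ => Real.log (x ^ 2) ^ 6) (gaussianReal 0 1) := by
  have h6 : Integrable (fun x : ℝ => x ^ 6) (gaussianReal 0 1) := by
    have : HasGaussianLaw (fun x : ℝ => x) (gaussianReal 0 1) :=
      ⟨by rw [Measure.map_id']; infer_instance⟩
    exact ((AllMoments.of_hasGaussianLaw this).pow 6).integrable
  refine Integrable.mono' (((integrable_abs_rpow_gaussianReal.const_mul (12 ^ 6)).add h6).const_mul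
    64) (by
      have : Measurable fun x : ℝ => Real.log (x ^ 2) ^ 6 :=
        (Real.measurable_log.comp (measurable_id.pow_const 2)).pow_const 6
      exact this.aestronglyMeasurable) (ae_of_all _ fun x => ?_)
  rw [Real.norm_of_nonneg (by positivity)]
  exact log_sq_pow_six_le x

/-- Sixth moment of the logarithm of a squared standard Gaussian variable. -/
noncomputable def logMoment : ℝ := ∫ x, Real.log (x ^ 2) ^ 6 ∂(gaussianReal 0 1)

/-- Concavity of log gives log q ≥ average of log x_i, which controls log q from below without any
knowledge of the law of q near 0; for q ≥ 1 the bound log q ≤ q - 1 suffices. -/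
lemma log_avg_bounds {ι : Type*} [Fintype ι] [Nonempty ι] {x : ι → ℝ} (hx : ∀ i, 0 < x i) :
    let q := (Fintype.card ι : ℝ)⁻¹ * ∑ i, x i
    let A := (Fintype.card ι : ℝ)⁻¹ * ∑ i, |Real.log (x i)|
    0 < q ∧ (q < 1 → |Real.log q| ≤ A) ∧ |Real.log q| ≤ q + A := by
  intro q A
  have hc : (0 : ℝ) < Fintype.card ι := by exact_mod_cast Fintype.card_pos
  have hq : 0 < q := mul_pos (inv_pos.2 hc) (Finset.sum_pos (fun i _ => hx i) Finset.univ_nonempty)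
  have hA : 0 ≤ A := mul_nonneg (inv_nonneg.2 hc.le) (Finset.sum_nonneg fun i _ => abs_nonneg _)
  have h1 : q < 1 → |Real.log q| ≤ A := fun hq1 => by
    rw [abs_of_nonpos (Real.log_nonpos hq.le hq1.le)]
    have := strictConcaveOn_log_Ioi.concaveOn.le_map_sum (t := Finset.univ)
      (w := fun _ : ι => (Fintype.card ι : ℝ)⁻¹) (p := x) (fun _ _ => (inv_pos.2 hc).le)
      (by simp [hc.ne']) (fun i _ => hx i)
    simp only [smul_eq_mul, ← Finset.mul_sum] at this
    have h2 : -((Fintype.card ι : ℝ)⁻¹ * ∑ i, Real.log (x i)) ≤ A := by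
      rw [← mul_neg, ← Finset.sum_neg_distrib]
      exact mul_le_mul_of_nonneg_left (Finset.sum_le_sum fun i _ => neg_le_abs _)
        (inv_pos.2 hc).le
    linarith
  refine ⟨hq, h1, ?_⟩
  rcases lt_or_ge q 1 with h | h
  · linarith [h1 h]
  · rw [abs_of_nonneg (Real.log_nonneg h)]
    linarith [Real.log_le_sub_one_of_pos hq]

/-- For q ≥ 1/2 the remainder is at most 2(q - 1)². For q < 1/2 one has 1 ≤ 16(q - 1)⁴, and A² ≤
η²A⁶ + 1/η trades a small multiple of a high moment of A against (q - 1)⁴. The parameter η stays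
free so that it can tend to 0 at a chosen rate. -/
lemma sq_log_remainder_le {q A η : ℝ} (hq : 0 < q) (hη : 0 < η)
    (h : q < 1 → |Real.log q| ≤ A) :
    (Real.log q - (q - 1)) ^ 2 ≤ 2 * η ^ 2 * A ^ 6 + (36 + 32 / η) * (q - 1) ^ 4 := by
  have hη' : 0 ≤ 32 / η := by positivity
  have z4 : 0 ≤ (q - 1) ^ 4 := by positivity
  have a6 : 0 ≤ A ^ 6 := by positivity
  rcases le_or_gt (1 / 2) q with h2 | h2
  · have u := Real.log_le_sub_one_of_pos hq
    have l := Real.one_sub_inv_le_log_of_pos hq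
    have e : (q - 1) - (1 - q⁻¹) = (q - 1) ^ 2 * q⁻¹ := by field_simp
    have iq : q⁻¹ ≤ 2 := by
      rw [inv_le_comm₀ hq two_pos]; linarith
    have b : (q - 1) - Real.log q ≤ 2 * (q - 1) ^ 2 := by
      nlinarith [mul_le_mul_of_nonneg_left iq (sq_nonneg (q - 1))]
    have : (Real.log q - (q - 1)) ^ 2 ≤ (2 * (q - 1) ^ 2) ^ 2 := by
      rw [← neg_sq]
      exact pow_le_pow_left₀ (by linarith) (by linarith) 2
    have : 0 ≤ 2 * η ^ 2 * A ^ 6 := by positivity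
    nlinarith [mul_nonneg hη' z4]
  · have hA := h (by linarith)
    have a0 : 0 ≤ A := (abs_nonneg _).trans hA
    have z1 : 1 ≤ 16 * (q - 1) ^ 4 := by
      have : (1 / 2 : ℝ) ^ 4 ≤ (1 - q) ^ 4 := pow_le_pow_left₀ (by norm_num) (by linarith) 4
      nlinarith [this]
    have b1 : (Real.log q - (q - 1)) ^ 2 ≤ 2 * A ^ 2 + 2 := by
      have : Real.log q ^ 2 ≤ A ^ 2 := sq_le_sq' (by linarith [(abs_le.1 hA).1]) (abs_le.1 hA).2
      nlinarith [sq_nonneg (Real.log q + (q - 1))]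
    have b2 : A ^ 2 ≤ η ^ 2 * A ^ 6 + 1 / η := by
      rcases le_total (η * A ^ 2) 1 with h3 | h3
      · have : A ^ 2 ≤ 1 / η := by rw [le_div_iff₀ hη]; linarith
        nlinarith [mul_nonneg (sq_nonneg η) a6]
      · have : 1 ≤ (η * A ^ 2) ^ 2 := one_le_pow₀ h3
        have : A ^ 2 * 1 ≤ A ^ 2 * (η * A ^ 2) ^ 2 := mul_le_mul_of_nonneg_left this (sq_nonneg A)
        have : 0 ≤ 1 / η := by positivity
        nlinarith
    have b3 : 1 / η ≤ 16 / η * (q - 1) ^ 4 := by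
      have := mul_le_mul_of_nonneg_left z1 (show 0 ≤ 1 / η by positivity)
      calc 1 / η = 1 / η * 1 := by ring
        _ ≤ _ := this
        _ = _ := by ring
    have : (36 + 32 / η) * (q - 1) ^ 4 = 36 * (q - 1) ^ 4 + 2 * (16 / η * (q - 1) ^ 4) := by ring
    rw [this]
    nlinarith

/-- The logarithm of a normalised sum of squares of Gaussian variables is square integrable, and
its linearisation error is controlled by the variance. -/
lemma log_quadraticForm {ι : Type*} [Fintype ι] [Nonempty ι] {W : ι → Ω → ℝ}
    (hW : HasGaussianLaw (fun ω i => W i ω) P) (h0 : ∀ i, ∫ ω, W i ω ∂P = 0) {s : ℝ} (hs : 0 < s)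
    (hs2 : ∀ i, ∫ ω, W i ω ^ 2 ∂P = s) {q : Ω → ℝ}
    (hq : q = fun ω => (Fintype.card ι : ℝ)⁻¹ * ∑ i, W i ω ^ 2 / s) :
    (∀ᵐ ω ∂P, 0 < q ω) ∧ MemLp (fun ω => Real.log (q ω)) 2 P ∧
    ∀ η > 0, ∫ ω, (Real.log (q ω) - (q ω - 1)) ^ 2 ∂P ≤
      2 * η ^ 2 * logMoment + (36 + 32 / η) * (chaosConst * (∫ ω, (q ω - 1) ^ 2 ∂P) ^ 2) := by
  have := hW.isProbabilityMeasure
  have hWi := fun i => hW.eval i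
  have mW := fun i => AllMoments.of_hasGaussianLaw (hWi i)
  have hc : (0 : ℝ) < Fintype.card ι := by exact_mod_cast Fintype.card_pos
  -- A Gaussian law with positive variance has no atom at 0.
  have hpos : ∀ᵐ ω ∂P, ∀ i, 0 < W i ω ^ 2 / s := by
    rw [ae_all_iff]
    intro i
    have hz : ∀ᵐ x ∂(P.map (W i)), x ≠ 0 := by
      have v : Var[W i; P] = s := by
        rw [variance_of_integral_eq_zero (hWi i).aemeasurable (h0 i), hs2]
      rw [(hWi i).map_eq_gaussianReal, v]
      have := nullSingletonClass_gaussianReal (μ := P[W i]) (v := s.toNNReal)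
        (by simpa using hs)
      rw [ae_iff]
      simp
    filter_upwards [ae_of_ae_map (hWi i).aemeasurable hz] with ω hω
    positivity
  set A : Ω → ℝ := fun ω => (Fintype.card ι : ℝ)⁻¹ * ∑ i, |Real.log (W i ω ^ 2 / s)| with hA
  have hb : ∀ᵐ ω ∂P, 0 < q ω ∧ (q ω < 1 → |Real.log (q ω)| ≤ A ω) ∧
      |Real.log (q ω)| ≤ q ω + A ω := by
    filter_upwards [hpos] with ω hω
    rw [hq]
    exact log_avg_bounds hω
  have mq : AllMoments q P := by
    rw [hq]
    refine (AllMoments.sum fun i _ => ?_).const_mul _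
    simpa [div_eq_inv_mul] using ((mW i).pow 2).const_mul s⁻¹
  have mlog : ∀ i, AEStronglyMeasurable (fun ω => |Real.log (W i ω ^ 2 / s)|) P := fun i => by
    have := (hWi i).aemeasurable
    exact (((this.pow_const 2).div_const s).log.abs).aestronglyMeasurable
  have int6 : ∀ i, Integrable (fun ω => |Real.log (W i ω ^ 2 / s)| ^ 6) P ∧
      ∫ ω, |Real.log (W i ω ^ 2 / s)| ^ 6 ∂P = logMoment := fun i => by
    have e : ∀ x : ℝ, |Real.log ((√s * x) ^ 2 / s)| ^ 6 = Real.log (x ^ 2) ^ 6 := fun x => by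
      rw [Even.pow_abs ⟨3, rfl⟩, mul_pow, Real.sq_sqrt hs.le, mul_div_cancel_left₀ _ hs.ne']
    have mf : Measurable fun x : ℝ => |Real.log (x ^ 2 / s)| ^ 6 := by
      exact ((Real.measurable_log.comp ((measurable_id.pow_const 2).div_const s)).abs).pow_const 6
    constructor
    · have v : Var[W i; P] = s := by
        rw [variance_of_integral_eq_zero (hWi i).aemeasurable (h0 i), hs2]
      have m : P.map (W i) = (gaussianReal 0 1).map (√s * ·) := by
        rw [gaussianReal_map_const_mul, (hWi i).map_eq_gaussianReal, v, h0]
        congr 1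
        · simp
        · ext; simp [hs.le]
      have := (integrable_map_measure (f := W i) (μ := P) mf.aestronglyMeasurable
        (hWi i).aemeasurable).1
      refine this ?_
      rw [m, integrable_map_measure mf.aestronglyMeasurable (by fun_prop)]
      simp only [Function.comp_def, e]
      exact integrable_log_sq_pow_six_gaussianReal
    · rw [integral_comp_of_hasGaussianLaw (hWi i) (h0 i)
        (f := fun x => |Real.log (x ^ 2 / s)| ^ 6) mf, hs2]
      simp_rw [e]; rfl
  have mA6 : ∀ i, MemLp (fun ω => |Real.log (W i ω ^ 2 / s)|) 6 P := fun i => by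
    rw [← integrable_norm_rpow_iff (mlog i) (by simp) (by simp)]
    refine (int6 i).1.congr (ae_of_all _ fun ω => ?_)
    simp only [Real.norm_eq_abs, abs_abs, ENNReal.toReal_ofNat]
    norm_cast
  have mA : MemLp A 6 P := (memLp_finsetSum _ fun i _ => mA6 i).const_mul _
  -- By the power mean inequality E A⁶ is at most `logMoment`, whatever the size of the family and
  -- the correlations within it.
  have A6 : ∀ ω, A ω ^ 6 ≤ (Fintype.card ι : ℝ)⁻¹ * ∑ i, |Real.log (W i ω ^ 2 / s)| ^ 6 :=
    fun ω => by
    have := Real.pow_arith_mean_le_arith_mean_pow Finset.univ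
      (fun _ : ι => (Fintype.card ι : ℝ)⁻¹) (fun i => |Real.log (W i ω ^ 2 / s)|)
      (fun _ _ => (inv_pos.2 hc).le) (by simp [hc.ne']) (fun i _ => abs_nonneg _) 6
    simpa only [← Finset.mul_sum] using this
  have iA6' : Integrable (fun ω => (Fintype.card ι : ℝ)⁻¹ *
      ∑ i, |Real.log (W i ω ^ 2 / s)| ^ 6) P :=
    (integrable_finsetSum _ fun i _ => (int6 i).1).const_mul _
  have iA6 : Integrable (fun ω => A ω ^ 6) P := by
    refine iA6'.mono' (mA.aestronglyMeasurable.pow 6) (ae_of_all _ fun ω => ?_)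
    rw [Real.norm_of_nonneg (by positivity)]
    exact A6 ω
  have eA6 : ∫ ω, A ω ^ 6 ∂P ≤ logMoment := by
    refine (integral_mono iA6 iA6' A6).trans_eq ?_
    rw [integral_const_mul, integral_finsetSum _ fun i _ => (int6 i).1]
    simp [(int6 _).2, hc.ne']
  have mlogq : AEStronglyMeasurable (fun ω => Real.log (q ω)) P :=
    mq.integrable.aestronglyMeasurable.aemeasurable.log.aestronglyMeasurable
  refine ⟨hb.mono fun ω h => h.1, ?_, fun η hη => ?_⟩
  · refine ((mq 2 (by simp)).add (mA.mono_exponent (p := 2) (by norm_num))).mono mlogq ?_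
    filter_upwards [hb] with ω hω
    rw [Real.norm_eq_abs]
    exact hω.2.2.trans (le_abs_self _)
  · have mZ : AllMoments (fun ω => q ω - 1) P := mq.sub (AllMoments.const 1)
    have i4 := (mZ.pow 4).integrable
    have step : ∫ ω, (Real.log (q ω) - (q ω - 1)) ^ 2 ∂P ≤
        ∫ ω, 2 * η ^ 2 * A ω ^ 6 + (36 + 32 / η) * (q ω - 1) ^ 4 ∂P := by
      refine integral_mono_of_nonneg (ae_of_all _ fun ω => sq_nonneg _)
        ((iA6.const_mul _).add (i4.const_mul _)) ?_
      filter_upwards [hb] with ω hω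
      exact sq_log_remainder_le hω.1 hη hω.2.1
    rw [integral_add (iA6.const_mul _) (i4.const_mul _), integral_const_mul,
      integral_const_mul] at step
    have h4 : ∫ ω, (q ω - 1) ^ 4 ∂P ≤ chaosConst * (∫ ω, (q ω - 1) ^ 2 ∂P) ^ 2 := by
      have := integral_quadraticForm_pow_four_le hW h0
      simp only [hs2] at this
      set c : ℝ := (Fintype.card ι : ℝ)⁻¹ * s⁻¹ with hcdef
      have e : ∀ ω, q ω - 1 = c * ∑ i, (W i ω ^ 2 - s) := fun ω => by
        rw [hq, Finset.sum_sub_distrib]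
        simp only [← Finset.sum_div]
        simp only [Finset.sum_const, Finset.card_univ, nsmul_eq_mul, hcdef]
        field_simp
      simp_rw [e, mul_pow, integral_const_mul]
      calc _ ≤ c ^ 4 * _ := mul_le_mul_of_nonneg_left this (by positivity)
        _ = _ := by ring
    have t1 : 2 * η ^ 2 * ∫ ω, A ω ^ 6 ∂P ≤ 2 * η ^ 2 * logMoment :=
      mul_le_mul_of_nonneg_left eA6 (by positivity)
    have t2 := mul_le_mul_of_nonneg_left h4 (show 0 ≤ 36 + 32 / η by positivity)
    linarith

end LogQuadraticForms

/-! ### Delta method for contrasts of log empirical variances. -/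

section LogRegression

open scoped ENNReal NNReal Matrix

variable {Ω : Type*} [MeasurableSpace Ω] {P : Measure Ω}

/-- Cauchy–Schwarz, read off the discriminant of t ↦ Var(D + tR) ≥ 0. -/
lemma sq_covariance_le [IsProbabilityMeasure P] {D R : Ω → ℝ} (hD : MemLp D 2 P)
    (hR : MemLp R 2 P) : cov[D, R; P] ^ 2 ≤ Var[D; P] * Var[R; P] := by
  have h : ∀ t : ℝ, 0 ≤ Var[R; P] * (t * t) + 2 * cov[D, R; P] * t + Var[D; P] := fun t => by
    have := variance_nonneg (fun ω => D ω + t * R ω) P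
    rw [variance_fun_add hD (hR.const_mul t), variance_const_mul, covariance_const_mul_right] at this
    linarith
  have := discrim_le_zero h
  rw [discrim] at this
  linarith

/-- By Cauchy–Schwarz, m |Cov(D, R)| is at most the square root of (m Var D)(m Var R), a bounded
factor times one that vanishes. -/
lemma tendsto_mul_variance_add [IsProbabilityMeasure P] {D R : ℕ → Ω → ℝ} {m : ℕ → ℝ} {a : ℝ}
    (hm : ∀ᶠ n in atTop, 0 ≤ m n) (hD : ∀ᶠ n in atTop, MemLp (D n) 2 P)
    (hR : ∀ᶠ n in atTop, MemLp (R n) 2 P)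
    (hDa : Tendsto (fun n => m n * Var[D n; P]) atTop (𝓝 a))
    (hR0 : Tendsto (fun n => m n * ∫ ω, R n ω ^ 2 ∂P) atTop (𝓝 0)) :
    Tendsto (fun n => m n * Var[fun ω => D n ω + R n ω; P]) atTop (𝓝 a) := by
  have hV : Tendsto (fun n => m n * Var[R n; P]) atTop (𝓝 0) := by
    refine squeeze_zero' ?_ ?_ hR0
    · filter_upwards [hm] with n hn using mul_nonneg hn (variance_nonneg _ _)
    · filter_upwards [hm, hR] with n hn hRn
      refine mul_le_mul_of_nonneg_left ?_ hn
      simpa using variance_le_expectation_sq hRn.aestronglyMeasurable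
  have hc : Tendsto (fun n => m n * cov[D n, R n; P]) atTop (𝓝 0) := by
    have h0 : Tendsto (fun n => √((m n * Var[D n; P]) * (m n * Var[R n; P]))) atTop (𝓝 0) := by
      simpa using (hDa.mul hV).sqrt
    refine squeeze_zero_norm' ?_ h0
    filter_upwards [hD, hR] with n hDn hRn
    rw [Real.norm_eq_abs]
    refine Real.abs_le_sqrt ?_
    nlinarith [mul_le_mul_of_nonneg_left (sq_covariance_le hDn hRn) (sq_nonneg (m n))]
  have := (hDa.add (hc.const_mul 2)).add hV
  simp only [mul_zero, add_zero] at this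
  refine this.congr' ?_
  filter_upwards [hD, hR] with n hDn hRn
  rw [variance_fun_add hDn hRn]; ring

/-- Asymptotic variance of a contrast of logarithms of empirical variances of jointly Gaussian
arrays. -/
theorem tendsto_variance_sum_log [IsProbabilityMeasure P] {ι : Type*} [Fintype ι] (w : ι → ℝ)
    {m : ℕ → ℝ} (hm : Tendsto m atTop atTop) {N : ℕ → ι → ℕ}
    (hN : ∀ᶠ n in atTop, ∀ i, 0 < N n i) {W : ℕ → ι → ℕ → Ω → ℝ}
    (hG : ∀ n, IsGaussianProcess (fun p : ι × ℕ => W n p.1 p.2) P)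
    (h0 : ∀ n i k, ∫ ω, W n i k ω ∂P = 0) {s : ℕ → ι → ℝ}
    (hs : ∀ᶠ n in atTop, ∀ i, 0 < s n i) (hs2 : ∀ n i k, ∫ ω, W n i k ω ^ 2 ∂P = s n i)
    {V : Matrix ι ι ℝ}
    (hV : ∀ i j, Tendsto (fun n => m n * ((N n i : ℝ)⁻¹ * (N n j : ℝ)⁻¹ *
      ∑ k ∈ Finset.range (N n i), ∑ l ∈ Finset.range (N n j),
        2 * (∫ ω, W n i k ω * W n j l ω ∂P) ^ 2 / (s n i * s n j))) atTop (𝓝 (V i j))) :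
    (∀ᶠ n in atTop, MemLp (fun ω => ∑ i, w i * Real.log ((N n i : ℝ)⁻¹ *
      ∑ k ∈ Finset.range (N n i), W n i k ω ^ 2)) 2 P) ∧
    Tendsto (fun n => m n * Var[fun ω => ∑ i, w i * Real.log ((N n i : ℝ)⁻¹ *
      ∑ k ∈ Finset.range (N n i), W n i k ω ^ 2); P]) atTop (𝓝 (w ⬝ᵥ V.mulVec w)) := by
  set q : ℕ → ι → Ω → ℝ := fun n i ω => (N n i : ℝ)⁻¹ *
      ∑ k ∈ Finset.range (N n i), W n i k ω ^ 2 / s n i with hq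
  have hWg : ∀ n i k, HasGaussianLaw (W n i k) P := fun n i k => (hG n).hasGaussianLaw_eval (i, k)
  have mW : ∀ n i k, AllMoments (W n i k) P := fun n i k => .of_hasGaussianLaw (hWg n i k)
  have mq : ∀ n i, AllMoments (q n i) P := fun n i => by
    refine (AllMoments.sum fun k _ => ?_).const_mul _
    simpa [div_eq_inv_mul] using ((mW n i k).pow 2).const_mul (s n i)⁻¹
  have mZ : ∀ n i, AllMoments (fun ω => q n i ω - 1) P := fun n i => (mq n i).sub (.const 1)
  have good : ∀ᶠ n in atTop, ∀ i, 0 < N n i ∧ 0 < s n i ∧ (∀ᵐ ω ∂P, 0 < q n i ω) ∧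
      MemLp (fun ω => Real.log (q n i ω)) 2 P ∧
      ∀ η > 0, ∫ ω, (Real.log (q n i ω) - (q n i ω - 1)) ^ 2 ∂P ≤ 2 * η ^ 2 * logMoment +
        (36 + 32 / η) * (chaosConst * (∫ ω, (q n i ω - 1) ^ 2 ∂P) ^ 2) := by
    filter_upwards [hN, hs] with n hn hsn i
    have : Nonempty (Fin (N n i)) := ⟨⟨0, hn i⟩⟩
    have hL : HasGaussianLaw (fun ω (k : Fin (N n i)) => W n i k ω) P := by
      have h1 : IsGaussianProcess (fun k : Fin (N n i) => W n i k) P :=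
        (hG n).comp_right (fun k : Fin (N n i) => (i, (k : ℕ)))
      have h2 := (h1.hasGaussianLaw Finset.univ).map_fun
        (ContinuousLinearMap.pi fun k : Fin (N n i) =>
          ContinuousLinearMap.proj (R := ℝ) (φ := fun _ : (Finset.univ : Finset (Fin (N n i))) => ℝ)
            ⟨k, Finset.mem_univ k⟩)
      exact h2
    exact ⟨hn i, hsn i, log_quadraticForm hL (fun k => h0 n i k) (hsn i) (fun k => hs2 n i k)
      (by ext ω; simp [hq, Finset.sum_range])⟩
  -- After centring, the product of variances in the Gaussian formula for E[U²V²] cancels and only 2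
  -- E[UV]² is left.
  have cross : ∀ᶠ n in atTop, ∀ i j, ∫ ω, (q n i ω - 1) * (q n j ω - 1) ∂P =
      (N n i : ℝ)⁻¹ * (N n j : ℝ)⁻¹ * ∑ k ∈ Finset.range (N n i), ∑ l ∈ Finset.range (N n j),
        2 * (∫ ω, W n i k ω * W n j l ω ∂P) ^ 2 / (s n i * s n j) := by
    filter_upwards [hN, hs] with n hn hsn i j
    have hZ : ∀ i ω, q n i ω - 1 = (N n i : ℝ)⁻¹ *
        ∑ k ∈ Finset.range (N n i), (W n i k ω ^ 2 / s n i - 1) := fun i ω => by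
      have : (N n i : ℝ) ≠ 0 := by exact_mod_cast (hn i).ne'
      simp only [hq, Finset.sum_sub_distrib, mul_sub, Finset.sum_const, Finset.card_range,
        nsmul_eq_mul, mul_one, inv_mul_cancel₀ this]
    have mX : ∀ i k, AllMoments (fun ω => W n i k ω ^ 2 / s n i - 1) P := fun i k => by
      refine AllMoments.sub ?_ (.const 1)
      simpa [div_eq_inv_mul] using ((mW n i k).pow 2).const_mul (s n i)⁻¹
    have e1 : ∀ ω, (q n i ω - 1) * (q n j ω - 1) = (N n i : ℝ)⁻¹ * (N n j : ℝ)⁻¹ *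
        ∑ k ∈ Finset.range (N n i), ∑ l ∈ Finset.range (N n j),
          (W n i k ω ^ 2 / s n i - 1) * (W n j l ω ^ 2 / s n j - 1) := fun ω => by
      rw [hZ, hZ, ← Finset.sum_mul_sum]; ring
    simp_rw [e1]
    rw [integral_const_mul, integral_finsetSum]
    · congr 1
      refine Finset.sum_congr rfl fun k _ => ?_
      rw [integral_finsetSum _ fun l _ => ((mX i k).mul (mX j l)).integrable]
      refine Finset.sum_congr rfl fun l _ => ?_
      have hsi := (hsn i).ne'
      have hsj := (hsn j).ne'
      have e2 : ∀ ω, (W n i k ω ^ 2 / s n i - 1) * (W n j l ω ^ 2 / s n j - 1) =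
          ((s n i * s n j)⁻¹ * (W n i k ω ^ 2 * W n j l ω ^ 2) -
            ((s n i)⁻¹ * W n i k ω ^ 2 + (s n j)⁻¹ * W n j l ω ^ 2)) + 1 := fun ω => by
        field_simp; ring
      have i4 := (((mW n i k).pow 2).mul ((mW n j l).pow 2)).const_mul (s n i * s n j)⁻¹
      have i2 := (((mW n i k).pow 2).const_mul (s n i)⁻¹)
      have j2 := (((mW n j l).pow 2).const_mul (s n j)⁻¹)
      have hp : HasGaussianLaw (fun ω => (W n i k ω, W n j l ω)) P :=
        (hG n).hasGaussianLaw_prodMk (s := (i, k)) (t := (j, l))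
      simp_rw [e2]
      rw [integral_add (i4.sub (i2.add j2)).integrable (integrable_const _),
        integral_sub i4.integrable (i2.add j2).integrable, integral_add i2.integrable j2.integrable,
        integral_const_mul, integral_const_mul, integral_const_mul, hs2, hs2,
        integral_sq_mul_sq_of_hasGaussianLaw hp (h0 n i k) (h0 n j l), hs2, hs2]
      simp
      field_simp; ring
    · intro k _
      exact integrable_finsetSum _ fun l _ => ((mX i k).mul (mX j l)).integrable
  have mean0 : ∀ᶠ n in atTop, ∀ i, ∫ ω, (q n i ω - 1) ∂P = 0 := by
    filter_upwards [hN, hs] with n hn hsn i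
    have : (N n i : ℝ) ≠ 0 := by exact_mod_cast (hn i).ne'
    rw [integral_sub (mq n i).integrable (integrable_const _)]
    simp only [hq]
    rw [integral_const_mul, integral_finsetSum]
    · simp only [integral_div, hs2, div_self (hsn i).ne']
      simp [this]
    · intro k _
      exact ((mW n i k).pow 2).integrable.div_const _
  have hZ2 : ∀ i, Tendsto (fun n => m n * ∫ ω, (q n i ω - 1) ^ 2 ∂P) atTop (𝓝 (V i i)) := by
    intro i
    refine (hV i i).congr' ?_
    filter_upwards [cross] with n hn
    simp_rw [sq (q n i _ - 1), hn i i]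
  set D : ℕ → Ω → ℝ := fun n ω => ∑ i, w i * (q n i ω - 1) with hDdef
  set R : ℕ → Ω → ℝ := fun n ω => ∑ i, w i * (Real.log (q n i ω) - (q n i ω - 1)) with hRdef
  have mD : ∀ n, AllMoments (D n) P := fun n => AllMoments.sum fun i _ => (mZ n i).const_mul _
  have hRi : ∀ᶠ n in atTop, ∀ i, MemLp (fun ω => Real.log (q n i ω) - (q n i ω - 1)) 2 P := by
    filter_upwards [good] with n hn i using (hn i).2.2.2.1.sub (mZ n i).memLp_two
  have hR : ∀ᶠ n in atTop, MemLp (R n) 2 P := by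
    filter_upwards [hRi] with n hn
    exact memLp_finsetSum _ fun i _ => (hn i).const_mul _
  have hDV : Tendsto (fun n => m n * Var[D n; P]) atTop (𝓝 (w ⬝ᵥ V.mulVec w)) := by
    have lim : Tendsto (fun n => ∑ i, ∑ j, w i * w j * (m n * ((N n i : ℝ)⁻¹ * (N n j : ℝ)⁻¹ *
      ∑ k ∈ Finset.range (N n i), ∑ l ∈ Finset.range (N n j),
        2 * (∫ ω, W n i k ω * W n j l ω ∂P) ^ 2 / (s n i * s n j)))) atTop
        (𝓝 (∑ i, ∑ j, w i * w j * V i j)) :=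
      tendsto_finsetSum _ fun i _ => tendsto_finsetSum _ fun j _ => (hV i j).const_mul _
    have e : w ⬝ᵥ V.mulVec w = ∑ i, ∑ j, w i * w j * V i j := by
      simp only [dotProduct, Matrix.mulVec, Finset.mul_sum]
      exact Finset.sum_congr rfl fun i _ => Finset.sum_congr rfl fun j _ => by ring
    rw [e]
    refine lim.congr' ?_
    filter_upwards [cross, mean0] with n hc hm0
    have hD0 : ∫ ω, D n ω ∂P = 0 := by
      rw [integral_finsetSum _ fun i _ => ((mZ n i).const_mul _).integrable]
      simp only [integral_const_mul, hm0]; simp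
    rw [variance_of_integral_eq_zero (mD n).integrable.aestronglyMeasurable.aemeasurable hD0]
    have e2 : ∀ ω, D n ω ^ 2 = ∑ i, ∑ j, w i * w j * ((q n i ω - 1) * (q n j ω - 1)) := fun ω => by
      rw [sq, hDdef, Finset.sum_mul_sum]
      exact Finset.sum_congr rfl fun i _ => Finset.sum_congr rfl fun j _ => by ring
    simp_rw [e2]
    have iij := fun i j => (((mZ n i).mul (mZ n j)).const_mul (w i * w j)).integrable
    rw [integral_finsetSum _ fun i _ => integrable_finsetSum _ fun j _ => iij i j, Finset.mul_sum]
    refine Finset.sum_congr rfl fun i _ => ?_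
    rw [integral_finsetSum _ fun j _ => iij i j, Finset.mul_sum]
    refine Finset.sum_congr rfl fun j _ => ?_
    rw [integral_const_mul, hc i j]; ring
  have hRi0 : ∀ i, Tendsto (fun n => m n * ∫ ω, (Real.log (q n i ω) - (q n i ω - 1)) ^ 2 ∂P)
      atTop (𝓝 0) := by
    intro i
    set e : ℕ → ℝ := fun n => m n ^ (-(1 / 4) : ℝ) with he
    -- The choice is η = e³ = m^(-3/4). As E(q - 1)² = O(1/m), the two parts of the remainder bound,
    -- multiplied by m, are of orders m^(-1/2) and m^(-1/4).
    have e0 : Tendsto e atTop (𝓝 0) := (tendsto_rpow_neg_atTop (by norm_num)).comp hm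
    have lim : Tendsto (fun n => 2 * logMoment * e n ^ 2 + (36 * e n ^ 4 + 32 * e n) *
        (chaosConst * (m n * ∫ ω, (q n i ω - 1) ^ 2 ∂P) ^ 2)) atTop (𝓝 0) := by
      have h := ((e0.pow 2).const_mul (2 * logMoment)).add
        ((((e0.pow 4).const_mul 36).add (e0.const_mul 32)).mul
          (((hZ2 i).pow 2).const_mul chaosConst))
      simpa using h
    refine squeeze_zero' ?_ ?_ lim
    · filter_upwards [hm.eventually_ge_atTop 0] with n hn
      exact mul_nonneg hn (integral_nonneg fun _ => sq_nonneg _)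
    · filter_upwards [hm.eventually_gt_atTop 0, good] with n hn hg
      have ep : 0 < e n := Real.rpow_pos_of_pos hn _
      have e4 : m n * e n ^ 4 = 1 := by
        rw [he, ← Real.rpow_natCast, ← Real.rpow_mul hn.le]
        nth_rewrite 1 [← Real.rpow_one (m n)]
        rw [← Real.rpow_add hn]; norm_num
      have := mul_le_mul_of_nonneg_left ((hg i).2.2.2.2 (e n ^ 3) (by positivity)) hn.le
      refine this.trans_eq ?_
      set b := ∫ ω, (q n i ω - 1) ^ 2 ∂P
      have h1 : m n = 1 / e n ^ 4 := by field_simp; linarith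
      rw [h1]; field_simp
  have hR0 : Tendsto (fun n => m n * ∫ ω, R n ω ^ 2 ∂P) atTop (𝓝 0) := by
    have lim : Tendsto (fun n => (∑ i, w i ^ 2) * ∑ i, m n *
        ∫ ω, (Real.log (q n i ω) - (q n i ω - 1)) ^ 2 ∂P) atTop (𝓝 0) := by
      simpa using (tendsto_finsetSum Finset.univ fun i _ => hRi0 i).const_mul (∑ i, w i ^ 2)
    refine squeeze_zero' ?_ ?_ lim
    · filter_upwards [hm.eventually_ge_atTop 0] with n hn
      exact mul_nonneg hn (integral_nonneg fun _ => sq_nonneg _)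
    · filter_upwards [hm.eventually_ge_atTop 0, hRi] with n hn hi
      rw [← Finset.mul_sum, mul_left_comm]
      refine mul_le_mul_of_nonneg_left ?_ hn
      rw [← integral_finsetSum _ fun i _ => (hi i).integrable_sq, ← integral_const_mul]
      refine integral_mono_of_nonneg (ae_of_all _ fun ω => sq_nonneg _)
        ((integrable_finsetSum _ fun i _ => (hi i).integrable_sq).const_mul _)
        (ae_of_all _ fun ω => ?_)
      exact Finset.sum_mul_sq_le_sq_mul_sq _ _ _
  have main := tendsto_mul_variance_add (hm.eventually_ge_atTop 0)
    (Eventually.of_forall fun n => (mD n).memLp_two) hR hDV hR0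
  -- The normalisation by s only adds the constant Σ w_i log s_i, which the variance ignores.
  have hae : ∀ᶠ n in atTop, (fun ω => ∑ i, w i * Real.log ((N n i : ℝ)⁻¹ *
      ∑ k ∈ Finset.range (N n i), W n i k ω ^ 2)) =ᵐ[P]
      fun ω => (D n ω + R n ω) + ∑ i, w i * Real.log (s n i) := by
    filter_upwards [good] with n hn
    have : ∀ᵐ ω ∂P, ∀ i, 0 < q n i ω := ae_all_iff.2 fun i => (hn i).2.2.1
    filter_upwards [this] with ω hω
    rw [hDdef, hRdef, ← Finset.sum_add_distrib, ← Finset.sum_add_distrib]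
    refine Finset.sum_congr rfl fun i _ => ?_
    have hsi := (hn i).2.1
    have e : (N n i : ℝ)⁻¹ * ∑ k ∈ Finset.range (N n i), W n i k ω ^ 2 = q n i ω * s n i := by
      simp only [hq, ← Finset.sum_div]
      field_simp
    rw [e, Real.log_mul (hω i).ne' hsi.ne']; ring
  constructor
  · filter_upwards [hae, hR] with n hn hRn
    rw [memLp_congr_ae hn]
    exact ((mD n).memLp_two.add hRn).add (memLp_const _)
  · refine main.congr' ?_
    filter_upwards [hae, hR] with n hn hRn
    rw [variance_congr hn, variance_add_const (X := fun ω => D n ω + R n ω)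
      ((mD n).memLp_two.add hRn).aestronglyMeasurable]

end LogRegression

/-! ### Cesàro averages over differences of indices. -/

section Counting

lemma sum_range_range_sub_le {e : ℤ → ℝ} (h0 : ∀ r, 0 ≤ e r) (hs : Summable e) (p q : ℕ) :
    ∑ k ∈ Finset.range p, ∑ l ∈ Finset.range q, e ((k : ℤ) - l) ≤ q * ∑' r, e r := by
  rw [Finset.sum_comm]
  have : ∀ l ∈ Finset.range q, ∑ k ∈ Finset.range p, e ((k : ℤ) - l) ≤ ∑' r, e r := fun l _ => by
    rw [← Finset.sum_image (s := Finset.range p) (g := fun k : ℕ => (k : ℤ) - l) (f := e)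
      (fun a _ b _ h => by simpa using h)]
    exact hs.sum_le_tsum _ fun r _ => h0 r
  simpa using Finset.sum_le_sum this

/-- A difference r with |r| ≤ R is attained at least min p q - R times, by the pairs (t + r⁺, t +
r⁻). -/
lemma le_sum_range_range_sub {e : ℤ → ℝ} (h0 : ∀ r, 0 ≤ e r) (A : Finset ℤ) (R : ℕ)
    (hA : ∀ r ∈ A, r.natAbs ≤ R) (p q : ℕ) :
    ((min p q : ℕ) - R : ℝ) * ∑ r ∈ A, e r ≤
      ∑ k ∈ Finset.range p, ∑ l ∈ Finset.range q, e ((k : ℤ) - l) := by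
  classical
  rw [← Finset.sum_product' (Finset.range p) (Finset.range q) fun k l => e ((k : ℤ) - l)]
  set B := Finset.range p ×ˢ Finset.range q
  have h1 : ∀ r ∈ A, ((min p q : ℕ) - R : ℝ) * e r ≤
      ∑ x ∈ B, if (x.1 : ℤ) - x.2 = r then e r else 0 := fun r hr => by
    rw [← Finset.sum_filter, Finset.sum_const, nsmul_eq_mul]
    refine mul_le_mul_of_nonneg_right ?_ (h0 r)
    have hR := hA r hr
    have hcard : min p q - R ≤ (B.filter fun x => (x.1 : ℤ) - x.2 = r).card := by
      rw [← Finset.card_range (min p q - R)]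
      refine Finset.card_le_card_of_injOn (fun t => (t + r.toNat, t + (-r).toNat)) ?_ ?_
      · intro t ht
        simp only [B, Finset.coe_range, Set.mem_Iio, Finset.coe_filter, Set.mem_ofPred_eq,
          Finset.mem_product, Finset.mem_range] at ht ⊢
        omega
      · intro a _ b _ h
        simp only [Prod.mk.injEq] at h
        omega
    have : ((min p q : ℕ) : ℝ) ≤ ((min p q - R : ℕ) : ℝ) + R := by
      exact_mod_cast (by omega : min p q ≤ min p q - R + R)
    have h2 : ((min p q - R : ℕ) : ℝ) ≤ (B.filter fun x => (x.1 : ℤ) - x.2 = r).card := by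
      exact_mod_cast hcard
    linarith
  rw [Finset.mul_sum]
  refine (Finset.sum_le_sum h1).trans ?_
  rw [Finset.sum_comm]
  refine Finset.sum_le_sum fun x _ => ?_
  rw [Finset.sum_ite_eq]
  split_ifs
  · exact le_rfl
  · exact h0 _

/-- Nonnegativity gives both bounds: the upper one from the full sum, the lower one from a finite
set of differences nearly exhausting the limit sum. Convergence of the total sums replaces uniform
control of the tails. -/
lemma tendsto_avg_sum_sub {e : ℕ → ℤ → ℝ} {e' : ℤ → ℝ} (h0 : ∀ n r, 0 ≤ e n r)
    (hs : ∀ n, Summable (e n)) (hs' : Summable e')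
    (hlim : ∀ r, Tendsto (fun n => e n r) atTop (𝓝 (e' r)))
    (hsum : Tendsto (fun n => ∑' r, e n r) atTop (𝓝 (∑' r, e' r)))
    {p q : ℕ → ℕ} {N : ℕ → ℝ} (hN : Tendsto N atTop atTop)
    (hp : Tendsto (fun n => (p n : ℝ) / N n) atTop (𝓝 1))
    (hq : Tendsto (fun n => (q n : ℝ) / N n) atTop (𝓝 1)) :
    Tendsto (fun n => (N n)⁻¹ * ∑ k ∈ Finset.range (p n), ∑ l ∈ Finset.range (q n),
      e n ((k : ℤ) - l)) atTop (𝓝 (∑' r, e' r)) := by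
  refine tendsto_order.2 ⟨fun a ha => ?_, fun b hb => ?_⟩
  · obtain ⟨A, hA⟩ := (hs'.hasSum.eventually_const_lt ha).exists
    set R := A.sup Int.natAbs
    have hR : ∀ r ∈ A, r.natAbs ≤ R := fun r hr => Finset.le_sup (f := Int.natAbs) hr
    have l1 : Tendsto (fun n => (min ((p n : ℝ) / N n) ((q n : ℝ) / N n) - R * (N n)⁻¹) *
        ∑ r ∈ A, e n r) atTop (𝓝 ((min 1 1 - R * 0) * ∑ r ∈ A, e' r)) :=
      ((hp.min hq).sub ((tendsto_inv_atTop_zero.comp hN).const_mul _)).mul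
        (tendsto_finsetSum _ fun r _ => hlim r)
    simp only [min_self, mul_zero, sub_zero, one_mul] at l1
    filter_upwards [l1.eventually_const_lt hA, hN.eventually_gt_atTop 0] with n h1 hn
    refine h1.trans_le ?_
    have := mul_le_mul_of_nonneg_left (le_sum_range_range_sub (h0 n) A R hR (p n) (q n))
      (inv_pos.2 hn).le
    refine le_trans (le_of_eq ?_) this
    rw [min_div_div_right hn.le, Nat.cast_min]
    field_simp
  · have l1 : Tendsto (fun n => (q n : ℝ) / N n * ∑' r, e n r) atTop (𝓝 (1 * ∑' r, e' r)) :=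
      hq.mul hsum
    rw [one_mul] at l1
    filter_upwards [l1.eventually_lt_const hb, hN.eventually_gt_atTop 0] with n h1 hn
    refine lt_of_le_of_lt ?_ h1
    have := mul_le_mul_of_nonneg_left (sum_range_range_sub_le (h0 n) (hs n) (p n) (q n))
      (inv_pos.2 hn).le
    exact this.trans_eq (by field_simp)

end Counting

/-! ### Periodization and Parseval's identity on the line. -/

section Periodization

open Real in
lemma one_add_abs_rpow_le {p x : ℝ} (hp : 0 ≤ p) (hx : |x| ≤ π) (l : ℤ) :
    (1 + |x + 2 * l * π|) ^ (-p) ≤ (1 + |(l : ℝ)|) ^ (-p) := by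
  refine Real.rpow_le_rpow_of_nonpos (by positivity) ?_ (by linarith)
  rcases eq_or_ne l 0 with rfl | hl
  · simp
  have h1 : (1 : ℝ) ≤ |(l : ℝ)| := by exact_mod_cast Int.one_le_abs hl
  have h2 : |2 * l * π| - |x| ≤ |x + 2 * l * π| := by
    have := abs_sub_abs_le_abs_sub (2 * l * π) (-x)
    rwa [abs_neg, sub_neg_eq_add, add_comm _ x] at this
  rw [abs_mul, abs_mul, abs_two, abs_of_pos Real.pi_pos] at h2
  nlinarith [Real.pi_gt_three]

lemma summable_one_add_abs_int_rpow {p : ℝ} (hp : 1 < p) :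
    Summable fun l : ℤ => (1 + |(l : ℝ)|) ^ (-p) := by
  refine (Real.summable_abs_int_rpow hp).of_norm_bounded_eventually ?_
  have : ({0} : Set ℤ).Finite := Set.finite_singleton 0
  filter_upwards [this.compl_mem_cofinite] with l hl
  have h1 : 0 < |(l : ℝ)| := abs_pos.2 (by exact_mod_cast hl)
  rw [Real.norm_of_nonneg (by positivity)]
  exact Real.rpow_le_rpow_of_nonpos h1 (by linarith) (by linarith)

variable {G : ℝ → ℂ} {C p : ℝ}

/-- `2π`-periodization. -/
noncomputable def periodize (G : ℝ → ℂ) (x : ℝ) : ℂ := ∑' l : ℤ, G (x + 2 * l * Real.pi)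

lemma norm_shift_le (hp : 1 < p) (hC : 0 ≤ C) (hG : ∀ x, ‖G x‖ ≤ C * (1 + |x|) ^ (-p)) {x : ℝ}
    (hx : |x| ≤ Real.pi) (l : ℤ) :
    ‖G (x + 2 * l * Real.pi)‖ ≤ C * (1 + |(l : ℝ)|) ^ (-p) :=
  (hG _).trans (mul_le_mul_of_nonneg_left (one_add_abs_rpow_le (by linarith) hx l) hC)

lemma norm_periodize_le (hp : 1 < p) (hC : 0 ≤ C) (hG : ∀ x, ‖G x‖ ≤ C * (1 + |x|) ^ (-p)) {x : ℝ}
    (hx : |x| ≤ Real.pi) :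
    ‖periodize G x‖ ≤ C * ∑' l : ℤ, (1 + |(l : ℝ)|) ^ (-p) := by
  have hs := (summable_one_add_abs_int_rpow hp).mul_left C
  rw [← tsum_mul_left]
  exact tsum_of_norm_bounded hs.hasSum (norm_shift_le hp hC hG hx)

lemma integrable_of_decay (hp : 1 < p) (hm : AEStronglyMeasurable G)
    (hG : ∀ x, ‖G x‖ ≤ C * (1 + |x|) ^ (-p)) : Integrable G := by
  have : Integrable fun x : ℝ => (1 + ‖x‖) ^ (-p) := integrable_one_add_norm (by simpa using hp)
  exact (this.const_mul C).mono' hm (ae_of_all _ hG)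

lemma quasiMeasurePreserving_add_right' (a : ℝ) :
    Measure.QuasiMeasurePreserving (fun x : ℝ => x + a) volume volume :=
  (measurePreserving_add_right volume a).quasiMeasurePreserving

lemma aestronglyMeasurable_periodize (hm : AEStronglyMeasurable G) :
    AEStronglyMeasurable (periodize G) := by
  unfold periodize
  refine AEMeasurable.aestronglyMeasurable (AEMeasurable.tsum fun l : ℤ => ?_)
  exact (hm.comp_quasiMeasurePreserving (quasiMeasurePreserving_add_right' _)).aemeasurable

-- The line is cut into translates of (-π, π]; for integer r the exponential is 2π-periodic, so the
-- pieces can be summed under the integral.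
open Real in
lemma integral_mul_exp_eq_periodize (hp : 1 < p) (hC : 0 ≤ C) (hm : AEStronglyMeasurable G)
    (hG : ∀ x, ‖G x‖ ≤ C * (1 + |x|) ^ (-p)) (r : ℤ) :
    ∫ x, G x * Complex.exp (Complex.I * x * r) =
      ∫ x in (-π)..π, periodize G x * Complex.exp (Complex.I * x * r) := by
  set E : ℝ → ℂ := fun x => Complex.exp (Complex.I * x * r) with hE
  have nE : ∀ x, ‖E x‖ = 1 := fun x => by
    have : Complex.I * x * r = ((x * r : ℝ) : ℂ) * Complex.I := by push_cast; ring
    rw [hE]; simp only [this, Complex.norm_exp_ofReal_mul_I]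
  have cE : Continuous E := by fun_prop
  have pE : ∀ x (l : ℤ), E (x + 2 * l * π) = E x := fun x l => by
    simp only [hE]
    have : Complex.I * ((x + 2 * l * π : ℝ) : ℂ) * r =
        Complex.I * x * r + ((l * r : ℤ) : ℂ) * (2 * π * Complex.I) := by push_cast; ring
    rw [this, Complex.exp_periodic.int_mul]
  have hint : Integrable fun x => G x * E x :=
    (integrable_of_decay hp hm hG).mul_bdd (c := 1) cE.aestronglyMeasurable
      (ae_of_all _ fun x => (nE x).le)
  have hpi := Real.pi_pos
  have h2pi : 0 < 2 * π := by positivity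
  have s1 := hasSum_integral_iUnion (μ := volume) (f := fun x => G x * E x)
    (s := fun n : ℤ => Set.Ioc (-π + n • (2 * π)) (-π + (n + 1) • (2 * π)))
    (fun _ => measurableSet_Ioc) (Set.pairwise_disjoint_Ioc_add_zsmul (-π) (2 * π)) hint.integrableOn
  rw [iUnion_Ioc_add_zsmul h2pi, setIntegral_univ] at s1
  have s2 : ∀ n : ℤ, ∫ x in Set.Ioc (-π + n • (2 * π)) (-π + (n + 1) • (2 * π)), G x * E x =
      ∫ x in Set.Ioc (-π) π, G (x + 2 * n * π) * E x := fun n => by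
    rw [← intervalIntegral.integral_of_le (by simp [add_mul]; positivity),
      ← intervalIntegral.integral_of_le (by linarith)]
    have := intervalIntegral.integral_comp_add_right (fun x => G x * E x) (a := -π) (b := π)
      (2 * n * π)
    simp only [pE] at this
    rw [this]
    congr 1 <;> simp <;> ring
  simp_rw [s2] at s1
  have s3 := hasSum_integral_of_summable_integral_norm (μ := volume.restrict (Set.Ioc (-π) π))
    (F := fun (n : ℤ) x => G (x + 2 * n * π) * E x) (fun n => ?_) ?_
  · rw [← s1.tsum_eq, s3.tsum_eq, intervalIntegral.integral_of_le (by linarith)]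
    simp only [periodize, tsum_mul_right]
    rfl
  · have h := hint.comp_add_right (2 * n * π)
    simp only [pE] at h
    exact h.integrableOn
  · refine Summable.of_nonneg_of_le (fun n => integral_nonneg fun x => norm_nonneg _) (fun n => ?_)
      (((summable_one_add_abs_int_rpow hp).mul_left C).mul_left (2 * π))
    have : ∫ x in Set.Ioc (-π) π, ‖G (x + 2 * n * π) * E x‖ ≤
        ∫ x in Set.Ioc (-π) π, C * (1 + |(n : ℝ)|) ^ (-p) := by
      refine integral_mono_of_nonneg (ae_of_all _ fun x => norm_nonneg _) (integrable_const _) ?_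
      refine (ae_restrict_iff' measurableSet_Ioc).2 (ae_of_all _ fun x hx => ?_)
      simp only [norm_mul, nE, mul_one]
      exact norm_shift_le hp hC hG (abs_le.2 ⟨hx.1.le, hx.2⟩) n
    refine this.trans_eq ?_
    simp
    left
    rw [max_eq_left] <;> linarith

-- Integer-frequency Fourier integrals over ℝ are, up to 2π, the Fourier coefficients of the
-- periodization, which is bounded and hence square integrable; Parseval applies.
open Real in
lemma hasSum_sq_integral_mul_exp (hp : 1 < p) (hC : 0 ≤ C) (hm : AEStronglyMeasurable G)
    (hG : ∀ x, ‖G x‖ ≤ C * (1 + |x|) ^ (-p)) :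
    HasSum (fun r : ℤ => ‖∫ x, G x * Complex.exp (Complex.I * x * r)‖ ^ 2)
      (2 * π * ∫ x in (-π)..π, ‖periodize G x‖ ^ 2) := by
  have hpi := Real.pi_pos
  have hab : -π < π := by linarith
  have hL2 : MemLp (periodize G) 2 (volume.restrict (Set.Ioc (-π) π)) := by
    refine MemLp.of_bound (aestronglyMeasurable_periodize hm).restrict
      (C * ∑' l : ℤ, (1 + |(l : ℝ)|) ^ (-p)) ?_
    refine (ae_restrict_iff' measurableSet_Ioc).2 (ae_of_all _ fun x hx => ?_)
    exact norm_periodize_le hp hC hG (abs_le.2 ⟨hx.1.le, hx.2⟩)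
  have h := ((hasSum_sq_fourierCoeffOn hab hL2).mul_left ((2 * π) ^ 2))
  -- Fourier coefficients carry exp(-inx), hence the reflection of the index.
  have h' := (Equiv.neg ℤ).hasSum_iff.2 h
  have e0 : (fun r : ℤ => ‖∫ x, G x * Complex.exp (Complex.I * x * r)‖ ^ 2) =
      (fun i => (2 * π) ^ 2 * ‖fourierCoeffOn hab (periodize G) i‖ ^ 2) ∘ ⇑(Equiv.neg ℤ) := by
    ext r
    simp only [Function.comp_apply, Equiv.neg_apply]
    rw [integral_mul_exp_eq_periodize hp hC hm hG r, fourierCoeffOn_eq_integral, norm_smul]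
    have : ∀ x : ℝ, (fourier (- -r) (x : AddCircle (π - -π)) : ℂ) • periodize G x =
        periodize G x * Complex.exp (Complex.I * x * r) := fun x => by
      rw [fourier_coe_apply, smul_eq_mul, mul_comm, neg_neg]
      congr 2
      have : (π : ℂ) ≠ 0 := by exact_mod_cast hpi.ne'
      push_cast
      field_simp
      ring
    simp_rw [this]
    have e : 2 * π * ‖1 / (π - -π)‖ = 1 := by
      rw [Real.norm_of_nonneg (by apply div_nonneg <;> linarith)]
      field_simp; ring
    rw [← mul_pow, ← mul_assoc, e, one_mul]
  have e1 : 2 * π * ∫ x in (-π)..π, ‖periodize G x‖ ^ 2 =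
      (2 * π) ^ 2 * (π - -π)⁻¹ • ∫ x in (-π)..π, ‖periodize G x‖ ^ 2 := by
    rw [smul_eq_mul, sub_neg_eq_add, ← two_mul]
    field_simp
  rw [e0, e1]
  exact h'

/-- Under a uniform decay bound, pointwise convergence implies convergence of the Fourier
coefficients and of their square sums. -/
lemma tendsto_fourier_of_decay {Gn : ℕ → ℝ → ℂ} (hp : 1 < p) (hC : 0 ≤ C)
    (hm : ∀ n, AEStronglyMeasurable (Gn n)) (hGn : ∀ n x, ‖Gn n x‖ ≤ C * (1 + |x|) ^ (-p))
    (hlim : ∀ x, Tendsto (fun n => Gn n x) atTop (𝓝 (G x))) :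
    (∀ r : ℤ, Tendsto (fun n => ∫ x, Gn n x * Complex.exp (Complex.I * x * r)) atTop
      (𝓝 (∫ x, G x * Complex.exp (Complex.I * x * r)))) ∧
    Tendsto (fun n => ∑' r : ℤ, ‖∫ x, Gn n x * Complex.exp (Complex.I * x * r)‖ ^ 2) atTop
      (𝓝 (∑' r : ℤ, ‖∫ x, G x * Complex.exp (Complex.I * x * r)‖ ^ 2)) := by
  have hm' : AEStronglyMeasurable G := aestronglyMeasurable_of_tendsto_ae atTop hm
    (ae_of_all _ hlim)
  have hG : ∀ x, ‖G x‖ ≤ C * (1 + |x|) ^ (-p) := fun x =>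
    le_of_tendsto (hlim x).norm (Eventually.of_forall fun n => hGn n x)
  have nE : ∀ (r : ℤ) (x : ℝ), ‖Complex.exp (Complex.I * x * r)‖ = 1 := fun r x => by
    have : Complex.I * x * r = ((x * r : ℝ) : ℂ) * Complex.I := by push_cast; ring
    rw [this, Complex.norm_exp_ofReal_mul_I]
  constructor
  · intro r
    have hb : Integrable fun x : ℝ => C * (1 + ‖x‖) ^ (-p) :=
      (integrable_one_add_norm (by simpa using hp)).const_mul C
    refine tendsto_integral_of_dominated_convergence _ (fun n => ?_) hb (fun n => ?_) ?_
    · exact (hm n).mul (by fun_prop)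
    · exact ae_of_all _ fun x => by rw [norm_mul, nE, mul_one]; exact hGn n x
    · exact ae_of_all _ fun x => (hlim x).mul_const _
  -- No summable majorant for the squared coefficients is at hand; Parseval moves the limit to an
  -- integral over a bounded interval with a bounded integrand.
  · rw [(hasSum_sq_integral_mul_exp hp hC hm' hG).tsum_eq]
    simp_rw [(hasSum_sq_integral_mul_exp hp hC (hm _) (hGn _)).tsum_eq]
    refine Tendsto.const_mul _ ?_
    set B := C * ∑' l : ℤ, (1 + |(l : ℝ)|) ^ (-p)
    refine intervalIntegral.tendsto_integral_filter_of_dominated_convergence (fun _ => B ^ 2) ?_ ?_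
      (by simp) ?_
    · exact Eventually.of_forall fun n =>
        ((aestronglyMeasurable_periodize (hm n)).restrict.norm.pow 2)
    · refine Eventually.of_forall fun n => ae_of_all _ fun x hx => ?_
      rw [Set.uIoc_of_le (by linarith [Real.pi_pos])] at hx
      rw [norm_pow, norm_norm]
      exact pow_le_pow_left₀ (norm_nonneg _)
        (norm_periodize_le hp hC (hGn n) (abs_le.2 ⟨hx.1.le, hx.2⟩)) 2
    · refine ae_of_all _ fun x hx => ?_
      rw [Set.uIoc_of_le (by linarith [Real.pi_pos])] at hx
      refine (Tendsto.norm ?_).pow 2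
      exact tendsto_tsum_of_dominated_convergence
        ((summable_one_add_abs_int_rpow hp).mul_left C) (fun l => hlim _)
        (Eventually.of_forall fun n l => norm_shift_le hp hC (hGn n)
          (abs_le.2 ⟨hx.1.le, hx.2⟩) l)

end Periodization

/-! ### Vanishing moments and factorization through finite differences. -/

section FiniteDifferences

open Polynomial

/-- The m-th derivative at 1 is the sum of the b_l weighted by the falling factorial l(l - 1)⋯(l - m
+ 1), a combination of moments of order at most m. Hence 1 is a root of multiplicity at least M. -/
lemma X_sub_one_pow_dvd_of_moments {M : ℕ} {b : ℕ → ℝ} {n : ℕ}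
    (h : ∀ m < M, ∑ l ∈ Finset.range n, (l : ℝ) ^ m * b l = 0) :
    (X - 1 : ℝ[X]) ^ M ∣ ∑ l ∈ Finset.range n, C (b l) * X ^ l := by
  set p : ℝ[X] := ∑ l ∈ Finset.range n, C (b l) * X ^ l
  rcases eq_or_ne p 0 with hp | hp
  · rw [hp]; exact dvd_zero _
  -- The multiplicity criterion is used with `M - 1`, so M = 0 is set apart.
  rcases Nat.eq_zero_or_pos M with rfl | hM
  · simp
  have hroot : ∀ m < M, (derivative^[m] p).IsRoot 1 := fun m hm => by
    rw [IsRoot.def, iterate_derivative_sum, eval_finsetSum]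
    simp only [iterate_derivative_C_mul, iterate_derivative_X_pow_eq_natCast_mul, eval_mul, eval_C,
      eval_natCast, eval_pow, eval_X, one_pow, mul_one]
    simp only [← descPochhammer_eval_eq_descFactorial ℝ, eval_eq_sum_range, Finset.mul_sum]
    rw [Finset.sum_comm]
    refine Finset.sum_eq_zero fun i hi => ?_
    rw [Finset.mem_range, descPochhammer_natDegree] at hi
    have := h i (by omega)
    calc ∑ l ∈ Finset.range n, b l * ((descPochhammer ℝ m).coeff i * (l : ℝ) ^ i)
        = (descPochhammer ℝ m).coeff i * ∑ l ∈ Finset.range n, (l : ℝ) ^ i * b l := by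
          rw [Finset.mul_sum]; exact Finset.sum_congr rfl fun l _ => by ring
      _ = 0 := by rw [this, mul_zero]
  have := lt_rootMultiplicity_of_isRoot_iterate_derivative_of_mem_nonZeroDivisors (n := M - 1) hp
    (fun m hm => hroot m (by omega))
    (mem_nonZeroDivisors_of_ne_zero (by exact_mod_cast Nat.factorial_ne_zero _))
  have h2 : M ≤ p.rootMultiplicity 1 := by omega
  simpa using (le_rootMultiplicity_iff hp).1 h2

/-- Forward shift of two-sided sequences. -/
noncomputable def shiftMap : Module.End ℝ (ℤ → ℝ) := LinearMap.funLeft ℝ ℝ (· + 1)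

lemma shiftMap_pow_apply (l : ℕ) (x : ℤ → ℝ) (n : ℤ) : (shiftMap ^ l) x n = x (n + l) := by
  induction l generalizing x n with
  | zero => simp
  | succ l ih =>
    rw [pow_succ, Module.End.mul_apply, ih]
    simp only [shiftMap, LinearMap.funLeft_apply]
    congr 1; push_cast; ring

lemma aeval_shiftMap_apply (p : ℝ[X]) (x : ℤ → ℝ) (n : ℤ) :
    aeval shiftMap p x n = ∑ i ∈ Finset.range (p.natDegree + 1), p.coeff i * x (n + i) := by
  rw [aeval_eq_sum_range]
  simp [LinearMap.sum_apply, Finset.sum_apply, shiftMap_pow_apply]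

variable {Ω : Type*}

lemma shiftMap_sub_one_pow_apply (M : ℕ) (X : ℤ → Ω → ℝ) (ω : Ω) :
    ((shiftMap - 1) ^ M) (fun k => X k ω) = fun n => diffIter M X (n + M) ω := by
  induction M with
  | zero => ext n; simp [diffIter]
  | succ M ih =>
    rw [pow_succ', Module.End.mul_apply, ih]
    ext n
    simp only [diffIter, Function.iterate_succ_apply', diff, LinearMap.sub_apply, Pi.sub_apply,
      Module.End.one_apply, shiftMap, LinearMap.funLeft_apply]
    push_cast
    congr 2 <;> ring_nf

/-- Polynomial calculus in the shift operator S: the factor (S - 1)^M is the M-th difference, read M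
places ahead because `diff` is a backward difference. Thus only the stationary sequence Δ^M X enters
the wavelet coefficients. -/
lemma sum_mul_eq_sum_mul_diffIter {M n : ℕ} {b : ℕ → ℝ} {q : ℝ[X]}
    (hq : ∑ l ∈ Finset.range n, C (b l) * Polynomial.X ^ l = (Polynomial.X - 1) ^ M * q)
    (X : ℤ → Ω → ℝ) (a : ℤ) (ω : Ω) :
    ∑ l ∈ Finset.range n, b l * X (a + l) ω =
      ∑ i ∈ Finset.range (q.natDegree + 1), q.coeff i * diffIter M X (a + i + M) ω := by
  have h1 : aeval shiftMap (∑ l ∈ Finset.range n, C (b l) * Polynomial.X ^ l)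
      (fun k => X k ω) a = ∑ l ∈ Finset.range n, b l * X (a + l) ω := by
    simp [map_sum, LinearMap.sum_apply, Finset.sum_apply, shiftMap_pow_apply,
      ← Polynomial.smul_eq_C_mul]
  rw [← h1, hq, mul_comm, map_mul, Module.End.mul_apply, map_pow, map_sub, aeval_X, map_one,
    shiftMap_sub_one_pow_apply, aeval_shiftMap_apply]

end FiniteDifferences

/-! ### Wavelet coefficients as finite discrete filters. -/

noncomputable section Filters

variable {φ ψ : ℝ → ℝ} {M T : ℕ} {α : ℝ}

/-- The (continuous-time) impulse response of the wavelet filter at scale `j`. -/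
def filterKer (φ ψ : ℝ → ℝ) (j : ℕ) (τ : ℝ) : ℝ := ∫ t, φ (t - τ) * psiJK ψ j 0 t

/-- An upper bound for the length of the filter at scale `j`. -/
def filterLen (T j : ℕ) : ℕ := 2 ^ j * T + T

lemma two_rpow_neg_natCast (j : ℕ) : (2 : ℝ) ^ (-(j : ℝ)) = ((2 : ℝ) ^ j)⁻¹ := by
  rw [Real.rpow_neg (by norm_num), Real.rpow_natCast]

lemma psiJK_ne_zero (hs : Function.support ψ ⊆ Set.Ioo 0 (T : ℝ)) {j : ℕ} {k : ℤ} {t : ℝ}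
    (h : psiJK ψ j k t ≠ 0) : 2 ^ j * (k : ℝ) < t ∧ t < 2 ^ j * (k : ℝ) + 2 ^ j * T := by
  have h2 : (0 : ℝ) < 2 ^ j := by positivity
  have := hs (Function.mem_support.2 (right_ne_zero_of_mul h))
  rw [two_rpow_neg_natCast, Set.mem_Ioo, inv_mul_eq_div] at this
  constructor
  · have := (lt_div_iff₀ h2).1 (show (k : ℝ) < t / 2 ^ j by linarith)
    linarith
  · have := (div_lt_iff₀ h2).1 (show t / 2 ^ j < k + T by linarith)
    linarith

lemma phi_ne_zero (hs : Function.support φ ⊆ Set.Ioo (-(T : ℝ)) 0) {t : ℝ} (h : φ t ≠ 0) :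
    -(T : ℝ) < t ∧ t < 0 := hs (Function.mem_support.2 h)

lemma psiJK_shift (j : ℕ) (k : ℤ) (t : ℝ) : psiJK ψ j k (t + 2 ^ j * k) = psiJK ψ j 0 t := by
  simp only [psiJK]
  congr 2
  rw [two_rpow_neg_natCast]
  push_cast
  field_simp; ring

/-- If both factors are nonzero at t, then t < l < t + T and 2^j k < t < 2^j k + 2^j T, so 0 < l -
2^j k < 2^j T + T. -/
lemma tsum_mul_psiJK (hφ : Function.support φ ⊆ Set.Ioo (-(T : ℝ)) 0)
    (hψ : Function.support ψ ⊆ Set.Ioo 0 (T : ℝ)) (x : ℤ → ℝ) (j : ℕ) (k : ℤ) (t : ℝ) :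
    (∑' l : ℤ, x l * φ (t - l)) * psiJK ψ j k t =
      ∑ i ∈ Finset.range (filterLen T j), x (2 ^ j * k + i) *
        (φ (t - (2 ^ j * k + i : ℝ)) * psiJK ψ j k t) := by
  by_cases h : psiJK ψ j k t = 0
  · simp [h]
  obtain ⟨h1, h2⟩ := psiJK_ne_zero hψ h
  have hsupp : ∀ l : ℤ, l ∉ (Finset.range (filterLen T j)).image
      (fun i : ℕ => (2 ^ j * k + i : ℤ)) → x l * φ (t - l) = 0 := fun l hl => by
    by_contra h0
    obtain ⟨h3, h4⟩ := phi_ne_zero hφ (right_ne_zero_of_mul h0)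
    refine hl (Finset.mem_image.2 ⟨(l - 2 ^ j * k).toNat, ?_, ?_⟩)
    · have : ((l - 2 ^ j * k : ℤ) : ℝ) < ((filterLen T j : ℕ) : ℤ) := by
        rw [filterLen]; push_cast; linarith
      have := Int.cast_lt.1 this
      have : (0 : ℝ) < ((l - 2 ^ j * k : ℤ) : ℝ) := by push_cast; linarith
      have := Int.cast_pos.1 this
      rw [Finset.mem_range]; omega
    · have : (0 : ℝ) < ((l - 2 ^ j * k : ℤ) : ℝ) := by push_cast; linarith
      have := Int.cast_pos.1 this
      omega
  rw [tsum_eq_sum hsupp, Finset.sum_image (fun a _ b _ h => by simpa using h), Finset.sum_mul]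
  refine Finset.sum_congr rfl fun i _ => ?_
  push_cast; ring

lemma memLp_psiJK (hψ : MemLp ψ 2 volume) (j : ℕ) (k : ℤ) : MemLp (psiJK ψ j k) 2 volume := by
  unfold psiJK
  refine MemLp.const_mul ?_ _
  have h2 : (2 : ℝ) ^ (-(j : ℝ)) ≠ 0 := by positivity
  have h1 : MemLp (fun t => ψ (t - k)) 2 volume :=
    hψ.comp_measurePreserving (measurePreserving_sub_right volume (k : ℝ))
  have hmap := Real.smul_map_volume_mul_left h2
  have h3 : MemLp (fun t => ψ (t - k)) 2 (Measure.map ((2 : ℝ) ^ (-(j : ℝ)) * ·) volume) := by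
    rw [Real.map_volume_mul_left h2]
    exact h1.smul_measure (by simp)
  exact h3.comp_of_map (by fun_prop)

lemma integrable_phi_mul_psiJK (hφ : MemLp φ 2 volume) (hψ : MemLp ψ 2 volume) (j : ℕ) (k : ℤ)
    (τ : ℝ) : Integrable fun t => φ (t - τ) * psiJK ψ j k t :=
  (hφ.comp_measurePreserving (measurePreserving_sub_right volume τ)).integrable_mul
    (memLp_psiJK hψ j k)

/-- Wavelet coefficients are obtained by a finite linear filter. -/
lemma waveletCoeff_eq_sum (hW : WaveletAssumptions φ ψ M α T) (x : ℤ → ℝ) (j : ℕ) (k : ℤ) :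
    waveletCoeff φ ψ x j k =
      ∑ l ∈ Finset.range (filterLen T j), filterKer φ ψ j l * x (2 ^ j * k + l) := by
  unfold waveletCoeff
  simp_rw [tsum_mul_psiJK hW.support_phi hW.support_psi]
  rw [integral_finsetSum _ fun i _ =>
    (integrable_phi_mul_psiJK hW.memLp_phi hW.memLp_psi j k _).const_mul _]
  refine Finset.sum_congr rfl fun i _ => ?_
  rw [integral_const_mul, mul_comm]
  congr 1
  rw [filterKer, ← integral_add_right_eq_self _ ((2 : ℝ) ^ j * k)]
  congr 1; ext t
  rw [psiJK_shift]
  congr 2; ring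

lemma integral_pow_mul_psiJK (hW : WaveletAssumptions φ ψ M α T) (j : ℕ) {m : ℕ} (hm : m < M) :
    Integrable (fun t => t ^ m * psiJK ψ j 0 t) ∧ ∫ t, t ^ m * psiJK ψ j 0 t = 0 := by
  set c : ℝ := (2 : ℝ) ^ (-(j : ℝ)) with hc
  have hc0 : 0 < c := by positivity
  have e : (fun t => t ^ m * psiJK ψ j 0 t) =
      fun t => ((2 : ℝ) ^ (-(j : ℝ) / 2) * (c⁻¹) ^ m) * ((fun s => s ^ m * ψ s) (c * t)) := by
    ext t
    simp only [psiJK, ← hc]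
    have : (c⁻¹) ^ m * c ^ m = 1 := by rw [← mul_pow, inv_mul_cancel₀ hc0.ne', one_pow]
    rw [mul_pow]
    simp only [Int.cast_zero, sub_zero]
    linear_combination -(t ^ m * (2 : ℝ) ^ (-(j : ℝ) / 2) * ψ (c * t)) * this
  have hi : Integrable fun s => s ^ m * ψ s := by
    have : (fun s => s ^ m * ψ s) =
        fun s => (Set.Ioo (0 : ℝ) T).indicator (fun s => s ^ m) s * ψ s := by
      ext s
      by_cases hs : s ∈ Set.Ioo (0 : ℝ) T
      · simp [hs]
      · have : ψ s = 0 := by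
          by_contra h; exact hs (hW.support_psi h)
        simp [this]
    rw [this]
    refine hW.integrable_psi.bdd_mul (c := (T : ℝ) ^ m) ?_ (ae_of_all _ fun s => ?_)
    · exact ((continuous_pow m).measurable.indicator measurableSet_Ioo).aestronglyMeasurable
    · by_cases hs : s ∈ Set.Ioo (0 : ℝ) T
      · simp only [Set.indicator_of_mem hs, norm_pow, Real.norm_eq_abs]
        exact pow_le_pow_left₀ (abs_nonneg _) (abs_le.2 ⟨by linarith [hs.1, hs.2], hs.2.le⟩) _
      · simp [hs]
  rw [e]
  refine ⟨(hi.comp_mul_left' hc0.ne').const_mul _, ?_⟩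
  rw [integral_const_mul, Measure.integral_comp_mul_left (fun s => s ^ m * ψ s),
    hW.vanishing_moments m hm]
  simp

/-- The sum is the wavelet coefficient of the sequence l^m: the interpolated sequence is a
polynomial of degree m, which the vanishing moments of ψ annihilate. -/
lemma sum_pow_mul_filterKer (hW : WaveletAssumptions φ ψ M α T) (j : ℕ) {m : ℕ} (hm : m < M) :
    ∑ l ∈ Finset.range (filterLen T j), (l : ℝ) ^ m * filterKer φ ψ j l = 0 := by
  have h := waveletCoeff_eq_sum hW (fun l => (l : ℝ) ^ m) j 0
  simp only [mul_zero, zero_add, Int.cast_natCast] at h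
  simp_rw [mul_comm ((_ : ℝ) ^ m)]
  rw [← h, waveletCoeff]
  obtain ⟨p, hp, hpe⟩ := hW.polynomial_phi m hm
  have : (fun t => (∑' l : ℤ, (l : ℝ) ^ m * φ (t - l)) * psiJK ψ j 0 t) =ᵐ[volume]
      fun t => ∑ i ∈ Finset.range (p.natDegree + 1), p.coeff i * (t ^ i * psiJK ψ j 0 t) := by
    filter_upwards [hpe] with t ht
    rw [ht, Polynomial.eval_eq_sum_range, Finset.sum_mul]
    exact Finset.sum_congr rfl fun i _ => by ring
  have hdeg : p.natDegree = m := Polynomial.natDegree_eq_of_degree_eq_some hp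
  rw [integral_congr_ae this, integral_finsetSum]
  · refine Finset.sum_eq_zero fun i hi => ?_
    rw [Finset.mem_range] at hi
    rw [integral_const_mul, (integral_pow_mul_psiJK hW j (by omega)).2, mul_zero]
  · intro i hi
    rw [Finset.mem_range] at hi
    exact (integral_pow_mul_psiJK hW j (by omega)).1.const_mul _

/-- Transfer function of the wavelet filter at scale `j`. -/
def transfer (φ ψ : ℝ → ℝ) (T j : ℕ) (x : ℝ) : ℂ :=
  ∑ l ∈ Finset.range (filterLen T j), (filterKer φ ψ j l : ℂ) * Complex.exp (Complex.I * x * l)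

lemma continuous_transfer (φ ψ : ℝ → ℝ) (T j : ℕ) : Continuous (transfer φ ψ T j) := by
  unfold transfer; fun_prop

/-- One quotient polynomial serves both in the time domain, acting on Δ^M X, and in the frequency
domain, as a cofactor of (e^{ix} - 1)^M. -/
lemma exists_transfer_factor (hW : WaveletAssumptions φ ψ M α T) (j : ℕ) :
    ∃ q : Polynomial ℝ,
      (∀ {Ω : Type _} (X : ℤ → Ω → ℝ) (k : ℤ) (ω : Ω),
        waveletCoeff φ ψ (fun l => X l ω) j k =
        ∑ i ∈ Finset.range (q.natDegree + 1), q.coeff i * diffIter M X (2 ^ j * k + i + M) ω) ∧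
      ∀ x : ℝ, transfer φ ψ T j x = (Complex.exp (Complex.I * x) - 1) ^ M *
        ∑ i ∈ Finset.range (q.natDegree + 1), (q.coeff i : ℂ) * Complex.exp (Complex.I * x * i) := by
  obtain ⟨q, hq⟩ := X_sub_one_pow_dvd_of_moments
    (b := fun l => filterKer φ ψ j l) (fun m hm => sum_pow_mul_filterKer hW j hm)
  refine ⟨q, fun X k ω => ?_, fun x => ?_⟩
  · rw [waveletCoeff_eq_sum hW, sum_mul_eq_sum_mul_diffIter hq]
  · have := congrArg (Polynomial.aeval (Complex.exp (Complex.I * x))) hq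
    rw [map_mul, Polynomial.aeval_eq_sum_range (p := q)] at this
    simp only [map_sum, map_mul, map_pow, map_sub, Polynomial.aeval_X, Polynomial.aeval_C, map_one,
      ← Complex.exp_nat_mul, Complex.coe_algebraMap, Complex.real_smul] at this
    simp only [transfer, mul_comm (Complex.I * (x : ℂ)) _]
    simpa using this

end Filters

/-! ### Spectral representation of wavelet covariances. -/

noncomputable section WaveletCovariance

open scoped ComplexConjugate

variable {φ ψ : ℝ → ℝ} {M T : ℕ} {α : ℝ} {Ω : Type*} [MeasurableSpace Ω] {P : Measure Ω}
  {X : ℤ → Ω → ℝ}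

lemma isGaussianProcess_waveletCoeff (hW : WaveletAssumptions φ ψ M α T)
    (hX : IsGaussianProcess X P) :
    IsGaussianProcess (fun (p : ℕ × ℤ) ω => waveletCoeff φ ψ (fun l => X l ω) p.1 p.2) P := by
  classical
  refine hX.of_isGaussianProcess fun p => ?_
  let I : Finset ℤ := (Finset.range (filterLen T p.1)).image fun i : ℕ => 2 ^ p.1 * p.2 + (i : ℤ)
  have hmem : ∀ i : Fin (filterLen T p.1), 2 ^ p.1 * p.2 + ((i : ℕ) : ℤ) ∈ I := fun i =>
    Finset.mem_image.2 ⟨i, Finset.mem_range.2 i.2, rfl⟩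
  refine ⟨I, ∑ i : Fin (filterLen T p.1), filterKer φ ψ p.1 (i : ℕ) •
    ContinuousLinearMap.proj (R := ℝ) (φ := fun _ : I => ℝ) ⟨_, hmem i⟩, fun ω => ?_⟩
  rw [waveletCoeff_eq_sum hW, Finset.sum_range]
  simp

variable {d : ℝ} {f : ℝ → ℝ}

lemma integral_waveletCoeff_eq_zero (hW : WaveletAssumptions φ ψ M α T)
    (hX : HasSpectralDensity (diffIter M X) P f) [IsProbabilityMeasure P]
    (hmean : ∀ k : ℤ, ∫ ω, diffIter M X k ω ∂P = 0) (j : ℕ) (k : ℤ) :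
    ∫ ω, waveletCoeff φ ψ (fun l => X l ω) j k ∂P = 0 := by
  obtain ⟨q, hq, -⟩ := exists_transfer_factor hW j
  simp_rw [hq X]
  rw [integral_finsetSum _ fun i _ => ((hX.memLp _).integrable (by norm_num)).const_mul _]
  simp [integral_const_mul, hmean]

lemma norm_one_sub_exp_pos {x : ℝ} (hx : x ∈ Set.Ioc (-Real.pi) Real.pi) (h0 : x ≠ 0) :
    0 < ‖1 - Complex.exp (-(Complex.I * x))‖ := by
  rw [norm_pos_iff, sub_ne_zero]
  intro h
  obtain ⟨n, hn⟩ := Complex.exp_eq_one_iff.1 h.symm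
  have h1 : -x = n * (2 * Real.pi) := by
    have := congrArg Complex.im hn
    simpa using this
  have hpi := Real.pi_pos
  have h2 : (-1 : ℝ) < n := by
    by_contra h; push Not at h; nlinarith [hx.2]
  have h3 : (n : ℝ) < 1 := by
    by_contra h; push Not at h; nlinarith [hx.1]
  have h4 : n = 0 := by
    have : -1 < n := by exact_mod_cast h2
    have : n < 1 := by exact_mod_cast h3
    omega
  rw [h4] at h1; simp at h1; exact h0 h1

/-- Spectral representation of the covariances of wavelet coefficients. -/
lemma covariance_waveletCoeff (hW : WaveletAssumptions φ ψ M α T) [IsProbabilityMeasure P]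
    (hX : HasSpectralDensity (diffIter M X) P
      (fun x => ‖1 - Complex.exp (-(Complex.I * x))‖ ^ (2 * ((M : ℝ) - d)) * f x))
    (hmean : ∀ k : ℤ, ∫ ω, diffIter M X k ω ∂P = 0) (j j' : ℕ) (k k' : ℤ) :
    ((∫ ω, waveletCoeff φ ψ (fun l => X l ω) j k * waveletCoeff φ ψ (fun l => X l ω) j' k' ∂P : ℝ)
      : ℂ) = ∫ x in (-Real.pi)..Real.pi,
        Complex.exp (Complex.I * x * ((2 : ℂ) ^ j * k - 2 ^ j' * k')) * transfer φ ψ T j x *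
          conj (transfer φ ψ T j' x) *
          ((‖1 - Complex.exp (-(Complex.I * x))‖ ^ (-2 * d) * f x : ℝ) : ℂ) := by
  obtain ⟨q, hq, hqt⟩ := exists_transfer_factor hW j
  obtain ⟨q', hq', hqt'⟩ := exists_transfer_factor hW j'
  have hpi := Real.pi_pos
  set g : ℝ → ℝ := fun x => ‖1 - Complex.exp (-(Complex.I * x))‖ ^ (2 * ((M : ℝ) - d)) * f x with hg
  set Y := diffIter M X
  have hY : ∀ a b : ℤ, ((∫ ω, Y a ω * Y b ω ∂P : ℝ) : ℂ) =
      ∫ x in (-Real.pi)..Real.pi, Complex.exp (Complex.I * x * ((a : ℂ) - b)) * (g x : ℂ) :=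
    fun a b => by
    rw [← hX.cov_eq, covariance_eq_sub (hX.memLp a) (hX.memLp b), hmean a]
    simp
  have hgi : IntervalIntegrable (fun x => (g x : ℂ)) volume (-Real.pi) Real.pi := by
    rw [intervalIntegrable_iff_integrableOn_Ioo_of_le (by linarith)]
    exact hX.integrableOn.ofReal
  have hei : ∀ a b : ℤ, IntervalIntegrable
      (fun x : ℝ => Complex.exp (Complex.I * x * ((a : ℂ) - b)) * (g x : ℂ)) volume
      (-Real.pi) Real.pi := fun a b => hgi.continuousOn_mul (by fun_prop)
  have iYY : ∀ a b : ℤ, Integrable (fun ω => Y a ω * Y b ω) P := fun a b =>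
    (hX.memLp a).integrable_mul (hX.memLp b)
  simp_rw [hq X, hq' X, Finset.sum_mul_sum]
  rw [integral_finsetSum _ fun i _ => integrable_finsetSum _ fun i' _ => by
    simpa only [mul_mul_mul_comm] using (iYY _ _).const_mul (q.coeff i * q'.coeff i')]
  have e1 : ∀ i ∈ Finset.range (q.natDegree + 1), ∫ ω, ∑ i' ∈ Finset.range (q'.natDegree + 1),
      q.coeff i * Y (2 ^ j * k + i + M) ω * (q'.coeff i' * Y (2 ^ j' * k' + i' + M) ω) ∂P =
      ∑ i' ∈ Finset.range (q'.natDegree + 1), q.coeff i * q'.coeff i' *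
        ∫ ω, Y (2 ^ j * k + i + M) ω * Y (2 ^ j' * k' + i' + M) ω ∂P := fun i _ => by
    simp only [mul_mul_mul_comm]
    rw [integral_finsetSum _ fun i' _ => (iYY _ _).const_mul _]
    simp only [integral_const_mul]
  rw [Finset.sum_congr rfl e1]
  push_cast
  simp only [hY]
  simp only [← intervalIntegral.integral_const_mul]
  have e2 : ∀ i ∈ Finset.range (q.natDegree + 1), ∑ i' ∈ Finset.range (q'.natDegree + 1),
      (∫ x in (-Real.pi)..Real.pi, (q.coeff i : ℂ) * q'.coeff i' *
      (Complex.exp (Complex.I * x * (((2 ^ j * k + i + M : ℤ) : ℂ) - ((2 ^ j' * k' + i' + M : ℤ) : ℂ)))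
        * (g x : ℂ))) = ∫ x in (-Real.pi)..Real.pi, ∑ i' ∈ Finset.range (q'.natDegree + 1),
        (q.coeff i : ℂ) * q'.coeff i' * (Complex.exp (Complex.I * x *
        (((2 ^ j * k + i + M : ℤ) : ℂ) - ((2 ^ j' * k' + i' + M : ℤ) : ℂ))) * (g x : ℂ)) :=
    fun i _ => (intervalIntegral.integral_finsetSum fun i' _ => (hei _ _).const_mul _).symm
  rw [Finset.sum_congr rfl e2, ← intervalIntegral.integral_finsetSum fun i _ => by
    have := IntervalIntegrable.sum (Finset.range (q'.natDegree + 1)) fun i' _ =>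
      (hei (2 ^ j * k + i + M) (2 ^ j' * k' + i' + M)).const_mul ((q.coeff i : ℂ) * q'.coeff i')
    refine this.congr ?_
    exact fun x _ => by simp only [Finset.sum_apply]]
  refine intervalIntegral.integral_congr_ae ?_
  -- The exponents 2M and -2d merge into 2(M - d) only over a positive base, that is, off the null
  -- set x = 0.
  have hne : ∀ᵐ x : ℝ, x ≠ 0 := by
    rw [ae_iff]; simp
  filter_upwards [hne] with x hx0 hx
  rw [Set.uIoc_of_le (by linarith)] at hx
  have hn := norm_one_sub_exp_pos hx hx0
  set n := ‖1 - Complex.exp (-(Complex.I * x))‖ with hn_def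
  have hen : ‖Complex.exp (Complex.I * x) - 1‖ = n := by
    rw [hn_def, show (1 : ℂ) - Complex.exp (-(Complex.I * x)) =
      Complex.exp (-(Complex.I * x)) * (Complex.exp (Complex.I * x) - 1) by
        rw [mul_sub, ← Complex.exp_add]; simp, norm_mul]
    have : -(Complex.I * x) = ((-x : ℝ) : ℂ) * Complex.I := by push_cast; ring
    rw [this, Complex.norm_exp_ofReal_mul_I, one_mul]
  have hM : (Complex.exp (Complex.I * x) - 1) ^ M * conj (Complex.exp (Complex.I * x) - 1) ^ M =
      ((n ^ (2 * M) : ℝ) : ℂ) := by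
    rw [← mul_pow, Complex.mul_conj, Complex.normSq_eq_norm_sq, hen]; push_cast; rw [pow_mul]
  have hgx : (g x : ℂ) = ((n ^ (2 * M) : ℝ) : ℂ) * (((n ^ (-2 * d) : ℝ) : ℂ) * (f x : ℂ)) := by
    rw [← Complex.ofReal_mul, ← Complex.ofReal_mul, hg]
    congr 1
    simp only [← hn_def]
    rw [← mul_assoc, ← Real.rpow_natCast, ← Real.rpow_add hn]
    congr 2; push_cast; ring
  have hc : ∀ y : ℂ, conj (Complex.exp (Complex.I * x * y)) =
      Complex.exp (-(Complex.I * x * conj y)) := fun y => by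
    rw [← Complex.exp_conj]; simp
  rw [hqt, hqt', map_mul, map_pow, map_sum]
  simp only [map_mul, Complex.conj_ofReal, hc, Complex.conj_natCast]
  rw [show ∀ a b c d e f : ℂ, a * (b * c) * (d * e) * f = (c * e) * (a * ((b * d) * f)) by
    intros; ring, hM, ← hgx, Finset.sum_mul_sum, Finset.sum_mul]
  refine Finset.sum_congr rfl fun i _ => ?_
  rw [Finset.sum_mul]
  refine Finset.sum_congr rfl fun i' _ => ?_
  have : Complex.exp (Complex.I * x * (((2 ^ j * k + i + M : ℤ) : ℂ) -
      ((2 ^ j' * k' + i' + M : ℤ) : ℂ))) = Complex.exp (Complex.I * x * i) *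
      Complex.exp (-(Complex.I * x * i')) *
      Complex.exp (Complex.I * x * ((2 : ℂ) ^ j * k - 2 ^ j' * k')) := by
    rw [← Complex.exp_add, ← Complex.exp_add]; congr 1; push_cast; ring
  rw [this]; ring

/-- Measurability of f comes from the integrability of the spectral density, after division by a
weight that vanishes only at 0. -/
lemma aestronglyMeasurable_of_hasSpectralDensity {Y : ℤ → Ω → ℝ} {a : ℝ}
    (hX : HasSpectralDensity Y P
      (fun x => ‖1 - Complex.exp (-(Complex.I * x))‖ ^ a * f x)) :
    AEStronglyMeasurable ((Set.Ioo (-Real.pi) Real.pi).indicator f) := by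
  rw [aestronglyMeasurable_indicator_iff measurableSet_Ioo]
  have h1 := hX.integrableOn.aestronglyMeasurable
  have h2 : AEStronglyMeasurable (fun x : ℝ => ‖1 - Complex.exp (-(Complex.I * x))‖ ^ (-a))
      (volume.restrict (Set.Ioo (-Real.pi) Real.pi)) := by
    refine Measurable.aestronglyMeasurable ?_
    fun_prop
  refine (h2.mul h1).congr ?_
  have hne : ∀ᵐ x : ℝ, x ≠ 0 := by
    rw [ae_iff]; simp
  filter_upwards [ae_restrict_of_ae hne, ae_restrict_mem measurableSet_Ioo] with x hx0 hx
  have hn := norm_one_sub_exp_pos ⟨hx.1, hx.2.le⟩ hx0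
  simp only [Pi.mul_apply]
  rw [← mul_assoc, ← Real.rpow_add hn]; simp

end WaveletCovariance

/-! ### Fourier inversion for integrable functions. -/

noncomputable section FourierInversion

open scoped FourierTransform ContDiff

lemma integral_fourier_mul_eq {f g : ℝ → ℂ} (hf : Integrable f) (hg : Integrable g) :
    ∫ x, 𝓕 f x * g x = ∫ x, f x * 𝓕 g x := by
  simpa using! VectorFourier.integral_fourierIntegral_smul_eq_flip (L := innerₗ ℝ)
    Real.continuous_fourierChar continuous_inner hf hg

lemma continuous_fourier {f : ℝ → ℂ} (hf : Integrable f) : Continuous (𝓕 f) :=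
  VectorFourier.fourierIntegral_continuous Real.continuous_fourierChar (innerSL ℝ).continuous₂ hf

lemma norm_fourier_le (f : ℝ → ℂ) (x : ℝ) : ‖𝓕 f x‖ ≤ ∫ t, ‖f t‖ := by
  rw [Real.fourier_real_eq]
  refine (norm_integral_le_integral_norm _).trans_eq ?_
  simp

/-- Fourier inversion almost everywhere. -/
lemma ae_eq_fourierInv_fourier {f : ℝ → ℂ} (hf : Integrable f) (hf' : Integrable (𝓕 f)) :
    f =ᵐ[volume] 𝓕⁻ (𝓕 f) := by
  have hc : Continuous (𝓕⁻ (𝓕 f)) := by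
    rw [Real.fourierInv_eq_fourier_comp_neg]
    exact continuous_fourier hf'.comp_neg
  refine ae_eq_of_integral_contDiff_smul_eq hf.locallyIntegrable hc.locallyIntegrable
    fun g hg hgc => ?_
  -- Smooth compactly supported test functions are Schwartz, where inversion is known; the
  -- multiplication formula, used twice, carries it over to f.
  have h1 : HasCompactSupport fun x => (g x : ℂ) := hgc.comp_left (g := fun x : ℝ => (x : ℂ)) rfl
  let G : SchwartzMap ℝ ℂ := h1.toSchwartzMap (Complex.ofRealCLM.contDiff.comp hg)
  have hG : ∀ x, G x = g x := fun x => rfl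
  calc ∫ x, g x • f x = ∫ x, f x * 𝓕 (𝓕⁻ G) x := by
        simp only [FourierTransform.fourier_fourierInv_eq, hG, Complex.real_smul, mul_comm]
    _ = ∫ x, 𝓕 f x * (𝓕⁻ G) x := by
        rw [integral_fourier_mul_eq hf (𝓕⁻ G).integrable]; rfl
    _ = ∫ x, 𝓕 f x * 𝓕 (fun y => G (-y)) x := by
        rw [← Real.fourierInv_eq_fourier_comp_neg, SchwartzMap.fourierInv_coe]
    _ = ∫ x, 𝓕 (𝓕 f) x * G (-x) := (integral_fourier_mul_eq hf' G.integrable.comp_neg).symm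
    _ = ∫ x, 𝓕 (𝓕 f) (-x) * G x := by
        rw [← integral_neg_eq_self]; simp
    _ = _ := by
        simp only [Real.fourierInv_eq_fourier_neg, hG, Complex.real_smul, mul_comm]

variable {g : ℝ → ℝ}

lemma fourier_ofReal (g : ℝ → ℝ) (x : ℝ) :
    𝓕 (fun t => (g t : ℂ)) x = fourierT g (2 * Real.pi * x) := by
  rw [Real.fourier_real_eq_integral_exp_smul, fourierT]
  congr 1; ext t
  rw [smul_eq_mul, mul_comm]
  congr 2; push_cast; ring

lemma continuous_fourierT (hg : Integrable g) : Continuous (fourierT g) := by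
  have : fourierT g = fun x => 𝓕 (fun t => (g t : ℂ)) ((2 * Real.pi)⁻¹ * x) := by
    ext x
    rw [fourier_ofReal, mul_inv_cancel_left₀ (by positivity)]
  rw [this]
  exact (continuous_fourier hg.ofReal).comp (by fun_prop)

lemma norm_fourierT_le (g : ℝ → ℝ) (x : ℝ) : ‖fourierT g x‖ ≤ ∫ t, |g t| := by
  unfold fourierT
  refine (norm_integral_le_integral_norm _).trans_eq ?_
  congr 1; ext t
  have : -(Complex.I * x * t) = ((-(x * t) : ℝ) : ℂ) * Complex.I := by push_cast; ring
  rw [norm_mul, this, Complex.norm_exp_ofReal_mul_I]; simp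

lemma fourierT_neg (g : ℝ → ℝ) (x : ℝ) : fourierT g (-x) = starRingEnd ℂ (fourierT g x) := by
  unfold fourierT
  rw [← integral_conj]
  congr 1; ext t
  simp [← Complex.exp_conj]

/-- Applied to ψ: its transform is integrable because α > 1, so ψ has a bounded continuous version
even though it is only assumed integrable and square integrable. -/
lemma exists_continuous_ae_eq (hg : Integrable g) (hg' : Integrable (fourierT g)) :
    ∃ h : ℝ → ℝ, Continuous h ∧ (∃ B, ∀ t, |h t| ≤ B) ∧ g =ᵐ[volume] h := by
  set f : ℝ → ℂ := fun t => (g t : ℂ)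
  have hf : Integrable f := hg.ofReal
  have hf' : Integrable (𝓕 f) := by
    have : 𝓕 f = fun x => fourierT g (2 * Real.pi * x) := funext fun x => fourier_ofReal g x
    rw [this]
    exact hg'.comp_mul_left' (by positivity)
  have hF : 𝓕⁻ (𝓕 f) = 𝓕 fun x => 𝓕 f (-x) := Real.fourierInv_eq_fourier_comp_neg _
  refine ⟨fun t => (𝓕⁻ (𝓕 f) t).re, ?_, ⟨∫ t, ‖𝓕 f (-t)‖, fun t => ?_⟩, ?_⟩
  · rw [hF]
    exact Complex.continuous_re.comp (continuous_fourier hf'.comp_neg)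
  · refine (Complex.abs_re_le_norm _).trans ?_
    rw [hF]
    exact norm_fourier_le _ _
  · filter_upwards [ae_eq_fourierInv_fourier hf hf'] with t ht
    rw [← ht]; simp [f]

end FourierInversion

/-! ### Fourier transform of the filter and Poisson summation. -/

noncomputable section FilterFourier

open scoped FourierTransform ComplexConjugate

variable {φ ψ : ℝ → ℝ} {M T : ℕ} {α : ℝ}

lemma WaveletAssumptions.exists_decay (hW : WaveletAssumptions φ ψ M α T) :
    ∃ C : ℝ, 0 ≤ C ∧ ∀ ξ, ‖fourierT ψ ξ‖ ≤ C * (1 + |ξ|) ^ (-α) := by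
  obtain ⟨C, hC⟩ := hW.decay_psi
  refine ⟨C, (by positivity : (0 : ℝ) ≤ _).trans (hC 0), fun ξ => ?_⟩
  have h1 : 0 < 1 + |ξ| := by positivity
  rw [Real.rpow_neg h1.le, ← div_eq_mul_inv, le_div_iff₀ (by positivity)]
  exact hC ξ

lemma WaveletAssumptions.integrable_fourierT (hW : WaveletAssumptions φ ψ M α T) (hα : 1 < α) :
    Integrable (fourierT ψ) := by
  obtain ⟨C, -, hC⟩ := hW.exists_decay
  exact integrable_of_decay hα (continuous_fourierT hW.integrable_psi).aestronglyMeasurable hC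

lemma psiJK_congr {h : ℝ → ℝ} (hψ : ψ =ᵐ[volume] h) (j : ℕ) :
    psiJK ψ j 0 =ᵐ[volume] psiJK h j 0 := by
  have h2 : (2 : ℝ) ^ (-(j : ℝ)) ≠ 0 := by positivity
  have hq : Measure.QuasiMeasurePreserving (fun t : ℝ => (2 : ℝ) ^ (-(j : ℝ)) * t)
      volume volume := by
    refine ⟨by fun_prop, ?_⟩
    rw [Real.map_volume_mul_left h2]
    exact Measure.smul_absolutelyContinuous
  filter_upwards [hq.ae_eq hψ] with t ht
  simp only [psiJK, Int.cast_zero, sub_zero]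
  simp only [Function.comp] at ht
  rw [ht]

/-- The kernel does not change when ψ is replaced by its bounded continuous version; the factor
2^(-j/2) is the normalization of ψ_{j,0}. -/
lemma continuous_filterKer (hW : WaveletAssumptions φ ψ M α T) (hα : 1 < α) :
    ∃ B : ℝ, 0 ≤ B ∧ ∀ j, Continuous (filterKer φ ψ j) ∧
      ∀ τ, |filterKer φ ψ j τ| ≤ B * (2 : ℝ) ^ (-(j : ℝ) / 2) := by
  obtain ⟨h, hc, ⟨B, hB⟩, he⟩ := exists_continuous_ae_eq hW.integrable_psi
    (hW.integrable_fourierT hα)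
  have hB0 : 0 ≤ B := (abs_nonneg _).trans (hB 0)
  refine ⟨(∫ t, |φ t|) * B, by positivity, fun j => ?_⟩
  have hcj : Continuous (psiJK h j 0) := by unfold psiJK; fun_prop
  have hBj : ∀ t, |psiJK h j 0 t| ≤ B * (2 : ℝ) ^ (-(j : ℝ) / 2) := fun t => by
    rw [psiJK, abs_mul, abs_of_pos (by positivity), mul_comm]
    gcongr
    exact hB _
  have e : ∀ τ, filterKer φ ψ j τ = ∫ s, φ s * psiJK h j 0 (s + τ) := fun τ => by
    rw [filterKer, ← integral_add_right_eq_self _ τ]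
    simp only [add_sub_cancel_right]
    refine integral_congr_ae ?_
    filter_upwards [(quasiMeasurePreserving_add_right' τ).ae_eq (psiJK_congr he j)] with s hs
    simp only [Function.comp] at hs
    rw [hs]
  have hbd : ∀ τ s, ‖φ s * psiJK h j 0 (s + τ)‖ ≤ |φ s| * (B * (2 : ℝ) ^ (-(j : ℝ) / 2)) :=
    fun τ s => by
    rw [norm_mul, Real.norm_eq_abs, Real.norm_eq_abs]
    gcongr
    exact hBj _
  refine ⟨?_, fun τ => ?_⟩
  · rw [show filterKer φ ψ j = _ from funext e]
    refine continuous_of_dominated (fun τ => ?_) (fun τ => ae_of_all _ (hbd τ))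
      (hW.integrable_phi.abs.mul_const _) (ae_of_all _ fun s => by fun_prop)
    exact hW.integrable_phi.aestronglyMeasurable.mul
      (hcj.comp (by fun_prop)).aestronglyMeasurable
  · rw [e, mul_assoc, ← integral_mul_const]
    exact norm_integral_le_of_norm_le (hW.integrable_phi.abs.mul_const _) (ae_of_all _ (hbd τ))

lemma filterKer_ne_zero (hW : WaveletAssumptions φ ψ M α T) {j : ℕ} {τ : ℝ}
    (h : filterKer φ ψ j τ ≠ 0) : 0 < τ ∧ τ < filterLen T j := by
  obtain ⟨t, ht⟩ : ∃ t, φ (t - τ) * psiJK ψ j 0 t ≠ 0 := by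
    by_contra! h0
    exact h (by simp [filterKer, h0])
  obtain ⟨h1, h2⟩ := phi_ne_zero hW.support_phi (left_ne_zero_of_mul ht)
  obtain ⟨h3, h4⟩ := psiJK_ne_zero hW.support_psi (right_ne_zero_of_mul ht)
  rw [filterLen]; push_cast at *
  constructor <;> linarith

lemma integrable_psiJK (hψ : Integrable ψ) (j : ℕ) : Integrable (psiJK ψ j 0) := by
  unfold psiJK
  simp only [Int.cast_zero, sub_zero]
  exact (hψ.comp_mul_left' (by positivity)).const_mul _

lemma fourierT_psiJK (ψ : ℝ → ℝ) (j : ℕ) (x : ℝ) :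
    fourierT (psiJK ψ j 0) x = ((2 : ℝ) ^ ((j : ℝ) / 2) : ℝ) * fourierT ψ (2 ^ j * x) := by
  have h2 : (0 : ℝ) < 2 ^ j := by positivity
  have e : ∀ t : ℝ, (psiJK ψ j 0 t : ℂ) * Complex.exp (-(Complex.I * x * t)) =
      ((2 : ℝ) ^ (-(j : ℝ) / 2) : ℝ) * ((fun s : ℝ => (ψ s : ℂ) *
        Complex.exp (-(Complex.I * (2 ^ j * x : ℝ) * s))) ((2 : ℝ) ^ (-(j : ℝ)) * t)) := fun t => by
    simp only [psiJK, Int.cast_zero, sub_zero]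
    rw [Complex.ofReal_mul, mul_assoc]
    congr 3
    rw [two_rpow_neg_natCast]
    push_cast
    field_simp
  unfold fourierT
  simp_rw [e]
  rw [integral_const_mul, Measure.integral_comp_mul_left (fun s : ℝ => (ψ s : ℂ) *
    Complex.exp (-(Complex.I * (2 ^ j * x : ℝ) * s)))]
  rw [two_rpow_neg_natCast, inv_inv, abs_of_pos h2, Complex.real_smul, ← mul_assoc,
    ← Complex.ofReal_mul]
  congr 2
  rw [← Real.rpow_natCast, ← Real.rpow_add (by norm_num)]
  congr 1; ring

/-- The kernel is the convolution of ψ_{j,0} with the reflection of φ, and multiplying both by the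
character keeps it a convolution. -/
lemma integral_filterKer_mul_exp (hW : WaveletAssumptions φ ψ M α T) (j : ℕ) (x : ℝ) :
    ∫ τ, (filterKer φ ψ j τ : ℂ) * Complex.exp (Complex.I * x * τ) =
      fourierT φ x * conj (((2 : ℝ) ^ ((j : ℝ) / 2) : ℝ) * fourierT ψ (2 ^ j * x)) := by
  set b : ℝ → ℂ := fun t => (psiJK ψ j 0 t : ℂ) * Complex.exp (Complex.I * x * t) with hb
  set a : ℝ → ℂ := fun t => (φ (-t) : ℂ) * Complex.exp (Complex.I * x * t) with ha
  have hexp : ∀ t : ℝ, ‖Complex.exp (Complex.I * x * t)‖ ≤ 1 := fun t => by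
    have : Complex.I * x * t = ((x * t : ℝ) : ℂ) * Complex.I := by push_cast; ring
    rw [this, Complex.norm_exp_ofReal_mul_I]
  have hbi : Integrable b := (integrable_psiJK hW.integrable_psi j).ofReal.mul_bdd (c := 1)
    (by fun_prop) (ae_of_all _ hexp)
  have hai : Integrable a := hW.integrable_phi.comp_neg.ofReal.mul_bdd (c := 1)
    (by fun_prop) (ae_of_all _ hexp)
  have e : ∀ τ : ℝ, (filterKer φ ψ j τ : ℂ) * Complex.exp (Complex.I * x * τ) =
      convolution b a (ContinuousLinearMap.mul ℂ ℂ) volume τ := fun τ => by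
    rw [filterKer, convolution, ← integral_complex_ofReal, ← integral_mul_const]
    congr 1; ext t
    simp only [ha, hb, ContinuousLinearMap.mul_apply', neg_sub]
    have : Complex.exp (Complex.I * x * τ) = Complex.exp (Complex.I * x * t) *
        Complex.exp (Complex.I * x * ((τ - t : ℝ) : ℂ)) := by
      rw [← Complex.exp_add]; congr 1; push_cast; ring
    rw [this]; push_cast; ring
  simp_rw [e]
  rw [integral_convolution _ hbi hai, ContinuousLinearMap.mul_apply', ← fourierT_psiJK, mul_comm,
    ← fourierT_neg]
  congr 1
  · rw [fourierT, ← integral_neg_eq_self]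
    simp only [ha]
    congr 1; ext t; push_cast; rw [neg_neg]; congr 2; ring
  · rw [fourierT]
    simp only [hb]
    congr 1; ext t; push_cast; congr 2; ring

/-- For k ≠ 0 one has |ξ - 2Ak| ≥ A|k|, while 1 + |ξ| ≤ 2A and 1 + |k| ≤ 2|k|. So the decay splits
into full powers in ξ and in the alias index k, uniformly in A. -/
lemma one_add_abs_sub_rpow_le {A ξ : ℝ} (hA : 1 ≤ A) (hξ : |ξ| ≤ A) (hα : 0 ≤ α) (k : ℤ) :
    (1 + |ξ - 2 * A * k|) ^ (-α) ≤ 4 ^ α * ((1 + |ξ|) ^ (-α) * (1 + |(k : ℝ)|) ^ (-α)) := by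
  have h : (1 + |ξ|) * (1 + |(k : ℝ)|) ≤ 4 * (1 + |ξ - 2 * A * k|) := by
    rcases eq_or_ne k 0 with rfl | hk
    · simp; linarith [abs_nonneg ξ]
    have h1 : (1 : ℝ) ≤ |(k : ℝ)| := by exact_mod_cast Int.one_le_abs hk
    have h2 : |2 * A * k| - |ξ| ≤ |ξ - 2 * A * k| := by
      rw [abs_sub_comm]; exact abs_sub_abs_le_abs_sub _ _
    rw [abs_mul, abs_mul, abs_two, abs_of_nonneg (by linarith : 0 ≤ A)] at h2
    nlinarith [abs_nonneg ξ, mul_le_mul_of_nonneg_right hξ (abs_nonneg (k : ℝ))]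
  rw [← Real.mul_rpow (by positivity) (by positivity)]
  have h3 := Real.rpow_le_rpow_of_nonpos (by positivity) h (neg_nonpos.2 hα)
  rw [Real.mul_rpow (by norm_num) (by positivity), Real.rpow_neg (by norm_num),
    inv_mul_le_iff₀ (by positivity)] at h3
  exact h3

lemma one_le_two_pow_mul_pi (j : ℕ) : (1 : ℝ) ≤ 2 ^ j * Real.pi := by
  have : (1 : ℝ) ≤ 2 ^ j := one_le_pow₀ (by norm_num)
  nlinarith [Real.pi_gt_three]

lemma exists_fourierT_mul_le (hW : WaveletAssumptions φ ψ M α T) (hα : 1 < α) :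
    ∃ C : ℝ, 0 ≤ C ∧ ∀ (j : ℕ) (x ξ : ℝ) (k : ℤ), |ξ| ≤ 2 ^ j * Real.pi →
      ‖fourierT φ x * conj (fourierT ψ (ξ - 2 * (2 ^ j * Real.pi) * k))‖ ≤
        C * ((1 + |ξ|) ^ (-α) * (1 + |(k : ℝ)|) ^ (-α)) := by
  obtain ⟨C, hC0, hC⟩ := hW.exists_decay
  refine ⟨(∫ t, |φ t|) * (C * 4 ^ α), by positivity, fun j x ξ k hξ => ?_⟩
  rw [norm_mul, RCLike.norm_conj, mul_assoc (∫ t, |φ t|)]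
  refine mul_le_mul (norm_fourierT_le _ _) ?_ (norm_nonneg _) (by positivity)
  · refine (hC _).trans ?_
    rw [mul_assoc C]
    gcongr
    exact one_add_abs_sub_rpow_le (one_le_two_pow_mul_pi j) hξ (by linarith : (0 : ℝ) ≤ α) k

/-- Poisson summation for the transfer function. -/
lemma transfer_eq_tsum (hW : WaveletAssumptions φ ψ M α T) (hα : 1 < α) (j : ℕ) {x : ℝ}
    (hx : |x| ≤ Real.pi) :
    transfer φ ψ T j x = ∑' k : ℤ, fourierT φ (x - 2 * Real.pi * k) *
      conj (((2 : ℝ) ^ ((j : ℝ) / 2) : ℝ) * fourierT ψ (2 ^ j * (x - 2 * Real.pi * k))) := by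
  obtain ⟨B, hB0, hB⟩ := continuous_filterKer hW hα
  set f : ℝ → ℂ := fun τ => (filterKer φ ψ j τ : ℂ) * Complex.exp (Complex.I * x * τ) with hf
  have hcont : Continuous f := by
    have := (hB j).1
    fun_prop
  have hF : ∀ w : ℝ, 𝓕 f w = fourierT φ (x - 2 * Real.pi * w) *
      conj (((2 : ℝ) ^ ((j : ℝ) / 2) : ℝ) * fourierT ψ (2 ^ j * (x - 2 * Real.pi * w))) := fun w => by
    rw [← integral_filterKer_mul_exp hW, Real.fourier_real_eq_integral_exp_smul]
    congr 1; ext τ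
    simp only [hf, smul_eq_mul]
    rw [mul_left_comm, ← Complex.exp_add]
    congr 2; push_cast; ring
  have hsupp : HasCompactSupport f := by
    refine HasCompactSupport.of_support_subset_isCompact (isCompact_Icc (a := (0:ℝ)) (b := filterLen T j))
      fun τ hτ => ?_
    have h0 : filterKer φ ψ j τ ≠ 0 := fun h => hτ (by simp [hf, h])
    have := filterKer_ne_zero hW h0
    exact ⟨this.1.le, this.2.le⟩
  have hO : f =O[cocompact ℝ] (|·| ^ (-α)) := by
    refine Asymptotics.IsBigO.of_bound 1 ?_
    have := hsupp.isCompact.compl_mem_cocompact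
    filter_upwards [this] with τ hτ
    rw [image_eq_zero_of_notMem_tsupport hτ, norm_zero]; positivity
  have hS : Summable fun k : ℤ => 𝓕 f k := by
    obtain ⟨C', hC0', hC'⟩ := exists_fourierT_mul_le hW hα
    refine ((summable_one_add_abs_int_rpow hα).mul_left
      (‖((2 : ℝ) ^ ((j : ℝ) / 2) : ℝ)‖ * (C' * (1 + |2 ^ j * x|) ^ (-α)))).of_norm_bounded fun k => ?_
    have h1 : |2 ^ j * x| ≤ 2 ^ j * Real.pi := by
      rw [abs_mul, abs_of_pos (by positivity)]; gcongr
    have := hC' j (x - 2 * Real.pi * k) (2 ^ j * x) k h1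
    rw [hF, map_mul, mul_left_comm, norm_mul, Complex.conj_ofReal, Complex.norm_real,
      mul_assoc ‖_‖, mul_assoc C']
    gcongr
    rwa [show (2 : ℝ) ^ j * (x - 2 * Real.pi * k) = 2 ^ j * x - 2 * (2 ^ j * Real.pi) * k by ring]
  have h := Real.tsum_eq_tsum_fourier_of_rpow_decay_of_summable hcont hα hO hS 0
  simp only [zero_add, hF] at h
  rw [transfer]
  have h2 : ∑' n : ℤ, f n = ∑ l ∈ Finset.range (filterLen T j),
      (filterKer φ ψ j l : ℂ) * Complex.exp (Complex.I * x * l) := by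
    -- The kernel is supported strictly between 0 and `filterLen T j`, so this finite range misses
    -- no integer.
    rw [tsum_eq_sum (s := (Finset.range (filterLen T j)).image fun l : ℕ => (l : ℤ)) fun n hn => ?_]
    · rw [Finset.sum_image (fun a _ b _ h => by simpa using h)]
      simp [hf]
    · have : filterKer φ ψ j n = 0 := by
        by_contra h0
        obtain ⟨h3, h4⟩ := filterKer_ne_zero hW h0
        have h3 : 0 < n := by exact_mod_cast h3
        have h4 : n < filterLen T j := by exact_mod_cast h4
        exact hn (Finset.mem_image.2 ⟨n.toNat, Finset.mem_range.2 (by omega), by omega⟩)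
      simp [hf, this]
  rw [← h2, h]
  congr 1; ext k; simp

end FilterFourier

/-! ### Uniform bounds and limit of the rescaled transfer functions. -/

noncomputable section RescaledTransfer

open scoped ComplexConjugate

variable {φ ψ : ℝ → ℝ} {M T : ℕ} {α : ℝ}

/-- Transfer function at scale `j`, normalized and expressed in the frequency unit `2^(-j)`. -/
def scaledTransfer (φ ψ : ℝ → ℝ) (T j : ℕ) (ξ : ℝ) : ℂ :=
  ((2 : ℝ) ^ (-(j : ℝ) / 2) : ℝ) * transfer φ ψ T j (((2 : ℝ) ^ j)⁻¹ * ξ)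

lemma continuous_scaledTransfer (φ ψ : ℝ → ℝ) (T j : ℕ) :
    Continuous (scaledTransfer φ ψ T j) := by
  have := continuous_transfer φ ψ T j
  unfold scaledTransfer
  fun_prop

lemma transfer_eq_scaledTransfer (φ ψ : ℝ → ℝ) (T j : ℕ) (ξ : ℝ) :
    transfer φ ψ T j (((2 : ℝ) ^ j)⁻¹ * ξ) =
      ((2 : ℝ) ^ ((j : ℝ) / 2) : ℝ) * scaledTransfer φ ψ T j ξ := by
  rw [scaledTransfer, ← mul_assoc, ← Complex.ofReal_mul, ← Real.rpow_add (by norm_num)]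
  rw [show (j : ℝ) / 2 + -j / 2 = 0 by ring]; simp

lemma abs_inv_two_pow_mul_le {j : ℕ} {ξ : ℝ} (hξ : |ξ| ≤ 2 ^ j * Real.pi) :
    |((2 : ℝ) ^ j)⁻¹ * ξ| ≤ Real.pi := by
  rwa [abs_mul, abs_of_pos (by positivity), inv_mul_le_iff₀ (by positivity)]

lemma scaledTransfer_eq_tsum (hW : WaveletAssumptions φ ψ M α T) (hα : 1 < α) {j : ℕ} {ξ : ℝ}
    (hξ : |ξ| ≤ 2 ^ j * Real.pi) :
    scaledTransfer φ ψ T j ξ = ∑' k : ℤ, fourierT φ (((2 : ℝ) ^ j)⁻¹ * ξ - 2 * Real.pi * k) *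
      conj (fourierT ψ (ξ - 2 * (2 ^ j * Real.pi) * k)) := by
  rw [scaledTransfer, transfer_eq_tsum hW hα j (abs_inv_two_pow_mul_le hξ), ← tsum_mul_left]
  congr 1; ext k
  have h1 : (2 : ℝ) ^ j * ((2 ^ j)⁻¹ * ξ - 2 * Real.pi * k) =
      ξ - 2 * (2 ^ j * Real.pi) * k := by
    field_simp
  have h2 : (((2 : ℝ) ^ (-(j : ℝ) / 2) : ℝ) : ℂ) * (((2 : ℝ) ^ ((j : ℝ) / 2) : ℝ) : ℂ) = 1 := by
    rw [← Complex.ofReal_mul, ← Real.rpow_add (by norm_num)]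
    rw [show -(j : ℝ) / 2 + j / 2 = 0 by ring]; simp
  rw [h1, map_mul, Complex.conj_ofReal, mul_left_comm (fourierT φ _), ← mul_assoc, h2, one_mul]

lemma exists_norm_scaledTransfer_le_decay (hW : WaveletAssumptions φ ψ M α T) (hα : 1 < α) :
    ∃ C : ℝ, 0 ≤ C ∧ ∀ (j : ℕ) (ξ : ℝ), |ξ| ≤ 2 ^ j * Real.pi →
      ‖scaledTransfer φ ψ T j ξ‖ ≤ C * (1 + |ξ|) ^ (-α) := by
  obtain ⟨C, hC0, hC⟩ := exists_fourierT_mul_le hW hα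
  have hs := summable_one_add_abs_int_rpow hα
  refine ⟨C * ∑' k : ℤ, (1 + |(k : ℝ)|) ^ (-α), by positivity, fun j ξ hξ => ?_⟩
  rw [scaledTransfer_eq_tsum hW hα hξ, mul_right_comm, ← tsum_mul_left]
  refine tsum_of_norm_bounded (hs.mul_left _).hasSum fun k => ?_
  rw [mul_assoc C]
  exact hC j _ ξ k hξ

lemma tendsto_two_pow_mul_pi : Tendsto (fun j : ℕ => (2 : ℝ) ^ j * Real.pi) atTop atTop :=
  (tendsto_pow_atTop_atTop_of_one_lt (by norm_num)).atTop_mul_const Real.pi_pos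

/-- The aliases k ≠ 0 sit at frequencies that tend to infinity with j and vanish by the decay of the
transform of ψ; the term k = 0 survives, with φ̂(0) = ∫ φ = 1. -/
lemma tendsto_scaledTransfer (hW : WaveletAssumptions φ ψ M α T) (hα : 1 < α) (ξ : ℝ) :
    Tendsto (fun j => scaledTransfer φ ψ T j ξ) atTop (𝓝 (conj (fourierT ψ ξ))) := by
  obtain ⟨C, hC0, hC⟩ := exists_fourierT_mul_le hW hα
  obtain ⟨C', hC0', hC'⟩ := hW.exists_decay
  have hs := summable_one_add_abs_int_rpow hα
  have hev : ∀ᶠ j : ℕ in atTop, |ξ| ≤ 2 ^ j * Real.pi :=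
    tendsto_two_pow_mul_pi.eventually_ge_atTop _
  have h : Tendsto (fun j : ℕ => ∑' k : ℤ,
      fourierT φ (((2 : ℝ) ^ j)⁻¹ * ξ - 2 * Real.pi * k) *
      conj (fourierT ψ (ξ - 2 * (2 ^ j * Real.pi) * k))) atTop
      (𝓝 (∑' k : ℤ, if k = 0 then conj (fourierT ψ ξ) else 0)) := by
    refine tendsto_tsum_of_dominated_convergence (hs.mul_left (C * (1 + |ξ|) ^ (-α))) (fun k => ?_) ?_
    · by_cases hk : k = 0
      · subst hk
        simp only [Int.cast_zero, mul_zero, sub_zero, if_true]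
        have h1 : Tendsto (fun j : ℕ => ((2 : ℝ) ^ j)⁻¹ * ξ) atTop (𝓝 0) := by
          have : Tendsto (fun j : ℕ => ((2 : ℝ) ^ j)⁻¹) atTop (𝓝 0) :=
            tendsto_inv_atTop_zero.comp (tendsto_pow_atTop_atTop_of_one_lt (by norm_num))
          simpa using this.mul_const ξ
        have h2 := ((continuous_fourierT hW.integrable_phi).tendsto 0).comp h1
        have h3 : fourierT φ 0 = 1 := by
          simp [fourierT, integral_complex_ofReal, hW.integral_phi]
        rw [h3] at h2
        simpa using h2.mul_const (conj (fourierT ψ ξ))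
      · simp only [hk, if_false]
        have hk1 : (1 : ℝ) ≤ |(k : ℝ)| := by exact_mod_cast Int.one_le_abs hk
        have h1 : Tendsto (fun j : ℕ => 1 + |ξ - 2 * (2 ^ j * Real.pi) * k|) atTop atTop := by
          refine tendsto_atTop_mono (fun j => ?_)
            (tendsto_atTop_add_const_right _ (-|ξ|) tendsto_two_pow_mul_pi)
          have h2 : |2 * (2 ^ j * Real.pi) * k| - |ξ| ≤ |ξ - 2 * (2 ^ j * Real.pi) * k| := by
            rw [abs_sub_comm]; exact abs_sub_abs_le_abs_sub _ _
          have h3 := one_le_two_pow_mul_pi j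
          rw [abs_mul, abs_mul, abs_two, abs_of_nonneg (by linarith : 0 ≤ 2 ^ j * Real.pi)] at h2
          nlinarith
        have h2 := (tendsto_rpow_neg_atTop (by linarith : 0 < α)).comp h1
        have h3 := (h2.const_mul C').const_mul (∫ t, |φ t|)
        simp only [mul_zero] at h3
        refine squeeze_zero_norm (fun j => ?_) h3
        rw [norm_mul, RCLike.norm_conj]
        exact mul_le_mul (norm_fourierT_le _ _) (hC' _) (norm_nonneg _) (by positivity)
    · filter_upwards [hev] with j hj k
      rw [mul_assoc C]
      exact hC j _ ξ k hj
  rw [tsum_ite_eq] at h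
  refine h.congr' ?_
  filter_upwards [hev] with j hj
  exact (scaledTransfer_eq_tsum hW hα hj).symm

/-- The discrete vanishing moments remove the Taylor polynomial of the exponential of order below M.
The powers of 2^j balance: about 2^j terms, a kernel of size 2^(-j/2), the normalization 2^(-j/2),
and l·2^(-j) bounded on the filter. -/
lemma exists_norm_scaledTransfer_le_pow (hW : WaveletAssumptions φ ψ M α T) (hα : 1 < α) :
    ∃ C : ℝ, 0 ≤ C ∧ ∀ (j : ℕ) (ξ : ℝ), |ξ| ≤ 1 → ‖scaledTransfer φ ψ T j ξ‖ ≤ C * |ξ| ^ M := by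
  obtain ⟨B, hB0, hB⟩ := continuous_filterKer hW hα
  refine ⟨2 * T * B * ((2 * T) ^ M * Real.exp (2 * T)), by positivity, fun j ξ hξ => ?_⟩
  have h2 : (1 : ℝ) ≤ 2 ^ j := one_le_pow₀ (by norm_num)
  have hN : (filterLen T j : ℝ) ≤ 2 ^ j * (2 * T) := by
    rw [filterLen]; push_cast
    nlinarith [(Nat.cast_nonneg T : (0 : ℝ) ≤ T)]
  set x := ((2 : ℝ) ^ j)⁻¹ * ξ with hx
  have hexp : ∀ l : ℕ, ∑ m ∈ Finset.range M, (Complex.I * x * l) ^ m / m.factorial =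
      ∑ m ∈ Finset.range M, ((Complex.I * x) ^ m / m.factorial) * (l : ℂ) ^ m := fun l =>
    Finset.sum_congr rfl fun m _ => by rw [mul_pow]; ring
  have hzero : ∑ l ∈ Finset.range (filterLen T j), (filterKer φ ψ j l : ℂ) *
      ∑ m ∈ Finset.range M, (Complex.I * x * l) ^ m / m.factorial = 0 := by
    simp_rw [hexp, Finset.mul_sum]
    rw [Finset.sum_comm]
    refine Finset.sum_eq_zero fun m hm => ?_
    have := congrArg (fun r : ℝ => (r : ℂ)) (sum_pow_mul_filterKer hW j (Finset.mem_range.1 hm))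
    push_cast at this
    calc _ = (Complex.I * x) ^ m / m.factorial * ∑ l ∈ Finset.range (filterLen T j),
        (l : ℂ) ^ m * filterKer φ ψ j l := by
          rw [Finset.mul_sum]; exact Finset.sum_congr rfl fun l _ => by ring
      _ = 0 := by rw [this, mul_zero]
  have htr : transfer φ ψ T j x = ∑ l ∈ Finset.range (filterLen T j), (filterKer φ ψ j l : ℂ) *
      (Complex.exp (Complex.I * x * l) -
        ∑ m ∈ Finset.range M, (Complex.I * x * l) ^ m / m.factorial) := by
    simp_rw [mul_sub]
    rw [Finset.sum_sub_distrib, hzero, sub_zero, transfer]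
  have hterm : ∀ l ∈ Finset.range (filterLen T j), ‖(filterKer φ ψ j l : ℂ) *
      (Complex.exp (Complex.I * x * l) -
        ∑ m ∈ Finset.range M, (Complex.I * x * l) ^ m / m.factorial)‖ ≤
      (B * (2 : ℝ) ^ (-(j : ℝ) / 2)) * ((2 * T * |ξ|) ^ M * Real.exp (2 * T)) := fun l hl => by
    have hl' : (l : ℝ) ≤ filterLen T j := by exact_mod_cast (Finset.mem_range.1 hl).le
    have hn : ‖Complex.I * x * l‖ ≤ 2 * T * |ξ| := by
      rw [norm_mul, norm_mul, Complex.norm_I, one_mul, Complex.norm_real, Complex.norm_natCast, hx,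
        Real.norm_eq_abs, abs_mul, abs_of_pos (by positivity : (0 : ℝ) < (2 ^ j)⁻¹)]
      calc (2 ^ j)⁻¹ * |ξ| * l ≤ (2 ^ j)⁻¹ * |ξ| * (2 ^ j * (2 * T)) := by
            gcongr; exact hl'.trans hN
        _ = 2 * T * |ξ| := by field_simp
    rw [norm_mul, Complex.norm_real, Real.norm_eq_abs]
    refine mul_le_mul ((hB j).2 _) ((Complex.norm_exp_sub_sum_le_norm_mul_exp _ _).trans ?_)
      (norm_nonneg _) (by positivity)
    have hT0 := (Nat.cast_nonneg T : (0 : ℝ) ≤ T)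
    refine mul_le_mul (pow_le_pow_left₀ (norm_nonneg _) hn _) (Real.exp_le_exp.2 (hn.trans ?_))
      (Real.exp_pos _).le (by positivity)
    nlinarith
  have h22 : (2 : ℝ) ^ (-(j : ℝ) / 2) * (2 : ℝ) ^ (-(j : ℝ) / 2) = (2 ^ j)⁻¹ := by
    rw [← Real.rpow_add (by norm_num), ← two_rpow_neg_natCast]; congr 1; ring
  rw [scaledTransfer, norm_mul, Complex.norm_real, Real.norm_of_nonneg (by positivity), ← hx, htr]
  calc (2 : ℝ) ^ (-(j : ℝ) / 2) * ‖∑ l ∈ Finset.range (filterLen T j), (filterKer φ ψ j l : ℂ) *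
      (Complex.exp (Complex.I * x * l) -
        ∑ m ∈ Finset.range M, (Complex.I * x * l) ^ m / m.factorial)‖
      ≤ (2 : ℝ) ^ (-(j : ℝ) / 2) * (2 ^ j * (2 * T) *
        ((B * (2 : ℝ) ^ (-(j : ℝ) / 2)) * ((2 * T * |ξ|) ^ M * Real.exp (2 * T)))) := by
        gcongr
        refine (norm_sum_le_of_le _ hterm).trans ?_
        rw [Finset.sum_const, Finset.card_range, nsmul_eq_mul]
        gcongr
    _ = ((2 : ℝ) ^ (-(j : ℝ) / 2) * (2 : ℝ) ^ (-(j : ℝ) / 2)) * 2 ^ j *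
        (2 * T * B * ((2 * T * |ξ|) ^ M * Real.exp (2 * T))) := by ring
    _ = 2 * T * B * ((2 * T) ^ M * Real.exp (2 * T)) * |ξ| ^ M := by
        rw [h22, inv_mul_cancel₀ (by positivity), mul_pow]; ring

lemma exists_norm_scaledTransfer_le (hW : WaveletAssumptions φ ψ M α T) (hα : 1 < α) :
    ∃ C : ℝ, 0 ≤ C ∧ ∀ (j : ℕ) (ξ : ℝ), |ξ| ≤ 2 ^ j * Real.pi →
      ‖scaledTransfer φ ψ T j ξ‖ ≤ C * (min 1 |ξ| ^ M * (1 + |ξ|) ^ (-α)) := by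
  obtain ⟨C, hC0, hC⟩ := exists_norm_scaledTransfer_le_decay hW hα
  obtain ⟨C', hC0', hC'⟩ := exists_norm_scaledTransfer_le_pow hW hα
  refine ⟨max C (C' * 2 ^ α), le_max_of_le_left hC0, fun j ξ hξ => ?_⟩
  rcases le_total |ξ| 1 with h | h
  · rw [min_eq_right h]
    have h1 : 1 ≤ (2 : ℝ) ^ α * (1 + |ξ|) ^ (-α) := by
      rw [Real.rpow_neg (by positivity), ← div_eq_mul_inv, ← Real.div_rpow (by norm_num)
        (by positivity)]
      refine Real.one_le_rpow ?_ (by linarith)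
      rw [le_div_iff₀ (by positivity)]; linarith
    calc _ ≤ C' * |ξ| ^ M * 1 := by rw [mul_one]; exact hC' j ξ h
      _ ≤ C' * |ξ| ^ M * ((2 : ℝ) ^ α * (1 + |ξ|) ^ (-α)) := by gcongr
      _ = C' * 2 ^ α * (|ξ| ^ M * (1 + |ξ|) ^ (-α)) := by ring
      _ ≤ _ := by gcongr; exact le_max_right _ _
  · rw [min_eq_left h, one_pow, one_mul]
    refine (hC j ξ hξ).trans ?_
    gcongr
    exact le_max_left _ _

lemma fourierT_psi_zero (hW : WaveletAssumptions φ ψ M α T) (hM : 1 ≤ M) : fourierT ψ 0 = 0 := by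
  have := hW.vanishing_moments 0 hM
  simp only [pow_zero, one_mul] at this
  simp [fourierT, integral_complex_ofReal, this]

lemma scaledTransfer_zero (hW : WaveletAssumptions φ ψ M α T) (hM : 1 ≤ M) (j : ℕ) :
    scaledTransfer φ ψ T j 0 = 0 := by
  have := congrArg (fun r : ℝ => (r : ℂ)) (sum_pow_mul_filterKer hW j hM)
  push_cast at this
  simp only [pow_zero, one_mul] at this
  simp [scaledTransfer, transfer, this]

end RescaledTransfer

/-! ### Domination and pointwise convergence of the spectral kernel. -/

noncomputable section SpectralKernel

open scoped ComplexConjugate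

variable {φ ψ : ℝ → ℝ} {M T : ℕ} {α d : ℝ} {f : ℝ → ℝ}

lemma rpow_le_mul_rpow_of_le {K x y : ℝ} (hx : 0 < x) (hy : 0 < y) (hK : 0 < K)
    (h1 : x ≤ K * y) (h2 : y ≤ K * x) (s : ℝ) : y ^ s ≤ K ^ |s| * x ^ s := by
  rcases le_total 0 s with hs | hs
  · rw [abs_of_nonneg hs, ← Real.mul_rpow hK.le hx.le]
    exact Real.rpow_le_rpow hy.le h2 hs
  · rw [abs_of_nonpos hs, Real.rpow_neg hK.le, ← div_eq_inv_mul, le_div_iff₀ (by positivity),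
      ← Real.mul_rpow hy.le hK.le, mul_comm y]
    exact Real.rpow_le_rpow_of_nonpos hx h1 hs

/-- Near 0 the two transfer functions contribute |x|^(2M), which compensates |x|^(-2d) because d ≤
M. -/
lemma min_one_pow_mul_rpow_le (hd : d ≤ M) {x : ℝ} (hx : x ≠ 0) :
    min 1 |x| ^ M * min 1 |x| ^ M * |x| ^ (-2 * d) ≤
      2 ^ |(-2 * d)| * (1 + |x|) ^ (-2 * d) := by
  have hx' : 0 < |x| := abs_pos.2 hx
  rcases le_total |x| 1 with h | h
  · rw [min_eq_right h, ← pow_add, ← Real.rpow_natCast, ← Real.rpow_add hx']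
    calc |x| ^ (((M + M : ℕ) : ℝ) + -2 * d) ≤ 1 :=
          Real.rpow_le_one hx'.le h (by push_cast; linarith)
      _ = 1 ^ (-2 * d) := (Real.one_rpow _).symm
      _ ≤ _ := rpow_le_mul_rpow_of_le (by positivity) one_pos two_pos (by linarith)
          (by linarith) _
  · rw [min_eq_left h, one_pow, one_mul, one_mul]
    exact rpow_le_mul_rpow_of_le (by positivity) hx' two_pos (by linarith) (by linarith) _

lemma norm_one_sub_exp (x : ℝ) : ‖1 - Complex.exp (-(Complex.I * x))‖ = 2 * |Real.sin (x / 2)| := by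
  have := Complex.norm_exp_I_mul_ofReal_sub_one (-x)
  rw [norm_sub_rev]
  push_cast at this
  rw [mul_neg] at this
  rw [this, norm_mul, neg_div, Real.sin_neg, norm_neg]; simp

lemma norm_one_sub_exp_le (x : ℝ) : ‖1 - Complex.exp (-(Complex.I * x))‖ ≤ |x| := by
  rw [norm_one_sub_exp]
  have := Real.abs_sin_le_abs (x := x / 2)
  rw [abs_div, abs_two] at this
  linarith

lemma le_norm_one_sub_exp {x : ℝ} (hx : |x| ≤ Real.pi) :
    |x| ≤ Real.pi / 2 * ‖1 - Complex.exp (-(Complex.I * x))‖ := by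
  rw [norm_one_sub_exp]
  have h : |x / 2| ≤ Real.pi / 2 := by rw [abs_div, abs_two]; gcongr
  have := Real.mul_abs_le_abs_sin h
  rw [abs_div, abs_two, div_mul_eq_mul_div, div_le_iff₀ Real.pi_pos] at this
  linarith

/-- Spectral density, after rescaling by `2^(j+u)`, of the pair formed by the coefficients
at scale `j + u` and those at scale `j` with locations congruent to `v` modulo `2^u`. -/
def spectralKernel (φ ψ : ℝ → ℝ) (T : ℕ) (d : ℝ) (f : ℝ → ℝ) (j u v : ℕ) (η : ℝ) : ℂ :=
  ((2 : ℝ) ^ (-(u : ℝ) / 2) : ℝ) * scaledTransfer φ ψ T j (((2 : ℝ) ^ u)⁻¹ * η) *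
    conj (scaledTransfer φ ψ T (j + u) η) *
    (((2 ^ (j + u) * ‖1 - Complex.exp (-(Complex.I * (((2 ^ (j + u))⁻¹ * η : ℝ) : ℂ)))‖)
      ^ (-2 * d) * (Set.Ioo (-Real.pi) Real.pi).indicator f ((2 ^ (j + u))⁻¹ * η) : ℝ) : ℂ) *
    Complex.exp (Complex.I * v * (((2 ^ u)⁻¹ * η : ℝ) : ℂ))

lemma norm_exp_I_mul_nat_mul (v : ℕ) (x : ℝ) : ‖Complex.exp (Complex.I * v * x)‖ = 1 := by
  have : Complex.I * v * x = ((v * x : ℝ) : ℂ) * Complex.I := by push_cast; ring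
  rw [this, Complex.norm_exp_ofReal_mul_I]

lemma aestronglyMeasurable_spectralKernel
    (hf : AEStronglyMeasurable ((Set.Ioo (-Real.pi) Real.pi).indicator f)) (j u v : ℕ) :
    AEStronglyMeasurable (spectralKernel φ ψ T d f j u v) := by
  have hc := continuous_scaledTransfer φ ψ T
  have hq : Measure.QuasiMeasurePreserving (fun t : ℝ => ((2 : ℝ) ^ (j + u))⁻¹ * t)
      volume volume := by
    refine ⟨by fun_prop, ?_⟩
    rw [Real.map_volume_mul_left (by positivity)]
    exact Measure.smul_absolutelyContinuous
  have h1 := hf.comp_quasiMeasurePreserving hq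
  have h2 : Measurable fun η : ℝ => (2 ^ (j + u) *
      ‖1 - Complex.exp (-(Complex.I * (((2 ^ (j + u))⁻¹ * η : ℝ) : ℂ)))‖) ^ (-2 * d) := by
    fun_prop
  have h3 := Complex.continuous_ofReal.comp_aestronglyMeasurable
    (h2.aestronglyMeasurable.mul h1)
  have c1 := hc j
  have c2 := hc (j + u)
  have h4 : Continuous fun η : ℝ => ((2 : ℝ) ^ (-(u : ℝ) / 2) : ℝ) *
    scaledTransfer φ ψ T j (((2 : ℝ) ^ u)⁻¹ * η) * conj (scaledTransfer φ ψ T (j + u) η) := by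
    have := Complex.continuous_conj.comp c2
    exact (continuous_const.mul (c1.comp (by fun_prop))).mul this
  exact (h4.aestronglyMeasurable.mul h3).mul (by fun_prop : Continuous fun η : ℝ =>
    Complex.exp (Complex.I * v * (((2 ^ u)⁻¹ * η : ℝ) : ℂ))).aestronglyMeasurable

/-- Uniformity in j makes dominated convergence possible. Each transfer function yields (1 +
|η|)^(-α) and the fractional factor (1 + |η|)^(-2d); the indicator confines η to |η| ≤ 2^(j+u) π,
where the transfer bounds hold. -/
lemma exists_norm_spectralKernel_le (hW : WaveletAssumptions φ ψ M α T) (hM : 1 ≤ M) (hα : 1 < α)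
    (hd : d ≤ M) {B : ℝ} (hB : ∀ x ∈ Set.Ioo (-Real.pi) Real.pi, |f x| ≤ B) (u : ℕ) :
    ∃ C : ℝ, 0 ≤ C ∧ ∀ j v η,
      ‖spectralKernel φ ψ T d f j u v η‖ ≤ C * (1 + |η|) ^ (-(2 * α + 2 * d)) := by
  obtain ⟨C, hC0, hC⟩ := exists_norm_scaledTransfer_le hW hα
  have hB0 : 0 ≤ B := (abs_nonneg _).trans (hB 0 ⟨by linarith [Real.pi_pos], Real.pi_pos⟩)
  have hpi := Real.pi_pos
  refine ⟨C * C * (2 ^ u) ^ |(-α)| * (Real.pi / 2) ^ |(-2 * d)| * B * 2 ^ |(-2 * d)|,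
    by positivity, fun j v η => ?_⟩
  -- At η = 0 the power of exponent -2d cannot be estimated, but the transfer functions vanish there
  -- since M ≥ 1.
  by_cases hη : η ≠ 0 ∧ ((2 : ℝ) ^ (j + u))⁻¹ * η ∈ Set.Ioo (-Real.pi) Real.pi
  swap
  · have : spectralKernel φ ψ T d f j u v η = 0 := by
      rw [not_and_or, not_not] at hη
      rcases hη with rfl | hη
      · simp [spectralKernel, scaledTransfer_zero hW hM]
      · simp [spectralKernel, Set.indicator_of_notMem hη]
    rw [this, norm_zero]; positivity
  obtain ⟨h0, hη⟩ := hη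
  have hη0 : 0 < |η| := abs_pos.2 h0
  set N : ℝ := 2 ^ (j + u) with hN
  have hNpos : 0 < N := by positivity
  have habs : |N⁻¹ * η| = N⁻¹ * |η| := by rw [abs_mul, abs_of_pos (by positivity)]
  have hle : |N⁻¹ * η| ≤ Real.pi := (abs_lt.2 hη).le
  have hηN : |η| ≤ N * Real.pi := by
    rw [habs, inv_mul_le_iff₀ hNpos] at hle; exact hle
  have hu1 : (1 : ℝ) ≤ 2 ^ u := one_le_pow₀ (by norm_num)
  have habs' : |((2 : ℝ) ^ u)⁻¹ * η| = (2 ^ u)⁻¹ * |η| := by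
    rw [abs_mul, abs_of_pos (by positivity)]
  have hue : |((2 : ℝ) ^ u)⁻¹ * η| ≤ |η| := by
    rw [habs']; exact mul_le_of_le_one_left hη0.le (inv_le_one_of_one_le₀ hu1)
  have b1 : ‖scaledTransfer φ ψ T j (((2 : ℝ) ^ u)⁻¹ * η)‖ ≤
      C * (min 1 |η| ^ M * ((2 ^ u) ^ |(-α)| * (1 + |η|) ^ (-α))) := by
    refine (hC j _ ?_).trans ?_
    · rw [habs', inv_mul_le_iff₀ (by positivity)]
      rw [hN, pow_add] at hηN; linarith
    · gcongr
      refine rpow_le_mul_rpow_of_le (by positivity) (by positivity) (by positivity) ?_ ?_ _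
      · rw [habs', mul_add, mul_inv_cancel_left₀ (by positivity)]; linarith
      · nlinarith
  have b2 := hC (j + u) η hηN
  have hn := norm_one_sub_exp_pos ⟨hη.1, hη.2.le⟩ (mul_ne_zero (by positivity) h0 : N⁻¹ * η ≠ 0)
  have b3 : (N * ‖1 - Complex.exp (-(Complex.I * ((N⁻¹ * η : ℝ) : ℂ)))‖) ^ (-2 * d) ≤
      (Real.pi / 2) ^ |(-2 * d)| * |η| ^ (-2 * d) := by
    refine rpow_le_mul_rpow_of_le hη0 (by positivity) (by positivity) ?_ ?_ _
    · have := le_norm_one_sub_exp hle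
      rw [habs, inv_mul_le_iff₀ hNpos] at this
      linarith
    · have := norm_one_sub_exp_le (N⁻¹ * η)
      rw [habs, le_inv_mul_iff₀ hNpos] at this
      nlinarith [Real.pi_gt_three]
  have b0 : (2 : ℝ) ^ (-(u : ℝ) / 2) ≤ 1 :=
    Real.rpow_le_one_of_one_le_of_nonpos (by norm_num)
      (by have : (0 : ℝ) ≤ u := by positivity
          linarith)
  rw [spectralKernel, norm_mul, norm_exp_I_mul_nat_mul, mul_one, norm_mul, norm_mul, norm_mul,
    RCLike.norm_conj, Complex.norm_real, Complex.norm_real, Real.norm_of_nonneg (by positivity),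
    Set.indicator_of_mem hη, norm_mul, Real.norm_of_nonneg (by positivity), ← hN]
  calc _ ≤ 1 * (C * (min 1 |η| ^ M * ((2 ^ u) ^ |(-α)| * (1 + |η|) ^ (-α)))) *
        (C * (min 1 |η| ^ M * (1 + |η|) ^ (-α))) *
        ((Real.pi / 2) ^ |(-2 * d)| * |η| ^ (-2 * d) * B) := by
        gcongr
        exact hB _ hη
    _ = C * C * (2 ^ u) ^ |(-α)| * (Real.pi / 2) ^ |(-2 * d)| * B * ((1 + |η|) ^ (-α) *
        (1 + |η|) ^ (-α)) * (min 1 |η| ^ M * min 1 |η| ^ M * |η| ^ (-2 * d)) := by ring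
    _ ≤ C * C * (2 ^ u) ^ |(-α)| * (Real.pi / 2) ^ |(-2 * d)| * B * ((1 + |η|) ^ (-α) *
        (1 + |η|) ^ (-α)) * (2 ^ |(-2 * d)| * (1 + |η|) ^ (-2 * d)) := by
        exact mul_le_mul_of_nonneg_left (min_one_pow_mul_rpow_le hd h0) (by positivity)
    _ = _ := by
        have h1 : 0 < 1 + |η| := by positivity
        rw [show -(2 * α + 2 * d) = -α + -α + -2 * d by ring, Real.rpow_add h1, Real.rpow_add h1]
        ring

lemma tendsto_inv_two_pow_mul (u : ℕ) (η : ℝ) :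
    Tendsto (fun j : ℕ => ((2 : ℝ) ^ (j + u))⁻¹ * η) atTop (𝓝 0) := by
  have h : Tendsto (fun j : ℕ => ((2 : ℝ) ^ (j + u))⁻¹) atTop (𝓝 0) :=
    tendsto_inv_atTop_zero.comp ((tendsto_pow_atTop_atTop_of_one_lt (by norm_num)).comp
      (tendsto_add_atTop_nat u))
  simpa using h.mul_const η

lemma tendsto_norm_one_sub_exp_div :
    Tendsto (fun x : ℝ => |x|⁻¹ * ‖1 - Complex.exp (-(Complex.I * x))‖) (𝓝[≠] 0) (𝓝 1) := by
  have h : HasDerivAt (fun x : ℝ => 1 - Complex.exp (-(Complex.I * x))) Complex.I 0 := by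
    have h1 : HasDerivAt (fun x : ℝ => -(Complex.I * (x : ℂ))) (-(Complex.I * 1)) 0 :=
      (Complex.ofRealCLM.hasDerivAt.const_mul Complex.I).neg
    have := (h1.cexp).const_sub 1
    simpa using this
  have h2 := (hasDerivAt_iff_tendsto_slope.1 h).norm
  rw [Complex.norm_I] at h2
  refine h2.congr fun x => ?_
  simp [slope_def_module]

lemma tendsto_of_classH {β L : ℝ} (hβ : 0 < β) (hf : f ∈ classH β L) :
    Tendsto ((Set.Ioo (-Real.pi) Real.pi).indicator f) (𝓝 0) (𝓝 (f 0)) := by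
  have hpi := Real.pi_pos
  have h1 : Tendsto (fun x : ℝ => L * f 0 * |x| ^ β) (𝓝 0) (𝓝 0) := by
    have : Continuous fun x : ℝ => L * f 0 * |x| ^ β :=
      continuous_const.mul (continuous_abs.rpow_const fun _ => Or.inr hβ.le)
    simpa [hβ.ne'] using this.tendsto 0
  rw [tendsto_iff_norm_sub_tendsto_zero]
  refine squeeze_zero' (Eventually.of_forall fun _ => norm_nonneg _) ?_ h1
  filter_upwards [Ioo_mem_nhds (neg_lt_zero.2 hpi) hpi] with x hx
  rw [Set.indicator_of_mem hx]
  exact (hf x ⟨hx.1.le, hx.2.le⟩).2.2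

/-- The rescaled singular factor converges since 2^(j+u) |1 - exp(-i 2^(-(j+u)) η)| → |η|, and f is
evaluated at points tending to 0. -/
lemma tendsto_spectralKernel (hW : WaveletAssumptions φ ψ M α T) (hM : 1 ≤ M) (hα : 1 < α)
    (hf : Tendsto ((Set.Ioo (-Real.pi) Real.pi).indicator f) (𝓝 0) (𝓝 (f 0)))
    (u : ℕ) (v : Fin (2 ^ u)) (η : ℝ) :
    Tendsto (fun j => spectralKernel φ ψ T d f j u v η) atTop
      (𝓝 (f 0 * conj (dInftyTerm ψ u d η v))) := by
  rcases eq_or_ne η 0 with rfl | h0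
  · simp [spectralKernel, scaledTransfer_zero hW hM, dInftyTerm, fourierT_psi_zero hW hM]
  have l1 := tendsto_scaledTransfer hW hα (((2 : ℝ) ^ u)⁻¹ * η)
  have l2 := (Complex.continuous_conj.tendsto _).comp
    ((tendsto_scaledTransfer hW hα η).comp (tendsto_add_atTop_nat u))
  have l3 := hf.comp (tendsto_inv_two_pow_mul u η)
  have l4 : Tendsto (fun j : ℕ => (2 : ℝ) ^ (j + u) *
      ‖1 - Complex.exp (-(Complex.I * (((2 ^ (j + u))⁻¹ * η : ℝ) : ℂ)))‖) atTop (𝓝 |η|) := by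
    have h1 : Tendsto (fun j : ℕ => ((2 : ℝ) ^ (j + u))⁻¹ * η) atTop (𝓝[≠] 0) :=
      tendsto_nhdsWithin_iff.2 ⟨tendsto_inv_two_pow_mul u η,
        Eventually.of_forall fun j => mul_ne_zero (by positivity) h0⟩
    have h2 := (tendsto_norm_one_sub_exp_div.comp h1).const_mul |η|
    rw [mul_one] at h2
    refine h2.congr fun j => ?_
    have h3 : 0 < |η| := abs_pos.2 h0
    simp only [Function.comp]
    rw [abs_mul, abs_of_pos (by positivity : 0 < ((2 : ℝ) ^ (j + u))⁻¹), mul_inv, inv_inv, ← mul_assoc]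
    congr 1
    field_simp
  have l5 := (l4.rpow_const (p := -2 * d) (Or.inl (abs_pos.2 h0).ne')).mul l3
  have l6 := (Complex.continuous_ofReal.tendsto _).comp l5
  have := (((l1.const_mul (((2 : ℝ) ^ (-(u : ℝ) / 2) : ℝ) : ℂ)).mul l2).mul l6).mul_const
    (Complex.exp (Complex.I * (v : ℕ) * (((2 ^ u)⁻¹ * η : ℝ) : ℂ)))
  refine (this.congr fun j => rfl).trans_eq (congrArg 𝓝 ?_)
  simp only [dInftyTerm, eVec, PiLp.smul_apply, smul_eq_mul, map_mul, Complex.conj_ofReal,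
    Complex.conj_conj, ← Complex.exp_conj, map_neg, Complex.conj_I, map_natCast,
    two_rpow_neg_natCast]
  push_cast
  ring_nf

end SpectralKernel

/-! ### Limits of covariances and of their square sums. -/

noncomputable section SpectralLimit

open scoped ComplexConjugate

variable {φ ψ : ℝ → ℝ} {M T : ℕ} {α d β L : ℝ} {f : ℝ → ℝ} {Ω : Type*} [MeasurableSpace Ω]
  {P : Measure Ω} {X : ℤ → Ω → ℝ}

/-- Fourier coefficients of `spectralKernel`. -/
def spectralCoeff (φ ψ : ℝ → ℝ) (T : ℕ) (d : ℝ) (f : ℝ → ℝ) (j u v : ℕ) (r : ℤ) : ℂ :=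
  ∫ η, spectralKernel φ ψ T d f j u v η * Complex.exp (Complex.I * η * r)

/-- Substitute η = 2^(j+u) x. Since 2^j (2^u q + v) - 2^(j+u) l = 2^(j+u) (q - l) + 2^j v, fixing
the residue v leaves a dependence on q - l alone; coefficients at different scales are jointly
stationary only in this sense. -/
lemma integral_waveletCoeff_mul (hW : WaveletAssumptions φ ψ M α T) [IsProbabilityMeasure P]
    (hX : HasSpectralDensity (diffIter M X) P
      (fun x => ‖1 - Complex.exp (-(Complex.I * x))‖ ^ (2 * ((M : ℝ) - d)) * f x))
    (hmean : ∀ k : ℤ, ∫ ω, diffIter M X k ω ∂P = 0) (j u v : ℕ) (q l : ℤ) :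
    ((∫ ω, waveletCoeff φ ψ (fun l => X l ω) j (2 ^ u * q + v) *
      waveletCoeff φ ψ (fun l => X l ω) (j + u) l ∂P : ℝ) : ℂ) =
      (((2 ^ (j + u) : ℝ) ^ (2 * d) : ℝ) : ℂ) * spectralCoeff φ ψ T d f j u v (q - l) := by
  rw [covariance_waveletCoeff hW hX hmean]
  have hpi := Real.pi_pos
  set N : ℝ := 2 ^ (j + u) with hN
  have hN0 : 0 < N := by positivity
  set F : ℝ → ℂ := fun x => Complex.exp (Complex.I * x * ((2 : ℂ) ^ j * ((2 ^ u * q + v : ℤ) : ℂ) -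
    2 ^ (j + u) * l)) * transfer φ ψ T j x * conj (transfer φ ψ T (j + u) x) *
    ((‖1 - Complex.exp (-(Complex.I * x))‖ ^ (-2 * d) * f x : ℝ) : ℂ) with hF
  have h1 : ∫ x in (-Real.pi)..Real.pi, F x =
      ((N⁻¹ : ℝ) : ℂ) * ∫ η in (-(N * Real.pi))..(N * Real.pi), F (N⁻¹ * η) := by
    rw [intervalIntegral.integral_comp_mul_left _ (by positivity), Complex.real_smul, inv_inv,
      mul_neg, inv_mul_cancel_left₀ hN0.ne', ← mul_assoc, ← Complex.ofReal_mul,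
      inv_mul_cancel₀ hN0.ne', Complex.ofReal_one, one_mul]
  rw [h1, intervalIntegral.integral_of_le (by nlinarith), integral_Ioc_eq_integral_Ioo,
    ← integral_indicator measurableSet_Ioo, spectralCoeff, ← integral_const_mul,
    ← integral_const_mul]
  congr 1; ext η
  have hmem : η ∈ Set.Ioo (-(N * Real.pi)) (N * Real.pi) ↔
      N⁻¹ * η ∈ Set.Ioo (-Real.pi) Real.pi := by
    rw [Set.mem_Ioo, Set.mem_Ioo, inv_mul_lt_iff₀ hN0, lt_inv_mul_iff₀ hN0, mul_neg]
  by_cases hη : η ∈ Set.Ioo (-(N * Real.pi)) (N * Real.pi)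
  swap
  · rw [Set.indicator_of_notMem hη, spectralKernel, Set.indicator_of_notMem (mt hmem.2 hη)]
    simp
  rw [Set.indicator_of_mem hη, spectralKernel, Set.indicator_of_mem (hmem.1 hη), ← hN]
  have t1 : transfer φ ψ T j (N⁻¹ * η) = ((2 : ℝ) ^ ((j : ℝ) / 2) : ℝ) *
      scaledTransfer φ ψ T j ((2 ^ u)⁻¹ * η) := by
    rw [← transfer_eq_scaledTransfer, ← mul_assoc, ← mul_inv, ← pow_add]
  have t2 : transfer φ ψ T (j + u) (N⁻¹ * η) = ((2 : ℝ) ^ (((j + u : ℕ) : ℝ) / 2) : ℝ) *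
      scaledTransfer φ ψ T (j + u) η := by
    rw [← transfer_eq_scaledTransfer]
  have hpow : ((N * ‖1 - Complex.exp (-(Complex.I * ((N⁻¹ * η : ℝ) : ℂ)))‖) ^ (-2 * d)) =
      (N ^ (2 * d))⁻¹ * ‖1 - Complex.exp (-(Complex.I * ((N⁻¹ * η : ℝ) : ℂ)))‖ ^ (-2 * d) := by
    rw [Real.mul_rpow hN0.le (norm_nonneg _), ← Real.rpow_neg hN0.le]; ring_nf
  have hexp : Complex.exp (Complex.I * ((N⁻¹ * η : ℝ) : ℂ) *
      ((2 : ℂ) ^ j * ((2 ^ u * q + v : ℤ) : ℂ) - 2 ^ (j + u) * l)) =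
      Complex.exp (Complex.I * v * (((2 ^ u)⁻¹ * η : ℝ) : ℂ)) *
        Complex.exp (Complex.I * η * ((q - l : ℤ) : ℂ)) := by
    rw [← Complex.exp_add, hN]
    congr 1
    push_cast
    rw [pow_add]
    field_simp
    ring
  have hconst : N⁻¹ * ((2 : ℝ) ^ ((j : ℝ) / 2) * (2 : ℝ) ^ (((j + u : ℕ) : ℝ) / 2)) =
      (2 : ℝ) ^ (-(u : ℝ) / 2) := by
    rw [hN, ← Real.rpow_natCast, ← Real.rpow_neg (by norm_num), ← Real.rpow_add (by norm_num),
      ← Real.rpow_add (by norm_num)]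
    congr 1; push_cast; ring
  have hcc : N ^ (2 * d) * (N ^ (2 * d))⁻¹ = 1 := mul_inv_cancel₀ (by positivity)
  simp only [hF]
  rw [t1, t2, hexp, hpow, ← hconst, map_mul, Complex.conj_ofReal]
  have hcc' := congrArg (fun r : ℝ => (r : ℂ)) hcc
  generalize N⁻¹ * η = y
  generalize ((2 : ℝ) ^ u)⁻¹ * η = z
  simp only [Complex.ofReal_mul, Complex.ofReal_one] at hcc' ⊢
  linear_combination (-(N⁻¹ : ℝ) * ((2 : ℝ) ^ ((j : ℝ) / 2) : ℝ) *
    ((2 : ℝ) ^ (((j + u : ℕ) : ℝ) / 2) : ℝ) * scaledTransfer φ ψ T j z *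
    conj (scaledTransfer φ ψ T (j + u) η) *
    (‖1 - Complex.exp (-(Complex.I * (y : ℂ)))‖ ^ (-2 * d) : ℝ) * f y *
    Complex.exp (Complex.I * v * (z : ℂ)) * Complex.exp (Complex.I * η * ((q - l : ℤ) : ℂ)) : ℂ) *
      hcc'

/-- Assumptions on the short-memory part of the spectral density. -/
structure ShortMemory (f : ℝ → ℝ) : Prop where
  aestronglyMeasurable : AEStronglyMeasurable ((Set.Ioo (-Real.pi) Real.pi).indicator f)
  bounded : ∃ B : ℝ, ∀ x ∈ Set.Ioo (-Real.pi) Real.pi, |f x| ≤ B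
  tendsto : Tendsto ((Set.Ioo (-Real.pi) Real.pi).indicator f) (𝓝 0) (𝓝 (f 0))
  pos : 0 < f 0

lemma HasMemoryParameter.shortMemory (hX : HasMemoryParameter X P d f) (hf : f ∈ classH β L)
    (hβ : 0 < β) (hd : d ≤ M) : ShortMemory f where
  aestronglyMeasurable := aestronglyMeasurable_of_hasSpectralDensity
    (hX.spectral M (by linarith))
  bounded := by
    obtain ⟨B, hB⟩ := hX.bounded
    exact ⟨B, fun x hx => by rw [abs_of_nonneg (hX.nonneg x hx)]; exact hB x hx⟩
  tendsto := tendsto_of_classH hβ hf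
  pos := by
    obtain ⟨c, hc, ε, hε, h⟩ := hX.bounded_below
    exact hc.trans_le (h 0 (by simpa using hε))

lemma exists_norm_dInftyTerm_le (hW : WaveletAssumptions φ ψ M α T) (hM : 1 ≤ M) (hα : 1 < α)
    (hd : d ≤ M) (hf : ShortMemory f)
    (u : ℕ) : ∃ C : ℝ, 0 ≤ C ∧ ∀ (v : Fin (2 ^ u)) η,
    ‖(f 0 : ℂ) * conj (dInftyTerm ψ u d η v)‖ ≤ C * (1 + |η|) ^ (-(2 * α + 2 * d)) := by
  obtain ⟨B, hB⟩ := hf.bounded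
  obtain ⟨C, hC0, hC⟩ := exists_norm_spectralKernel_le hW hM hα hd hB u
  exact ⟨C, hC0, fun v η => le_of_tendsto (tendsto_spectralKernel hW hM hα hf.tendsto u v η).norm
    (Eventually.of_forall fun j => hC j v η)⟩

lemma aestronglyMeasurable_dInftyTerm (hW : WaveletAssumptions φ ψ M α T) (hM : 1 ≤ M) (hα : 1 < α) (hf : ShortMemory f)
    (u : ℕ) (v : Fin (2 ^ u)) :
    AEStronglyMeasurable fun η => (f 0 : ℂ) * conj (dInftyTerm ψ u d η v) :=
  aestronglyMeasurable_of_tendsto_ae atTop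
    (fun j => aestronglyMeasurable_spectralKernel (φ := φ) (ψ := ψ) (T := T) (d := d)
      hf.aestronglyMeasurable j u v)
    (ae_of_all _ fun η => tendsto_spectralKernel hW hM hα hf.tendsto u v η)

lemma tendsto_spectralCoeff (hW : WaveletAssumptions φ ψ M α T) (hM : 1 ≤ M) (hα : 1 < α)
    (hd : d ≤ M) (hαd : 1 < 2 * α + 2 * d) (hf : ShortMemory f)
    (u : ℕ) (v : Fin (2 ^ u)) :
    (∀ r : ℤ, Tendsto (fun j => spectralCoeff φ ψ T d f j u v r) atTop
      (𝓝 (∫ η, (f 0 * conj (dInftyTerm ψ u d η v)) * Complex.exp (Complex.I * η * r)))) ∧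
    Tendsto (fun j => ∑' r : ℤ, ‖spectralCoeff φ ψ T d f j u v r‖ ^ 2) atTop
      (𝓝 (∑' r : ℤ, ‖∫ η, (f 0 * conj (dInftyTerm ψ u d η v)) *
        Complex.exp (Complex.I * η * r)‖ ^ 2)) := by
  obtain ⟨B, hB⟩ := hf.bounded
  obtain ⟨C, hC0, hC⟩ := exists_norm_spectralKernel_le hW hM hα hd hB u
  exact tendsto_fourier_of_decay hαd hC0
    (fun j => aestronglyMeasurable_spectralKernel hf.aestronglyMeasurable j u v)
    (fun j η => hC j v η) (fun η => tendsto_spectralKernel hW hM hα hf.tendsto u v η)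

lemma summable_spectralCoeff (hW : WaveletAssumptions φ ψ M α T) (hM : 1 ≤ M) (hα : 1 < α)
    (hd : d ≤ M) (hαd : 1 < 2 * α + 2 * d) (hf : ShortMemory f)
    (j u v : ℕ) :
    Summable fun r : ℤ => ‖spectralCoeff φ ψ T d f j u v r‖ ^ 2 := by
  obtain ⟨B, hB⟩ := hf.bounded
  obtain ⟨C, hC0, hC⟩ := exists_norm_spectralKernel_le hW hM hα hd hB u
  exact (hasSum_sq_integral_mul_exp hαd hC0
    (aestronglyMeasurable_spectralKernel hf.aestronglyMeasurable j u v) (fun η => hC j v η)).summable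

lemma periodize_dInftyTerm (hW : WaveletAssumptions φ ψ M α T) (hM : 1 ≤ M) (hα : 1 < α)
    (hd : d ≤ M) (hαd : 1 < 2 * α + 2 * d) (hf : ShortMemory f)
    (u : ℕ) (v : Fin (2 ^ u)) {x : ℝ} (hx : |x| ≤ Real.pi) :
    periodize (fun η => (f 0 : ℂ) * conj (dInftyTerm ψ u d η v)) x =
      f 0 * conj (dInfty ψ u x d v) := by
  obtain ⟨C, hC0, hC⟩ := exists_norm_dInftyTerm_le hW hM hα hd hf u
  have h0 : (f 0 : ℂ) ≠ 0 := by exact_mod_cast hf.pos.ne'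
  have hs : ∀ v : Fin (2 ^ u), Summable fun l : ℤ =>
      dInftyTerm ψ u d (x + 2 * l * Real.pi) v := fun v => by
    have h1 : Summable fun l : ℤ =>
        (f 0 : ℂ) * conj (dInftyTerm ψ u d (x + 2 * l * Real.pi) v) :=
      ((summable_one_add_abs_int_rpow hαd).mul_left C).of_norm_bounded
        fun l => norm_shift_le hαd hC0 (hC v) hx l
    have h2 := (summable_mul_left_iff h0).1 h1
    exact h2.star.congr fun l => Complex.conj_conj _
  -- `dInfty` is a sum of vectors; coordinates pass through it by the continuous equivalence with
  -- functions.
  have hcomp : dInfty ψ u x d v = ∑' l : ℤ, dInftyTerm ψ u d (x + 2 * l * Real.pi) v := by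
    have := congrFun ((EuclideanSpace.equiv (Fin (2 ^ u)) ℂ).map_tsum
      (L := SummationFilter.unconditional ℤ) (f := fun l : ℤ => dInftyTerm ψ u d (x + 2 * l * Real.pi))) v
    exact this.trans (tsum_apply (Pi.summable.2 hs))
  rw [periodize, tsum_mul_left, hcomp, Complex.conj_tsum]

/-- Parseval in each coordinate; summing over the residues v assembles the Euclidean norm. -/
lemma sum_tsum_eq_integral_dInfty (hW : WaveletAssumptions φ ψ M α T) (hM : 1 ≤ M) (hα : 1 < α)
    (hd : d ≤ M) (hαd : 1 < 2 * α + 2 * d) (hf : ShortMemory f)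
    (u : ℕ) :
    ∑ v : Fin (2 ^ u), ∑' r : ℤ, ‖∫ η, (f 0 * conj (dInftyTerm ψ u d η v)) *
        Complex.exp (Complex.I * η * r)‖ ^ 2 =
      2 * Real.pi * (f 0 ^ 2 * ∫ x in (-Real.pi)..Real.pi, ‖dInfty ψ u x d‖ ^ 2) := by
  obtain ⟨C, hC0, hC⟩ := exists_norm_dInftyTerm_le hW hM hα hd hf u
  have hpi := Real.pi_pos
  have h1 : ∀ v : Fin (2 ^ u), ∑' r : ℤ, ‖∫ η, (f 0 * conj (dInftyTerm ψ u d η v)) *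
        Complex.exp (Complex.I * η * r)‖ ^ 2 =
      2 * Real.pi * ∫ x in (-Real.pi)..Real.pi,
        ‖periodize (fun η => (f 0 : ℂ) * conj (dInftyTerm ψ u d η v)) x‖ ^ 2 := fun v =>
    (hasSum_sq_integral_mul_exp hαd hC0
      (aestronglyMeasurable_dInftyTerm hW hM hα hf u v) (hC v)).tsum_eq
  have hint : ∀ v : Fin (2 ^ u), IntervalIntegrable (fun x =>
      ‖periodize (fun η => (f 0 : ℂ) * conj (dInftyTerm ψ u d η v)) x‖ ^ 2) volume
      (-Real.pi) Real.pi := fun v => by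
    rw [intervalIntegrable_iff_integrableOn_Ioc_of_le (by linarith)]
    refine Integrable.of_bound ((aestronglyMeasurable_periodize
      (aestronglyMeasurable_dInftyTerm hW hM hα hf u v)).restrict.norm.pow 2)
      ((C * ∑' l : ℤ, (1 + |(l : ℝ)|) ^ (-(2 * α + 2 * d))) ^ 2) ?_
    refine (ae_restrict_iff' measurableSet_Ioc).2 (ae_of_all _ fun x hx => ?_)
    rw [norm_pow, norm_norm]
    exact pow_le_pow_left₀ (norm_nonneg _)
      (norm_periodize_le hαd hC0 (hC v) (abs_le.2 ⟨hx.1.le, hx.2⟩)) _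
  rw [Finset.sum_congr rfl fun v _ => h1 v, ← Finset.mul_sum,
    ← intervalIntegral.integral_finsetSum fun v _ => hint v,
    ← intervalIntegral.integral_const_mul (f 0 ^ 2)]
  congr 1
  refine intervalIntegral.integral_congr fun x hx => ?_
  rw [Set.uIcc_of_le (by linarith)] at hx
  simp only [periodize_dInftyTerm hW hM hα hd hαd hf u _ (abs_le.2 hx), norm_mul,
    RCLike.norm_conj, mul_pow, Complex.norm_real, Real.norm_eq_abs, sq_abs]
  rw [← Finset.mul_sum, EuclideanSpace.norm_sq_eq]

/-- The case u = v = r = 0 is the normalized variance of a coefficient. -/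
lemma tendsto_spectralCoeff_zero (hW : WaveletAssumptions φ ψ M α T) (hM : 1 ≤ M) (hα : 1 < α)
    (hd : d ≤ M) (hαd : 1 < 2 * α + 2 * d) (hf : ShortMemory f) :
    Tendsto (fun j => spectralCoeff φ ψ T d f j 0 0 0) atTop (𝓝 ((f 0 * Kpsi ψ d : ℝ) : ℂ)) := by
  refine ((tendsto_spectralCoeff hW hM hα hd hαd hf 0 0).1 0).trans_eq (congrArg 𝓝 ?_)
  rw [Kpsi, ← integral_const_mul, ← integral_complex_ofReal]
  congr 1; ext η
  have h := Complex.mul_conj (fourierT ψ η)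
  rw [Complex.normSq_eq_norm_sq, Complex.ofReal_pow] at h
  simp [dInftyTerm, eVec]
  left
  linear_combination ((|η| ^ (-(2 * d)) : ℝ) : ℂ) * h

/-- If the integral were 0, the transform of ψ would vanish almost everywhere, hence everywhere by
continuity, and inversion would give ψ = 0 almost everywhere, against ∫ ψ² = 1. -/
lemma Kpsi_pos (hW : WaveletAssumptions φ ψ M α T) (hM : 1 ≤ M) (hα : 1 < α)
    (hd : d ≤ M) (hαd : 1 < 2 * α + 2 * d) (hf : ShortMemory f)
    : 0 < Kpsi ψ d := by
  obtain ⟨C, hC0, hC⟩ := exists_norm_dInftyTerm_le hW hM hα hd hf 0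
  -- Integrability is needed, as the integral of a non-integrable function is 0 by convention.
  have hi := integrable_of_decay hαd
    (aestronglyMeasurable_dInftyTerm hW hM hα hf 0 0) (hC 0)
  have e : ∀ η, ‖(f 0 : ℂ) * conj (dInftyTerm ψ 0 d η 0)‖ =
      f 0 * (|η| ^ (-2 * d) * ‖fourierT ψ η‖ ^ 2) := fun η => by
    simp [dInftyTerm, eVec, abs_of_pos hf.pos]
    rw [abs_of_nonneg (by positivity)]; left; ring
  have hi' : Integrable fun η => |η| ^ (-2 * d) * ‖fourierT ψ η‖ ^ 2 := by
    have := hi.norm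
    simp only [e] at this
    exact (integrable_const_mul_iff (IsUnit.mk0 _ hf.pos.ne') _).1 this
  have hnn : ∀ η, 0 ≤ |η| ^ (-2 * d) * ‖fourierT ψ η‖ ^ 2 := fun η => by positivity
  refine (integral_nonneg hnn).lt_of_ne fun h => ?_
  have hz := (integral_eq_zero_iff_of_nonneg hnn hi').1 h.symm
  have hz' : fourierT ψ =ᵐ[volume] 0 := by
    have hne : ∀ᵐ x : ℝ, x ≠ 0 := by
      rw [ae_iff]; simp
    filter_upwards [hz, hne] with η hη h0
    have : |η| ^ (-2 * d) ≠ 0 := (Real.rpow_pos_of_pos (abs_pos.2 h0) _).ne'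
    have h2 := (mul_eq_zero.1 hη).resolve_left this
    simpa using h2
  have hz0 := ((continuous_fourierT hW.integrable_psi).ae_eq_iff_eq volume continuous_zero).1 hz'
  have h1 : (fun t => (ψ t : ℂ)) =ᵐ[volume] 0 := by
    have hF : FourierTransform.fourier (fun t => (ψ t : ℂ)) = (0 : ℝ → ℂ) := by
      ext x; rw [fourier_ofReal, hz0]; rfl
    have hi : Integrable fun t => (ψ t : ℂ) := hW.integrable_psi.ofReal
    have := ae_eq_fourierInv_fourier hi (by rw [hF]; exact integrable_zero _ _ _)
    rw [hF] at this
    filter_upwards [this] with t ht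
    rw [ht, Real.fourierInv_eq]; simp
  have h2 : ∫ t, ψ t ^ 2 = 0 := by
    rw [← integral_zero ℝ ℝ (μ := volume)]
    refine integral_congr_ae ?_
    filter_upwards [h1] with t ht
    have : ψ t = 0 := by simpa using ht
    simp [this]
  rw [hW.integral_psi_sq] at h2
  exact one_ne_zero h2

end SpectralLimit

/-! ### Residue classes and asymptotics of the numbers of coefficients. -/

section Counting

/-- Division with remainder k = Uq + v; the number of q with Uq + v < N is (N - v)/U rounded up,
written without truncation problems because v < U. -/
lemma sum_range_eq_sum_residues {A : Type*} [AddCommMonoid A] {U : ℕ} (hU : 0 < U) (N : ℕ)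
    (F : ℕ → A) : ∑ k ∈ Finset.range N, F k =
      ∑ v : Fin U, ∑ q ∈ Finset.range ((N + (U - 1 - v)) / U), F (U * q + v) := by
  rw [Finset.sum_sigma' Finset.univ fun v : Fin U => Finset.range ((N + (U - 1 - v)) / U)]
  refine Finset.sum_bij' (fun k _ => ⟨⟨k % U, Nat.mod_lt _ hU⟩, k / U⟩)
    (fun x _ => U * x.2 + x.1) (fun k hk => ?_) (fun x hx => ?_) (fun k _ => ?_) (fun x _ => ?_)
    fun k _ => ?_
  · simp only [Finset.mem_sigma, Finset.mem_univ, true_and, Finset.mem_range] at hk ⊢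
    have h1 := Nat.mod_lt k hU
    have h2 := Nat.div_add_mod k U
    rw [← Nat.succ_le_iff, Nat.le_div_iff_mul_le hU, Nat.succ_mul, mul_comm]
    omega
  · simp only [Finset.mem_sigma, Finset.mem_univ, true_and, Finset.mem_range] at hx ⊢
    have h1 := x.1.2
    rw [← Nat.succ_le_iff, Nat.le_div_iff_mul_le hU, Nat.succ_mul, mul_comm] at hx
    omega
  · exact Nat.div_add_mod k U
  · obtain ⟨v, q⟩ := x
    have h1 : (U * q + v) % U = v := by
      rw [Nat.mul_add_mod, Nat.mod_eq_of_lt v.2]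
    have h2 : (U * q + v) / U = q := by
      rw [Nat.mul_add_div hU, Nat.div_eq_of_lt v.2, add_zero]
    simp [h1, h2]
  · rw [Nat.div_add_mod]

lemma tendsto_residue_count {U : ℕ} (hU : 0 < U) (v : Fin U) {N : ℕ → ℕ} {N' : ℕ → ℝ}
    (hN' : Tendsto N' atTop atTop)
    (h : Tendsto (fun n => (N n : ℝ) / N' n) atTop (𝓝 U)) :
    Tendsto (fun n => (((N n + (U - 1 - v)) / U : ℕ) : ℝ) / N' n) atTop (𝓝 1) := by
  have hU' : (0 : ℝ) < U := by exact_mod_cast hU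
  have hinv : Tendsto (fun n => (N' n)⁻¹) atTop (𝓝 0) := tendsto_inv_atTop_zero.comp hN'
  have l1 : Tendsto (fun n => (N n : ℝ) / N' n / U - (N' n)⁻¹) atTop (𝓝 1) := by
    have := (h.div_const (U : ℝ)).sub hinv
    rwa [div_self hU'.ne', sub_zero] at this
  have l2 : Tendsto (fun n => (N n : ℝ) / N' n / U + (N' n)⁻¹) atTop (𝓝 1) := by
    have := (h.div_const (U : ℝ)).add hinv
    rwa [div_self hU'.ne', add_zero] at this
  refine tendsto_of_tendsto_of_tendsto_of_le_of_le' l1 l2 ?_ ?_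
  · filter_upwards [hN'.eventually_gt_atTop 0] with n hn
    have h1 : N n < ((N n + (U - 1 - v)) / U + 1) * U := by
      have := Nat.lt_mul_div_succ (N n + (U - 1 - v)) hU
      rw [mul_comm] at this
      omega
    have h2 : (N n : ℝ) ≤ ((((N n + (U - 1 - v)) / U : ℕ) : ℝ) + 1) * U := by exact_mod_cast h1.le
    rw [div_right_comm, ← sub_nonneg, inv_eq_one_div, ← sub_div, ← sub_div]
    refine div_nonneg ?_ hn.le
    rw [← div_le_iff₀ hU'] at h2
    linarith
  · filter_upwards [hN'.eventually_gt_atTop 0] with n hn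
    have h1 : ((N n + (U - 1 - v)) / U) * U ≤ N n + U := by
      have := Nat.div_mul_le_self (N n + (U - 1 - v)) U
      omega
    have h2 : (((N n + (U - 1 - v)) / U : ℕ) : ℝ) * U ≤ N n + U := by exact_mod_cast h1
    rw [div_right_comm, inv_eq_one_div, ← add_div]
    refine div_le_div_of_nonneg_right ?_ hn.le
    rw [← le_div_iff₀ hU', add_div, div_self hU'.ne'] at h2
    exact h2

variable {T ℓ : ℕ} {J₀ : ℕ → ℕ}

/-- `2^(-J) (n - T + 1)`, the order of magnitude of the number of coefficients at scale `J`. -/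
noncomputable def scaledLength (T n J : ℕ) : ℝ := ((2 : ℝ) ^ J)⁻¹ * ((n : ℝ) - T + 1)

lemma numCoeff_add (T n J i : ℕ) :
    numCoeff T n (J + i) = ⌊((2 : ℝ) ^ i)⁻¹ * scaledLength T n J - T + 1⌋₊ := by
  rw [numCoeff, two_rpow_neg_natCast, scaledLength, pow_add, mul_inv]
  congr 3; ring

lemma totalCoeff_eq (T ℓ n J : ℕ) :
    totalCoeff T ℓ n J = ∑ i : Fin (ℓ + 1), numCoeff T n (J + i) := by
  rw [totalCoeff, ← Finset.sum_range fun i => numCoeff T n (J + i),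
    show Finset.Icc J (J + ℓ) = Finset.Ico J (J + ℓ + 1) by ext; simp only [Finset.mem_Icc, Finset.mem_Ico]; omega,
    Finset.sum_Ico_eq_sum_range]
  congr 2; omega

lemma tendsto_scaledLength (hT : 1 ≤ T)
    (hm : Tendsto (fun n => totalCoeff T ℓ n (J₀ n)) atTop atTop) :
    Tendsto (fun n => scaledLength T n (J₀ n)) atTop atTop := by
  have hT' : (1 : ℝ) ≤ T := by exact_mod_cast hT
  -- Each count is at most the scaled length because -T + 1 ≤ 0; the maximum with 0 covers scales
  -- without coefficients.
  have hb : ∀ n, (totalCoeff T ℓ n (J₀ n) : ℝ) ≤ (ℓ + 1) * max (scaledLength T n (J₀ n)) 0 :=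
    fun n => by
    have : ∀ i : Fin (ℓ + 1), (numCoeff T n (J₀ n + i) : ℝ) ≤ max (scaledLength T n (J₀ n)) 0 := by
      intro i
      rw [numCoeff_add]
      set a := scaledLength T n (J₀ n)
      have h1 : ((2 : ℝ) ^ (i : ℕ))⁻¹ ≤ 1 := inv_le_one_of_one_le₀ (one_le_pow₀ (by norm_num))
      have h2 : ((2 : ℝ) ^ (i : ℕ))⁻¹ * a - T + 1 ≤ max a 0 := by
        have : ((2 : ℝ) ^ (i : ℕ))⁻¹ * a ≤ 1 * max a 0 :=
          mul_le_mul_of_nonneg h1 (le_max_left _ _) (by positivity) (le_max_right _ _)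
        linarith
      exact (Nat.cast_le.2 (Nat.floor_mono h2)).trans (Nat.floor_le (le_max_right _ _))
    rw [totalCoeff_eq]
    push_cast
    refine (Finset.sum_le_sum fun i _ => this i).trans_eq ?_
    simp
  have h1 : Tendsto (fun n => max (scaledLength T n (J₀ n)) 0) atTop atTop := by
    have h2 := (tendsto_natCast_atTop_atTop (R := ℝ)).comp hm
    refine Tendsto.atTop_of_const_mul₀ (c := (ℓ : ℝ) + 1) (by positivity)
      (tendsto_atTop_mono hb h2)
  -- Comparing with max b 1, which is positive, rules out the branch where the maximum is 0.
  refine tendsto_atTop.2 fun b => ?_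
  filter_upwards [h1.eventually_ge_atTop (max b 1)] with n hn
  rcases le_max_iff.1 hn with h | h
  · exact (le_max_left _ _).trans h
  · have := (le_max_right b 1).trans h
    linarith

lemma tendsto_numCoeff_div (ha : Tendsto (fun n => scaledLength T n (J₀ n)) atTop atTop) (i : ℕ) :
    Tendsto (fun n => (numCoeff T n (J₀ n + i) : ℝ) / scaledLength T n (J₀ n)) atTop
      (𝓝 ((2 : ℝ) ^ i)⁻¹) := by
  have hc : (0 : ℝ) < ((2 : ℝ) ^ i)⁻¹ := by positivity
  have hy : Tendsto (fun n => ((2 : ℝ) ^ i)⁻¹ * scaledLength T n (J₀ n) - T + 1) atTop atTop := by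
    have := tendsto_atTop_add_const_right _ (-(T : ℝ) + 1) (ha.const_mul_atTop hc)
    refine this.congr fun n => by ring
  have h1 := (tendsto_nat_floor_div_atTop (R := ℝ)).comp hy
  have hinv : Tendsto (fun n => (scaledLength T n (J₀ n))⁻¹) atTop (𝓝 0) :=
    tendsto_inv_atTop_zero.comp ha
  have h2 : Tendsto (fun n => (((2 : ℝ) ^ i)⁻¹ * scaledLength T n (J₀ n) - T + 1) /
      scaledLength T n (J₀ n)) atTop (𝓝 ((2 : ℝ) ^ i)⁻¹) := by
    have := (hinv.const_mul (-(T : ℝ) + 1)).const_add ((2 : ℝ) ^ i)⁻¹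
    rw [mul_zero, add_zero] at this
    refine this.congr' ?_
    filter_upwards [ha.eventually_gt_atTop 0] with n hn
    field_simp
    ring
  have h3 := h1.mul h2
  rw [one_mul] at h3
  refine h3.congr' ?_
  filter_upwards [ha.eventually_gt_atTop 0, hy.eventually_gt_atTop 0] with n hn hyn
  simp only [Function.comp]
  rw [numCoeff_add, div_mul_div_cancel₀ hyn.ne']

lemma tendsto_numCoeff (ha : Tendsto (fun n => scaledLength T n (J₀ n)) atTop atTop) (i : ℕ) :
    Tendsto (fun n => (numCoeff T n (J₀ n + i) : ℝ)) atTop atTop := by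
  have := (tendsto_numCoeff_div ha i).pos_mul_atTop (by positivity) ha
  refine this.congr' ?_
  filter_upwards [ha.eventually_gt_atTop 0] with n hn
  field_simp

lemma tendsto_numCoeff_div_numCoeff
    (ha : Tendsto (fun n => scaledLength T n (J₀ n)) atTop atTop) (i u : ℕ) :
    Tendsto (fun n => (numCoeff T n (J₀ n + i) : ℝ) / numCoeff T n (J₀ n + (i + u))) atTop
      (𝓝 ((2 ^ u : ℕ) : ℝ)) := by
  have := (tendsto_numCoeff_div ha i).div (tendsto_numCoeff_div ha (i + u)) (by positivity)
  have e : ((2 : ℝ) ^ i)⁻¹ / ((2 : ℝ) ^ (i + u))⁻¹ = ((2 ^ u : ℕ) : ℝ) := by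
    rw [pow_add]; push_cast; field_simp
  rw [e] at this
  refine this.congr' ?_
  filter_upwards [ha.eventually_gt_atTop 0] with n hn
  exact div_div_div_cancel_right₀ hn.ne' _ _

lemma tendsto_totalCoeff_div_numCoeff
    (ha : Tendsto (fun n => scaledLength T n (J₀ n)) atTop atTop) (i : ℕ) :
    Tendsto (fun n => (totalCoeff T ℓ n (J₀ n) : ℝ) / numCoeff T n (J₀ n + i)) atTop
      (𝓝 (2 ^ i * (2 - (2 : ℝ) ^ (-(ℓ : ℝ))))) := by
  have h1 : Tendsto (fun n => (totalCoeff T ℓ n (J₀ n) : ℝ) / scaledLength T n (J₀ n)) atTop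
      (𝓝 (2 - (2 : ℝ) ^ (-(ℓ : ℝ)))) := by
    have h2 := tendsto_finsetSum Finset.univ fun (i : Fin (ℓ + 1)) _ =>
      tendsto_numCoeff_div (T := T) (J₀ := J₀) ha i
    have e : ∑ i : Fin (ℓ + 1), ((2 : ℝ) ^ (i : ℕ))⁻¹ = 2 - (2 : ℝ) ^ (-(ℓ : ℝ)) := by
      rw [← Finset.sum_range fun i => ((2 : ℝ) ^ i)⁻¹, two_rpow_neg_natCast]
      have key : ∀ k : ℕ, ∑ i ∈ Finset.range (k + 1), ((2 : ℝ) ^ i)⁻¹ = 2 - ((2 : ℝ) ^ k)⁻¹ := by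
        intro k
        induction k with
        | zero => norm_num
        | succ k ih =>
          rw [Finset.sum_range_succ, ih, pow_succ, mul_inv]; ring
      exact key ℓ
    rw [e] at h2
    refine h2.congr fun n => ?_
    rw [totalCoeff_eq, ← Finset.sum_div]
    push_cast; rfl
  have := h1.div (tendsto_numCoeff_div ha i) (by positivity)
  rw [div_inv_eq_mul, mul_comm] at this
  refine this.congr' ?_
  filter_upwards [ha.eventually_gt_atTop 0] with n hn
  exact div_div_div_cancel_right₀ hn.ne' _ _

/-- As m is of order 2^(-J₀) n, the condition m/n → 0 forces 2^(-J₀) → 0. -/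
lemma tendsto_lowerScale (hm : Tendsto (fun n => scaledLength T n (J₀ n)) atTop atTop)
    (hmn : Tendsto (fun n => (totalCoeff T ℓ n (J₀ n) : ℝ) / (n : ℝ)) atTop (𝓝 0)) :
    Tendsto J₀ atTop atTop := by
  have hn : Tendsto (fun n : ℕ => (n : ℝ)) atTop atTop := tendsto_natCast_atTop_atTop
  have h0 := (tendsto_totalCoeff_div_numCoeff (ℓ := ℓ) hm 0)
  have h1 := tendsto_numCoeff_div hm 0
  have hpos : (0 : ℝ) < 2 ^ 0 * (2 - (2 : ℝ) ^ (-(ℓ : ℝ))) := by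
    have : (2 : ℝ) ^ (-(ℓ : ℝ)) ≤ 1 := Real.rpow_le_one_of_one_le_of_nonpos (by norm_num)
      (neg_nonpos.2 (by positivity))
    rw [pow_zero, one_mul]; linarith
  have h2 : Tendsto (fun n => scaledLength T n (J₀ n) / (n : ℝ)) atTop (𝓝 0) := by
    have h3 := (hmn.div h0 hpos.ne').div h1 (by positivity)
    rw [zero_div, zero_div] at h3
    refine h3.congr' ?_
    filter_upwards [hm.eventually_gt_atTop 0, (tendsto_numCoeff hm 0).eventually_gt_atTop 0,
      hn.eventually_gt_atTop 0, h0.eventually_const_lt hpos] with n a b c e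
    have e' : (totalCoeff T ℓ n (J₀ n) : ℝ) ≠ 0 := fun h => by simp [h] at e
    simp only [Pi.div_apply]
    field_simp
  have h4 : Tendsto (fun n : ℕ => (n : ℝ) / ((n : ℝ) - T + 1)) atTop (𝓝 1) := by
    have := ((tendsto_inv_atTop_zero.comp hn).const_mul (-(T : ℝ) + 1)).const_add 1
    rw [mul_zero, add_zero] at this
    have := this.inv₀ one_ne_zero
    rw [inv_one] at this
    refine this.congr' ?_
    filter_upwards [hn.eventually_gt_atTop 0] with n h6
    rw [← inv_div]
    congr 1
    simp only [Function.comp]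
    field_simp
    ring
  have h5 : Tendsto (fun n => ((2 : ℝ) ^ J₀ n)⁻¹) atTop (𝓝 0) := by
    have := h2.mul h4
    rw [zero_mul] at this
    refine this.congr' ?_
    filter_upwards [hn.eventually_gt_atTop 0, hn.eventually_gt_atTop (T : ℝ)] with n h6 h7
    have : (0 : ℝ) < (n : ℝ) - T + 1 := by linarith
    rw [scaledLength]
    field_simp
  refine tendsto_atTop.2 fun K => ?_
  filter_upwards [h5.eventually_lt_const (by positivity : (0 : ℝ) < ((2 : ℝ) ^ K)⁻¹)] with n h8
  rw [inv_lt_inv₀ (by positivity) (by positivity)] at h8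
  exact ((pow_lt_pow_iff_right₀ (by norm_num : (1 : ℝ) < 2)).1 h8).le

end Counting

/-! ### Assembling the covariance limit. -/

noncomputable section Assembly

variable {φ ψ : ℝ → ℝ} {M T ℓ : ℕ} {α d : ℝ} {f : ℝ → ℝ} {Ω : Type*} [MeasurableSpace Ω]
  {P : Measure Ω} {X : ℤ → Ω → ℝ} {J₀ : ℕ → ℕ}

lemma integral_waveletCoeff_sq (hW : WaveletAssumptions φ ψ M α T) [IsProbabilityMeasure P]
    (hX : HasSpectralDensity (diffIter M X) P
      (fun x => ‖1 - Complex.exp (-(Complex.I * x))‖ ^ (2 * ((M : ℝ) - d)) * f x))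
    (hmean : ∀ k : ℤ, ∫ ω, diffIter M X k ω ∂P = 0) (j : ℕ) (k : ℤ) :
    ∫ ω, waveletCoeff φ ψ (fun l => X l ω) j k ^ 2 ∂P =
      (2 ^ j : ℝ) ^ (2 * d) * (spectralCoeff φ ψ T d f j 0 0 0).re := by
  have h := congrArg Complex.re (integral_waveletCoeff_mul hW hX hmean j 0 0 k k)
  rw [Complex.re_ofReal_mul, Complex.ofReal_re, sub_self] at h
  simpa [pow_two] using h

lemma integral_waveletCoeff_mul_sq (hW : WaveletAssumptions φ ψ M α T) [IsProbabilityMeasure P]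
    (hX : HasSpectralDensity (diffIter M X) P
      (fun x => ‖1 - Complex.exp (-(Complex.I * x))‖ ^ (2 * ((M : ℝ) - d)) * f x))
    (hmean : ∀ k : ℤ, ∫ ω, diffIter M X k ω ∂P = 0) (j u v : ℕ) (q l : ℤ) :
    (∫ ω, waveletCoeff φ ψ (fun l => X l ω) j (2 ^ u * q + v) *
      waveletCoeff φ ψ (fun l => X l ω) (j + u) l ∂P) ^ 2 =
      ((2 ^ (j + u) : ℝ) ^ (2 * d)) ^ 2 * ‖spectralCoeff φ ψ T d f j u v (q - l)‖ ^ 2 := by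
  have h := congrArg norm (integral_waveletCoeff_mul hW hX hmean j u v q l)
  rw [norm_mul, Complex.norm_real, Complex.norm_real, Real.norm_eq_abs,
    Real.norm_of_nonneg (by positivity)] at h
  rw [← sq_abs, h, mul_pow]

lemma tendsto_re_spectralCoeff_zero (hW : WaveletAssumptions φ ψ M α T) (hM : 1 ≤ M) (hα : 1 < α)
    (hd : d ≤ M) (hαd : 1 < 2 * α + 2 * d) (hf : ShortMemory f) (hJ : Tendsto J₀ atTop atTop)
    (i : ℕ) : Tendsto (fun n => (spectralCoeff φ ψ T d f (J₀ n + i) 0 0 0).re) atTop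
      (𝓝 (f 0 * Kpsi ψ d)) :=
  (Complex.continuous_re.tendsto _).comp
    ((tendsto_spectralCoeff_zero hW hM hα hd hαd hf).comp
      ((tendsto_add_atTop_nat i).comp hJ))

/-- Scale J₀ + i has about 2^u times as many coefficients as scale J₀ + i + u, so each residue class
v has asymptotically as many indices q as there are l, and the Cesàro limit applies class by class.
-/
lemma tendsto_sum_sq_spectralCoeff (hW : WaveletAssumptions φ ψ M α T) (hM : 1 ≤ M) (hα : 1 < α)
    (hd : d ≤ M) (hαd : 1 < 2 * α + 2 * d) (hf : ShortMemory f) (hJ : Tendsto J₀ atTop atTop)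
    (ha : Tendsto (fun n => scaledLength T n (J₀ n)) atTop atTop) (i u : ℕ) :
    Tendsto (fun n => ∑ v : Fin (2 ^ u), (numCoeff T n (J₀ n + (i + u)) : ℝ)⁻¹ *
      ∑ q ∈ Finset.range ((numCoeff T n (J₀ n + i) + (2 ^ u - 1 - v)) / 2 ^ u),
        ∑ l ∈ Finset.range (numCoeff T n (J₀ n + (i + u))),
          ‖spectralCoeff φ ψ T d f (J₀ n + i) u v ((q : ℤ) - l)‖ ^ 2) atTop
      (𝓝 (2 * Real.pi * (f 0 ^ 2 * ∫ x in (-Real.pi)..Real.pi, ‖dInfty ψ u x d‖ ^ 2))) := by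
  rw [← sum_tsum_eq_integral_dInfty hW hM hα hd hαd hf]
  refine tendsto_finsetSum _ fun v _ => ?_
  have hJi : Tendsto (fun n => J₀ n + i) atTop atTop := (tendsto_add_atTop_nat i).comp hJ
  obtain ⟨h1, h2⟩ := tendsto_spectralCoeff hW hM hα hd hαd hf u v
  obtain ⟨C, hC0, hC⟩ := exists_norm_dInftyTerm_le hW hM hα hd hf u
  have hN := tendsto_numCoeff (T := T) (J₀ := J₀) ha (i + u)
  refine tendsto_avg_sum_sub (e := fun n r => ‖spectralCoeff φ ψ T d f (J₀ n + i) u v r‖ ^ 2)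
    (fun n r => by positivity)
    (fun n => summable_spectralCoeff hW hM hα hd hαd hf _ u v)
    (hasSum_sq_integral_mul_exp hαd hC0
      (aestronglyMeasurable_dInftyTerm hW hM hα hf u v) (hC v)).summable
    (fun r => ((h1 r).comp hJi).norm.pow 2) (h2.comp hJi) hN
    (tendsto_residue_count (by positivity) v hN (tendsto_numCoeff_div_numCoeff ha i u)) ?_
  refine tendsto_const_nhds.congr' ?_
  filter_upwards [hN.eventually_gt_atTop 0] with n hn
  exact (div_self hn.ne').symm

/-- The powers of 2^(J₀+i) cancel between squared covariances and variances, leaving 2^(2du), and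
f(0)² cancels too. The factor m / n_{J₀+i} yields 2^i (2 - 2^(-ℓ)), the other inverse count
normalizes the Cesàro average, and 2 · 2π = 4π. -/
lemma tendsto_covariance_sum [IsProbabilityMeasure P] (hW : WaveletAssumptions φ ψ M α T)
    (hX : HasSpectralDensity (diffIter M X) P
      (fun x => ‖1 - Complex.exp (-(Complex.I * x))‖ ^ (2 * ((M : ℝ) - d)) * f x))
    (hmean : ∀ k : ℤ, ∫ ω, diffIter M X k ω ∂P = 0) (hM : 1 ≤ M) (hα : 1 < α)
    (hd : d ≤ M) (hαd : 1 < 2 * α + 2 * d) (hf : ShortMemory f) (hJ : Tendsto J₀ atTop atTop)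
    (ha : Tendsto (fun n => scaledLength T n (J₀ n)) atTop atTop) (ℓ i u : ℕ) :
    Tendsto (fun n => (totalCoeff T ℓ n (J₀ n) : ℝ) * ((numCoeff T n (J₀ n + i) : ℝ)⁻¹ *
      (numCoeff T n (J₀ n + (i + u)) : ℝ)⁻¹ * ∑ k ∈ Finset.range (numCoeff T n (J₀ n + i)),
        ∑ l ∈ Finset.range (numCoeff T n (J₀ n + (i + u))),
          2 * (∫ ω, waveletCoeff φ ψ (fun l => X l ω) (J₀ n + i) k *
            waveletCoeff φ ψ (fun l => X l ω) (J₀ n + (i + u)) l ∂P) ^ 2 /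
          ((2 ^ (J₀ n + i) : ℝ) ^ (2 * d) * (spectralCoeff φ ψ T d f (J₀ n + i) 0 0 0).re *
            ((2 ^ (J₀ n + (i + u)) : ℝ) ^ (2 * d) *
              (spectralCoeff φ ψ T d f (J₀ n + (i + u)) 0 0 0).re)))) atTop
      (𝓝 ((2 - (2 : ℝ) ^ (-(ℓ : ℝ))) * (4 * Real.pi * (2 : ℝ) ^ (2 * d * (u : ℝ)) * 2 ^ i /
        Kpsi ψ d ^ 2 * ∫ x in (-Real.pi)..Real.pi, ‖dInfty ψ u x d‖ ^ 2))) := by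
  have hK := Kpsi_pos hW hM hα hd hαd hf
  have hf0 := hf.pos
  have l1 := tendsto_totalCoeff_div_numCoeff (T := T) (J₀ := J₀) (ℓ := ℓ) ha i
  have l2 := tendsto_re_spectralCoeff_zero hW hM hα hd hαd hf hJ i
  have l3 := tendsto_re_spectralCoeff_zero hW hM hα hd hαd hf hJ (i + u)
  have l4 := tendsto_sum_sq_spectralCoeff hW hM hα hd hαd hf hJ ha i u
  have l5 := ((l2.mul l3).inv₀ (by positivity)).const_mul (2 * (2 : ℝ) ^ (2 * d * (u : ℝ)))
  refine ((l1.mul l5).mul l4).congr' ?_ |>.trans_eq (congrArg 𝓝 ?_)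
  · filter_upwards [l2.eventually_const_lt (by positivity : 0 < f 0 * Kpsi ψ d),
      l3.eventually_const_lt (by positivity : 0 < f 0 * Kpsi ψ d)] with n h2 h3
    set S := (spectralCoeff φ ψ T d f (J₀ n + i) 0 0 0).re
    set S' := (spectralCoeff φ ψ T d f (J₀ n + (i + u)) 0 0 0).re
    set N := numCoeff T n (J₀ n + i)
    set N' := numCoeff T n (J₀ n + (i + u))
    have hcu : (2 ^ (J₀ n + (i + u)) : ℝ) ^ (2 * d) =
        (2 ^ (J₀ n + i) : ℝ) ^ (2 * d) * (2 : ℝ) ^ (2 * d * (u : ℝ)) := by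
      rw [← add_assoc, pow_add, Real.mul_rpow (by positivity) (by positivity),
        ← Real.rpow_natCast 2 u, ← Real.rpow_mul (by norm_num), mul_comm (u : ℝ)]
    have hterm : ∀ (v : Fin (2 ^ u)) (q l : ℕ),
        2 * (∫ ω, waveletCoeff φ ψ (fun l => X l ω) (J₀ n + i) ((2 ^ u * q + v : ℕ) : ℤ) *
            waveletCoeff φ ψ (fun l => X l ω) (J₀ n + (i + u)) l ∂P) ^ 2 /
          ((2 ^ (J₀ n + i) : ℝ) ^ (2 * d) * S * ((2 ^ (J₀ n + (i + u)) : ℝ) ^ (2 * d) * S')) =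
        2 * (2 : ℝ) ^ (2 * d * (u : ℝ)) * (S * S')⁻¹ *
          ‖spectralCoeff φ ψ T d f (J₀ n + i) u v ((q : ℤ) - l)‖ ^ 2 := fun v q l => by
      have h := integral_waveletCoeff_mul_sq hW hX hmean (J₀ n + i) u v q l
      rw [add_assoc] at h
      push_cast
      rw [h, hcu]
      have hc : 0 < (2 ^ (J₀ n + i) : ℝ) ^ (2 * d) := by positivity
      field_simp
    rw [sum_range_eq_sum_residues (by positivity : 0 < 2 ^ u)]
    simp only [hterm, ← Finset.mul_sum]
    rw [div_eq_mul_inv]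
    ring
  · field_simp
    ring

end Assembly

end WaveletRegression

/-! ### Proof of the theorem. -/

open WaveletRegression in
theorem mainTheorem3
    {Ω : Type*} [MeasurableSpace Ω] (P : Measure Ω) [IsProbabilityMeasure P]
    (φ ψ : ℝ → ℝ) (M : ℕ) (hM : 1 ≤ M) (α : ℝ) (hα : 1 < α) (T : ℕ) (hT : 1 ≤ T)
    (hW : WaveletAssumptions φ ψ M α T)
    (β L : ℝ) (hβ : β ∈ Set.Ioc (0 : ℝ) 2) (hL : 0 < L)
    (d : ℝ) (hd : d ∈ Set.Ioc ((1 + β) / 2 - α) (M : ℝ))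
    (fstar : ℝ → ℝ) (hf : fstar ∈ classH β L)
    (X : ℤ → Ω → ℝ) (hGauss : IsGaussianProcess X P)
    (hX : HasMemoryParameter X P d fstar)
    (hmean : ∀ k : ℤ, ∫ ω, diffIter M X k ω ∂P = 0)
    (ℓ : ℕ) (hℓ : 1 ≤ ℓ) (w : Fin (ℓ + 1) → ℝ)
    (hw0 : ∑ i, w i = 0)
    (hw1 : 2 * Real.log 2 * ∑ i : Fin (ℓ + 1), ((i : ℕ) : ℝ) * w i = 1)
    (J₀ : ℕ → ℕ)
    (hm : Tendsto (fun n => totalCoeff T ℓ n (J₀ n)) atTop atTop)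
    (hmn : Tendsto (fun n => (totalCoeff T ℓ n (J₀ n) : ℝ) / (n : ℝ)) atTop (𝓝 0)) :
    (∀ᶠ n in atTop, MemLp (fun ω => dHat φ ψ T w (fun k => X k ω) n (J₀ n)) 2 P) ∧
    Tendsto
      (fun n => (totalCoeff T ℓ n (J₀ n) : ℝ) *
        variance (fun ω => dHat φ ψ T w (fun k => X k ω) n (J₀ n)) P)
      atTop
      (𝓝 ((2 - (2 : ℝ) ^ (-(ℓ : ℝ))) * (w ⬝ᵥ (asympVar ψ ℓ d).mulVec w))) := by
  have hd' : d ≤ M := hd.2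
  have hαd : 1 < 2 * α + 2 * d := by linarith [hd.1, hβ.1]
  have hS := hX.shortMemory hf hβ.1 hd'
  have hspec := hX.spectral M (by linarith)
  have ha := tendsto_scaledLength hT hm
  have hJ := tendsto_lowerScale ha hmn
  have hK := Kpsi_pos hW hM hα hd' hαd hS
  have hf0 := hS.pos
  have key := tendsto_variance_sum_log (P := P) w
    (m := fun n => (totalCoeff T ℓ n (J₀ n) : ℝ))
    (tendsto_natCast_atTop_atTop.comp hm)
    (N := fun n i => numCoeff T n (J₀ n + i))
    (eventually_all.2 fun i => by
      filter_upwards [(tendsto_numCoeff (T := T) ha (i : ℕ)).eventually_gt_atTop 0] with n hn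
      exact_mod_cast hn)
    (W := fun n i k ω => waveletCoeff φ ψ (fun l => X l ω) (J₀ n + i) (k : ℤ))
    (fun n => (isGaussianProcess_waveletCoeff hW hGauss).comp_right
      fun p : Fin (ℓ + 1) × ℕ => (J₀ n + p.1, (p.2 : ℤ)))
    (fun n i k => integral_waveletCoeff_eq_zero hW hspec hmean _ _)
    (s := fun n i => (2 ^ (J₀ n + i) : ℝ) ^ (2 * d) *
      (spectralCoeff φ ψ T d fstar (J₀ n + i) 0 0 0).re)
    (eventually_all.2 fun i => by
      filter_upwards [(tendsto_re_spectralCoeff_zero hW hM hα hd' hαd hS hJ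
        (i : ℕ)).eventually_const_lt (by positivity : 0 < fstar 0 * Kpsi ψ d)] with n hn
      positivity)
    (fun n i k => integral_waveletCoeff_sq hW hspec hmean _ _)
    (V := (2 - (2 : ℝ) ^ (-(ℓ : ℝ))) • asympVar ψ ℓ d) fun i j => by
      have main := tendsto_covariance_sum hW hspec hmean hM hα hd' hαd hS hJ ha ℓ
      rcases le_total (i : ℕ) j with hij | hij
      · have hu : (i : ℕ) + Nat.dist i j = j := by rw [Nat.dist_eq_sub_of_le hij]; omega
        have := main i (Nat.dist i j)
        rw [hu] at this
        simpa only [Matrix.smul_apply, asympVar, Matrix.of_apply, min_eq_left hij,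
          smul_eq_mul] using this
      -- The limit is available with the smaller scale index first; the double sum is symmetric
      -- under exchange of the two scales.
      · have hu : (j : ℕ) + Nat.dist i j = i := by rw [Nat.dist_eq_sub_of_le_right hij]; omega
        have := main j (Nat.dist i j)
        rw [hu] at this
        simp only [Matrix.smul_apply, asympVar, Matrix.of_apply, min_eq_right hij,
          smul_eq_mul]
        refine this.congr fun n => ?_
        rw [Finset.sum_comm]
        congr 1
        rw [mul_comm (numCoeff T n (J₀ n + j) : ℝ)⁻¹]
        congr 1
        refine Finset.sum_congr rfl fun k _ => Finset.sum_congr rfl fun l _ => ?_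
        simp only [mul_comm]
  rw [Matrix.smul_mulVec, dotProduct_smul, smul_eq_mul] at key
  exact key
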